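/- **Cauchy–Pompeiu formula on the supersphere.** Let $m\ge 1$, $n\ge 0$. *Algebra.* Let $\mathcal C$ be the real algebra generated by $e_1,\dots,e_m$, $\grave e_1,\dots,\grave e_{2n}$ with $e_je_k+e_ke_j=-2\delta_{jk}$, $\grave e_{2j-1}\grave e_{2k}-\grave e_{2k}\grave e_{2j-1}=\delta_{jk}$, $[\grave e_{2j},\grave e_{2k}]=[\grave e_{2j-1},\grave e_{2k-1}]=0$, $e_j\grave e_k+\grave e_ke_j=0$. Let $\grave x_1,\dots,\grave x_{2n},\grave y_1,\dots,\grave y_{2n}$ be anticommuting variables that commute with $\mathcal C$. For $\underline x\in\mathbb R^m$ put $\underline x=\sum_i x_ie_i$, $\grave{\underline x}=\sum_j\grave x_j\grave e_j$, $x=\underline x+\grave{\underline x}$, and similarly for $y$. Let $$\partial_x=2\sum_{j=1}^n(\grave e_{2j}\partial_{\grave x_{2j-1}}-\grave e_{2j-1}\partial_{\grave x_{2j}})-\sum_{i=1}^me_i\partial_{x_i},\qquad \int_B=\pi^{-n}\partial_{\grave x_{2n}}\cdots\partial_{\grave x_1}.$$ For $W\subset\mathbb R^m$ open, $C^k(W)_{m|2n}$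 is the set of $f=\sum_Af_A(\underline x)\,\grave x_A$ with real coefficients $f_A\in C^k(W)$, $\grave x_A$ being the ordered product of the $\grave x_j$, $j\in A\subset\{1,\dots,2n\}$; $f(y)=\sum_Af_A(\underline y)\,\grave y_A$. *Integrals.* Let $\mathbb B^m$ be the closed unit ball, $\mathbb S^{m-1}$ its boundary, and for $g$ of class $C^j$ near $\mathbb S^{m-1}$ let $$\langle\delta^{(j)}(\underline x^2+1),g\rangle=\frac{d^j}{ds^j}\Big|_{s=1}\Big[\tfrac12 s^{\frac m2-1}\int_{\mathbb S^{m-1}}g(\sqrt s\,\xi)\,d\sigma(\xi)\Big].$$ Put $$\int_{SS}F=2\sum_{j=0}^n\Big\langle\delta^{(j)}(\underline x^2+1),\int_B\frac{\grave{\underline x}^{2j}}{j!}F\Big\rangle,\qquad \int_{SB}F=\int_{\mathbb B^m}\int_BF\,dV+\sum_{j=1}^n\Big\langle\delta^{(j-1)}(\underline x^2+1),\int_B\frac{\grave{\underline x}^{2j}}{j!}F\Big\rangle$$ for $F$ of class $C^n$, respectively of class $C^{\max(n-1,0)}$ near $\mathbb S^{m-1}$ and integrable on $\mathbb B^m$.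 *Kernel.* Let $(\nu_j^{m|0})_{j\ge1}$ be functions on $\mathbb R^m$, scalar-valued for $j$ even and with values in $\mathrm{span}(e_1,\dots,e_m)$ for $j$ odd, locally integrable on $\mathbb R^m$ and smooth on $\mathbb R^m\setminus\{0\}$, such that, with $D=-\sum_ie_i\partial_{x_i}$, $D\nu_1^{m|0}=\delta$ and $D\nu_{j+1}^{m|0}=\nu_j^{m|0}$ for $j\ge 1$ in the sense of distributions (so $\nu_j^{m|0}$ is a fundamental solution of $D^j$). Let $$\nu_1^{m|2n}(x-y)=\pi^n\sum_{k=0}^{n-1}\frac{2\cdot4^kk!}{(n-k-1)!}\,\nu_{2k+2}^{m|0}(\underline x-\underline y)\,(\grave{\underline x}-\grave{\underline y})^{2n-2k-1}+\pi^n\sum_{k=0}^n\frac{4^kk!}{(n-k)!}\,\nu_{2k+1}^{m|0}(\underline x-\underline y)\,(\grave{\underline x}-\grave{\underline y})^{2n-2k}.$$ *Statement.* Such families $(\nu_j^{m|0})$ exist, and for each of them the following holds. Let $\Omega\subset\mathbb R^m$ be open with $\mathbb B^m\subset\Omega$, and let $f\in C^1(\Omega)_{m|2n}$ be of class $C^n$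 in a neighbourhood of $\mathbb S^{m-1}$ (no extra condition if $n\le1$). Then for every $\underline y\in\Omega\setminus\mathbb S^{m-1}$ both integrals below, taken over $x$, exist, and $$\int_{SS}\nu_1^{m|2n}(x-y)\,x\,f(x)+\int_{SB}\nu_1^{m|2n}(x-y)\,\partial_xf(x)=\begin{cases}-f(y)&\text{if }\underline y\in\mathring{\mathbb B}^m,\\0&\text{if }\underline y\in\Omega\setminus\mathbb B^m.\end{cases}$$ -/

import Mathlib

open MeasureTheory
open scoped TensorProduct ContDiff

namespace SuperCauchy

noncomputable section

/-- The bosonic space `ℝ^m` with its Euclidean norm and Lebesgue measure. -/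
abbrev Bos (m : ℕ) : Type := EuclideanSpace ℝ (Fin m)

/-! ### The algebra of Clifford and Weyl generators

The `2n` fermionic indices are numbered from `0`, so that the index `2j` (resp. `2j+1`) stands for
the `(2j+1)`-st (resp. `(2j+2)`-nd) variable in the usual numbering from `1`. -/

/-- `symp a b` is the value of the commutator `[è_a, è_b]`. -/
def symp {N : ℕ} (a b : Fin N) : ℝ :=
  if (a : ℕ) % 2 = 0 ∧ (b : ℕ) = a + 1 then 1
  else if (b : ℕ) % 2 = 0 ∧ (a : ℕ) = b + 1 then -1
  else 0

/-- Free generators: `Sum.inl i` is `e_i`, `Sum.inr a` is `è_a`. -/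
abbrev FreeGen (m n : ℕ) : Type := FreeAlgebra ℝ (Fin m ⊕ Fin (2 * n))

/-- The multiplication relations between the `m` orthogonal Clifford generators `e_i` and the `2n`
symplectic Clifford generators `è_a`. -/
inductive CliffordRel (m n : ℕ) : FreeGen m n → FreeGen m n → Prop
  | orth (i k : Fin m) :
      CliffordRel m n
        (FreeAlgebra.ι ℝ (Sum.inl i) * FreeAlgebra.ι ℝ (Sum.inl k)
          + FreeAlgebra.ι ℝ (Sum.inl k) * FreeAlgebra.ι ℝ (Sum.inl i))
        (algebraMap ℝ (FreeGen m n) (if i = k then -2 else 0))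
  | symplectic (a b : Fin (2 * n)) :
      CliffordRel m n
        (FreeAlgebra.ι ℝ (Sum.inr a) * FreeAlgebra.ι ℝ (Sum.inr b)
          - FreeAlgebra.ι ℝ (Sum.inr b) * FreeAlgebra.ι ℝ (Sum.inr a))
        (algebraMap ℝ (FreeGen m n) (symp a b))
  | mixed (i : Fin m) (a : Fin (2 * n)) :
      CliffordRel m n
        (FreeAlgebra.ι ℝ (Sum.inl i) * FreeAlgebra.ι ℝ (Sum.inr a)
          + FreeAlgebra.ι ℝ (Sum.inr a) * FreeAlgebra.ι ℝ (Sum.inl i))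
        0

/-- The algebra `𝒞` generated by all `e_i` and `è_a`. -/
abbrev CliffordWeyl (m n : ℕ) : Type := RingQuot (CliffordRel m n)

/-- The generator `e_i` or `è_a` of `𝒞`. -/
def cgen {m n : ℕ} (i : Fin m ⊕ Fin (2 * n)) : CliffordWeyl m n :=
  RingQuot.mkAlgHom ℝ (CliffordRel m n) (FreeAlgebra.ι ℝ i)

/-! ### The superalgebra in the two super variables `x` and `y` -/

/-- The Grassmann algebra on the anticommuting variables `x̀_a` (index `Sum.inl a`) and `ỳ_a`
(index `Sum.inr a`). -/
abbrev Grassmann (n : ℕ) : Type := ExteriorAlgebra ℝ (Fin (2 * n) ⊕ Fin (2 * n) → ℝ)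

/-- Grassmann variables commute with all Clifford generators: the ordinary tensor product. -/
abbrev SuperAlg (m n : ℕ) : Type := Grassmann n ⊗[ℝ] CliffordWeyl m n

/-- An anticommuting variable. -/
def gvar {n : ℕ} (c : Fin (2 * n) ⊕ Fin (2 * n)) : Grassmann n :=
  ExteriorAlgebra.ι ℝ (Pi.single c 1)

/-- The anticommuting variable `x̀_a`. -/
def xf {m n : ℕ} (a : Fin (2 * n)) : SuperAlg m n := gvar (Sum.inl a) ⊗ₜ[ℝ] 1

/-- The anticommuting variable `ỳ_a`. -/
def yf {m n : ℕ} (a : Fin (2 * n)) : SuperAlg m n := gvar (Sum.inr a) ⊗ₜ[ℝ] 1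

/-- The orthogonal Clifford generator `e_i`. -/
def eb {m n : ℕ} (i : Fin m) : SuperAlg m n := 1 ⊗ₜ[ℝ] cgen (Sum.inl i)

/-- The symplectic Clifford generator `è_a`. -/
def ef {m n : ℕ} (a : Fin (2 * n)) : SuperAlg m n := 1 ⊗ₜ[ℝ] cgen (Sum.inr a)

/-- The left derivative `∂_{x̀_a}`: it sends `x̀_b w` to `δ_{ab} w - x̀_b ∂_{x̀_a} w` and `ỳ_b w` to
`- ỳ_b ∂_{x̀_a} w`, kills constants and does not see the Clifford generators. -/
def dxf {m n : ℕ} (a : Fin (2 * n)) : SuperAlg m n →ₗ[ℝ] SuperAlg m n :=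
  LinearMap.rTensor (CliffordWeyl m n)
    (CliffordAlgebra.contractLeft (Q := (0 : QuadraticForm ℝ (Fin (2 * n) ⊕ Fin (2 * n) → ℝ)))
      (LinearMap.proj (Sum.inl a)))

/-- The Berezin integral `∫_B = π^{-n} ∂_{x̀_{2n}} ⋯ ∂_{x̀_1}` in the variables `x̀`. -/
def berezin {m n : ℕ} : SuperAlg m n →ₗ[ℝ] SuperAlg m n :=
  ((Real.pi ^ n)⁻¹ : ℝ) •
    (((List.finRange (2 * n)).reverse.map
      (fun a => (dxf a : Module.End ℝ (SuperAlg m n)))).prod : Module.End ℝ (SuperAlg m n))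

/-- The bosonic vector `∑ e_i t_i` of a point of `ℝ^m`. -/
def bvec {m n : ℕ} (t : Fin m → ℝ) : SuperAlg m n := ∑ i, t i • eb i

/-- The fermionic vector variable `x̀ = ∑ x̀_a è_a`. -/
def xfvec {m n : ℕ} : SuperAlg m n := ∑ a, xf a * ef a

/-- The vector variable `x = x̲ + x̀` above the point `x̲`. -/
def xvec {m n : ℕ} (x : Bos m) : SuperAlg m n := bvec (fun i => x i) + xfvec

/-- The fermionic vector variable `x̀ - ỳ`. -/
def xyfvec {m n : ℕ} : SuperAlg m n := ∑ a, (xf a - yf a) * ef a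

/-! ### Superfunctions -/

/-- A superfunction `f = ∑_A f_A x̀_A`, where `A` runs through the sets of fermionic indices and `x̀_A`
is the product of the corresponding variables in increasing order, is given by its coefficients. -/
abbrev SuperFun (m n : ℕ) : Type := Finset (Fin (2 * n)) → Bos m → ℝ

/-- All coefficients of `f` are of class `C^k` on `U`. -/
def SuperFun.CkOn {m n : ℕ} (k : ℕ) (f : SuperFun m n) (U : Set (Bos m)) : Prop :=
  ∀ A, ContDiffOn ℝ k (f A) U

/-- The ordered product of the `z a`, `a ∈ A`. -/
def gprod {m n : ℕ} (z : Fin (2 * n) → SuperAlg m n) (A : Finset (Fin (2 * n))) : SuperAlg m n :=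
  ((A.sort (· ≤ ·)).map z).prod

/-- The value of `f` at the bosonic point `x` with the anticommuting variables named `z`:
`f.eval xf x` is `f(x)` and `f.eval yf y` is `f(y)`. -/
def SuperFun.eval {m n : ℕ} (f : SuperFun m n) (z : Fin (2 * n) → SuperAlg m n) (x : Bos m) :
    SuperAlg m n :=
  ∑ A, f A x • gprod z A

/-- The bosonic partial derivative `∂_{x_i} g` of a real function. -/
def pderiv {m : ℕ} (i : Fin m) (g : Bos m → ℝ) (x : Bos m) : ℝ :=
  fderiv ℝ g x (EuclideanSpace.single i 1)

/-- The super Dirac operator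
`∂_x = 2 ∑_j (è_{2j} ∂_{x̀_{2j-1}} - è_{2j-1} ∂_{x̀_{2j}}) - ∑_i e_i ∂_{x_i}`,
acting from the left on `f`, at the bosonic point `x`. -/
def dirac {m n : ℕ} (f : SuperFun m n) (x : Bos m) : SuperAlg m n :=
  (2 : ℝ) • ∑ j : Fin n,
      (ef ⟨2 * j + 1, by omega⟩ * dxf ⟨2 * j, by omega⟩ (f.eval xf x)
        - ef ⟨2 * j, by omega⟩ * dxf ⟨2 * j + 1, by omega⟩ (f.eval xf x))
    - ∑ i : Fin m, eb i * SuperFun.eval (fun A => pderiv i (f A)) xf x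

/-! ### The Cauchy kernel -/

/-- `s k` is `ν_{2k+2}^{m|0}` (scalar) and `v k i` is the component along `e_i` of the vector-valued
`ν_{2k+1}^{m|0}`. With `D = -∑ e_i ∂_{x_i}` the Dirac operator of `ℝ^m = ℝ^{m|0}`, these are functions on
`ℝ^m`, locally integrable and smooth off the origin, such that `D ν_1 = δ` and `D ν_{j+1} = ν_j` for
`j ≥ 1` in the sense of distributions; so `ν_j` is a fundamental solution of `D^j`. -/
structure IsFundamentalFamily (m : ℕ) (s : ℕ → Bos m → ℝ) (v : ℕ → Fin m → Bos m → ℝ) : Prop where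
  integrable_s : ∀ k, LocallyIntegrable (s k) volume
  integrable_v : ∀ k i, LocallyIntegrable (v k i) volume
  smooth_s : ∀ k, ContDiffOn ℝ ∞ (s k) {0}ᶜ
  smooth_v : ∀ k i, ContDiffOn ℝ ∞ (v k i) {0}ᶜ
  /-- `ν_{2k+1} = D ν_{2k+2}`, that is, `v k i = -∂_{x_i} (s k)`. In particular `ν_{2k+1}` is curl-free,
  so that `D ν_{2k+1}` is its divergence. -/
  dirac_even : ∀ k i (φ : Bos m → ℝ), ContDiff ℝ ∞ φ → HasCompactSupport φ →
    ∫ x, s k x * pderiv i φ x = ∫ x, v k i x * φ x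
  /-- `D ν_1 = δ`. -/
  dirac_one : ∀ φ : Bos m → ℝ, ContDiff ℝ ∞ φ → HasCompactSupport φ →
    -∑ i, ∫ x, v 0 i x * pderiv i φ x = φ 0
  /-- `D ν_{2k+3} = ν_{2k+2}`. -/
  dirac_odd : ∀ k (φ : Bos m → ℝ), ContDiff ℝ ∞ φ → HasCompactSupport φ →
    -∑ i, ∫ x, v (k + 1) i x * pderiv i φ x = ∫ x, s k x * φ x

/-- The kernel `ν_1^{m|2n}(x - y)`, where `z = x̲ - y̲`:
`π^n ∑_{k<n} 2 (4^k k!/(n-k-1)!) ν_{2k+2}(z) (x̀-ỳ)^{2n-2k-1}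
  + π^n ∑_{k≤n} (4^k k!/(n-k)!) ν_{2k+1}(z) (x̀-ỳ)^{2n-2k}`. -/
def kernel {m n : ℕ} (s : ℕ → Bos m → ℝ) (v : ℕ → Fin m → Bos m → ℝ) (z : Bos m) :
    SuperAlg m n :=
  (Real.pi ^ n : ℝ) •
    (∑ k ∈ Finset.range n,
        (2 * (4 ^ k * (k.factorial : ℝ) / ((n - k - 1).factorial : ℝ)) * s k z) •
          (xyfvec : SuperAlg m n) ^ (2 * n - 2 * k - 1)
      + ∑ k ∈ Finset.range (n + 1),
        (4 ^ k * (k.factorial : ℝ) / ((n - k).factorial : ℝ)) •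
          (bvec (fun i => v k i z) * (xyfvec : SuperAlg m n) ^ (2 * n - 2 * k)))

/-! ### Integration over the supersphere and the superball -/

/-- `⟨δ(s + x̲²), g⟩ = ⟨δ(s - r²), g⟩ = ½ s^{(m-2)/2} ∫_{S^{m-1}} g(√s ξ) dσ(ξ)` for `s > 0`, with the
surface measure of the unit sphere. -/
def shell {m : ℕ} (g : Bos m → ℝ) (s : ℝ) : ℝ :=
  1 / 2 * s ^ (((m : ℝ) - 2) / 2) *
    ∫ ξ : Metric.sphere (0 : Bos m) 1, g (Real.sqrt s • (ξ : Bos m))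
      ∂((volume : Measure (Bos m)).toSphere)

/-- `⟨δ^{(j)}(x̲² + 1), g⟩`, the `j`-th derivative at `s = 1` of `⟨δ(s - r²), g⟩`, for `g` of class
`C^j` near the unit sphere. -/
def deltaPairing {m : ℕ} (j : ℕ) (g : Bos m → ℝ) : ℝ := iteratedDeriv j (shell g) 1

/-- `F` is of class `C^k` on a neighbourhood of the unit sphere. (The functions that occur have
values in a finite-dimensional subspace of the algebra; regularity, integrability and integrals are
taken coordinatewise, that is, after applying the linear functionals.) -/
def CkNearSphere {m n : ℕ} (k : ℕ) (F : Bos m → SuperAlg m n) : Prop :=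
  ∃ U : Set (Bos m), IsOpen U ∧ Metric.sphere (0 : Bos m) 1 ⊆ U ∧
    ∀ φ : Module.Dual ℝ (SuperAlg m n), ContDiffOn ℝ k (fun x => φ (F x)) U

/-- `I = ∫_{SS} F = 2 ∫_{ℝ^{m|2n}} δ(x²+1) F`, with
`δ(x²+1) = ∑_{j=0}^n (x̀^{2j}/j!) δ^{(j)}(x̲²+1)`; the integral is over the super variable `x` and may
depend on the anticommuting variables `ỳ`. -/
def IsSupersphereIntegral {m n : ℕ} (F : Bos m → SuperAlg m n) (I : SuperAlg m n) : Prop :=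
  CkNearSphere n F ∧
  ∀ φ : Module.Dual ℝ (SuperAlg m n),
    φ I = 2 * ∑ j ∈ Finset.range (n + 1),
      deltaPairing j (fun x => φ (berezin (((j.factorial : ℝ)⁻¹ • xfvec ^ (2 * j)) * F x)))

/-- `J = ∫_{SB} F = ∫_{ℝ^{m|2n}} H(x²+1) F`, with
`H(x²+1) = H(x̲²+1) + ∑_{j=1}^n (x̀^{2j}/j!) δ^{(j-1)}(x̲²+1)`. -/
def IsSuperballIntegral {m n : ℕ} (F : Bos m → SuperAlg m n) (J : SuperAlg m n) : Prop :=
  CkNearSphere (n - 1) F ∧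
  ∀ φ : Module.Dual ℝ (SuperAlg m n),
    IntegrableOn (fun x => φ (F x)) (Metric.closedBall 0 1) ∧
    φ J = (∫ x in Metric.closedBall (0 : Bos m) 1, φ (berezin (F x)))
      + ∑ j ∈ Finset.Icc 1 n,
        deltaPairing (j - 1)
          (fun x => φ (berezin (((j.factorial : ℝ)⁻¹ • xfvec ^ (2 * j)) * F x)))

end

end SuperCauchy

open SuperCauchy

/-!
# The Cauchy–Pompeiu formula on the supersphere

The formula is the statement `∂_x ν = δ` for the Cauchy kernel `ν = ν_1^{m|2n}`, tested against
`H(x² + 1) f`, where `H` is the Heaviside function and `H(x² + 1)` is its finite Taylor expansion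
`∑_j H^{(j)}(x̲² + 1) x̀^{2j} / j!` in the nilpotent element `x̀²`. By the chain rule,
`∂_x (H(x² + 1) f) = H(x² + 1) ∂_x f + 2 x δ(x² + 1) f`, so that the two terms are the integrands over
the superball and the supersphere, while testing `δ` at `y` gives `-H(1 - ‖y‖²) f(y)`, all higher terms
of the expansion vanishing because `‖y‖ ≠ 1`.

To make this rigorous, `H` is replaced by smooth steps `h_N` (`smoothStep`), for which `h_N(x² + 1) f`
has compactly supported `C¹` coefficients, and then `N → ∞`.

* `SuperCalculus.hasInt_kernel_diracTerm` is the identity `∂_x ν = δ` on test functions `a P` with `a` of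
  class `C¹` with compact support and `P` constant. Bosonic derivatives are moved by means of the
  distributional equations of the family `ν_j^{m|0}` (which hold for `C¹` test functions by
  mollification), fermionic ones by `berezin_fvec_even_fermDirac` and `berezin_fvec_odd_fermDirac`:
  with `z̀ = x̀ - ỳ`, `∫_B z̀^{2l} ∂_x̀ P = -2l ∫_B z̀^{2l-1} P` and
  `∫_B z̀^{2l+1} ∂_x̀ P = (2n - 2l) ∫_B z̀^{2l} P`. The coefficients of the kernel make all terms cancel but one, a
  multiple of `z̀^{2n}`, and `π^n z̀^{2n} / n!` is the fermionic delta function (`IsSubst.berezin`).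
* `SuperCalculus.sum_diracTerm_cutoff` is the chain rule; it uses `x̀^{2n+1} = 0`. Together the two give
  the formula for `h_N`, `SuperCalculus.hasInt_smoothStep`.
* `tendsto_integral_iteratedDeriv_smoothStep`: by the coarea formula in the variable `‖x‖²`, integrals
  against `h_N^{(k+1)}(1 - ‖x‖²)` converge to the pairing with `δ^{(k)}(x̲² + 1)`, since the derivatives
  can be moved to the `C^k` function `shell c` and `h_N'` is an approximate identity.
* Integrals of functions with values in the superalgebra are taken after applying linear functionals;
  all functions that occur are finite sums of real functions times constants (`HasExpansion`), so that
  the values of the two integrals exist as elements of the superalgebra.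

The family `ν_j^{m|0}` is built from radial functions `t^p (A log t + B)` of `t = ‖x‖²` by solving one
linear equation for the coefficients at each step (`exists_coefficients`). That the
singularity at the origin contributes nothing to the distributional derivatives, except for `ν_1`, is
`HasOrder.integral_mul_pderiv`; for `ν_1 = x̲ / (σ ‖x‖^m)`, polar coordinates turn `D ν_1 = δ` into the
fundamental theorem of calculus along rays.
-/

/-! ### Relations in the superalgebra -/

namespace SuperCauchy

section Generators

/-- The Grassmann vector `u` as an element of the superalgebra. -/
noncomputable def gvec {m n : ℕ} (u : Fin (2 * n) ⊕ Fin (2 * n) → ℝ) : SuperAlg m n :=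
  (ExteriorAlgebra.ι ℝ u : Grassmann n) ⊗ₜ[ℝ] 1

variable {m n : ℕ}

/-- `gvec` as a linear map. -/
noncomputable def gvecLin : (Fin (2 * n) ⊕ Fin (2 * n) → ℝ) →ₗ[ℝ] SuperAlg m n where
  toFun := gvec
  map_add' u w := by simp [gvec, TensorProduct.add_tmul]
  map_smul' r u := by simp [gvec, TensorProduct.smul_tmul']

lemma gvec_mul_comm (u w : Fin (2 * n) ⊕ Fin (2 * n) → ℝ) :
    (gvec u : SuperAlg m n) * gvec w = -(gvec w * gvec u) := by
  have h := ExteriorAlgebra.ι_add_mul_swap (R := ℝ) u w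
  rw [eq_neg_iff_add_eq_zero]
  simp only [gvec, Algebra.TensorProduct.tmul_mul_tmul, mul_one, ← TensorProduct.add_tmul, h,
    TensorProduct.zero_tmul]

lemma gvec_mul_ef (u : Fin (2 * n) ⊕ Fin (2 * n) → ℝ) (a : Fin (2 * n)) :
    (gvec u : SuperAlg m n) * ef a = ef a * gvec u := by
  simp [gvec, ef]

lemma gvec_mul_eb (u : Fin (2 * n) ⊕ Fin (2 * n) → ℝ) (i : Fin m) :
    (gvec u : SuperAlg m n) * eb i = eb i * gvec u := by
  simp [gvec, eb]

lemma ef_commutator (a b : Fin (2 * n)) :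
    (ef a : SuperAlg m n) * ef b - ef b * ef a = algebraMap ℝ _ (symp a b) := by
  have h := RingQuot.mkAlgHom_rel ℝ (CliffordRel.symplectic (m := m) a b)
  simp only [map_sub, map_mul, AlgHom.commutes] at h
  change cgen _ * cgen _ - cgen _ * cgen _ = _ at h
  simp only [ef, Algebra.TensorProduct.tmul_mul_tmul, mul_one, ← TensorProduct.tmul_sub, h]
  rw [Algebra.TensorProduct.algebraMap_apply, Algebra.algebraMap_eq_smul_one,
    Algebra.algebraMap_eq_smul_one, TensorProduct.tmul_smul, TensorProduct.smul_tmul']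

lemma eb_mul_ef (i : Fin m) (a : Fin (2 * n)) :
    (eb i : SuperAlg m n) * ef a = -(ef a * eb i) := by
  have h := RingQuot.mkAlgHom_rel ℝ (CliffordRel.mixed (m := m) i a)
  simp only [map_add, map_mul, map_zero] at h
  change cgen _ * cgen _ + cgen _ * cgen _ = _ at h
  rw [eq_neg_iff_add_eq_zero]
  simp only [eb, ef, Algebra.TensorProduct.tmul_mul_tmul, mul_one, ← TensorProduct.tmul_add, h,
    TensorProduct.tmul_zero]

lemma eb_anticommutator (i k : Fin m) :
    (eb i : SuperAlg m n) * eb k + eb k * eb i = algebraMap ℝ _ (if i = k then -2 else 0) := by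
  have h := RingQuot.mkAlgHom_rel ℝ (CliffordRel.orth (n := n) i k)
  simp only [map_add, map_mul, AlgHom.commutes] at h
  change cgen _ * cgen _ + cgen _ * cgen _ = _ at h
  simp only [eb, Algebra.TensorProduct.tmul_mul_tmul, mul_one, ← TensorProduct.tmul_add, h]
  rw [Algebra.TensorProduct.algebraMap_apply, Algebra.algebraMap_eq_smul_one,
    Algebra.algebraMap_eq_smul_one, TensorProduct.tmul_smul, TensorProduct.smul_tmul']

lemma dxf_gvec_mul (c : Fin (2 * n)) (u : Fin (2 * n) ⊕ Fin (2 * n) → ℝ) (w : SuperAlg m n) :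
    dxf c (gvec u * w) = u (Sum.inl c) • w - gvec u * dxf c w := by
  induction w using TensorProduct.induction_on with
  | zero => simp
  | add a b ha hb => simp only [mul_add, map_add, ha, hb, smul_add]; abel
  | tmul g k =>
    simp only [gvec, dxf, Algebra.TensorProduct.tmul_mul_tmul, one_mul, LinearMap.rTensor_tmul]
    have := CliffordAlgebra.contractLeft_ι_mul
      (Q := (0 : QuadraticForm ℝ (Fin (2 * n) ⊕ Fin (2 * n) → ℝ)))
      (LinearMap.proj (R := ℝ) (φ := fun _ => ℝ) (Sum.inl c)) u g
    rw [ExteriorAlgebra.ι, this, TensorProduct.sub_tmul, TensorProduct.smul_tmul']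
    rfl

lemma dxf_ef_mul (c a : Fin (2 * n)) (w : SuperAlg m n) :
    dxf c (ef a * w) = ef a * dxf c w := by
  induction w using TensorProduct.induction_on with
  | zero => simp
  | add a b ha hb => simp only [mul_add, map_add, ha, hb]
  | tmul g k => simp [ef, dxf]

lemma dxf_eb_mul (c : Fin (2 * n)) (i : Fin m) (w : SuperAlg m n) :
    dxf c (eb i * w) = eb i * dxf c w := by
  induction w using TensorProduct.induction_on with
  | zero => simp
  | add a b ha hb => simp only [mul_add, map_add, ha, hb]
  | tmul g k => simp [eb, dxf]

lemma dxf_one (c : Fin (2 * n)) : dxf c (1 : SuperAlg m n) = 0 := by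
  rw [Algebra.TensorProduct.one_def]
  simp only [dxf, LinearMap.rTensor_tmul]
  erw [CliffordAlgebra.contractLeft_one]
  simp

lemma dxf_dxf (c : Fin (2 * n)) (w : SuperAlg m n) : dxf c (dxf c w) = 0 := by
  induction w using TensorProduct.induction_on with
  | zero => simp
  | add a b ha hb => simp only [map_add, ha, hb, add_zero]
  | tmul g k =>
    simp only [dxf, LinearMap.rTensor_tmul]
    erw [CliffordAlgebra.contractLeft_contractLeft]
    simp

lemma dxf_comm (c d : Fin (2 * n)) (w : SuperAlg m n) :
    dxf c (dxf d w) = -dxf d (dxf c w) := by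
  induction w using TensorProduct.induction_on with
  | zero => simp
  | add a b ha hb => simp only [map_add, ha, hb, neg_add]
  | tmul g k =>
    simp only [dxf, LinearMap.rTensor_tmul]
    erw [CliffordAlgebra.contractLeft_comm]
    rw [TensorProduct.neg_tmul]

/-! ### The symplectic form -/

lemma symp_swap {N : ℕ} (a b : Fin N) : symp b a = -symp a b := by
  unfold symp
  split_ifs <;> first | omega | simp

/-- A sum over the fermionic indices, taken over the symplectic pairs. -/
lemma sum_pairs {M : Type*} [AddCommMonoid M] (g : Fin (2 * n) → M) :
    ∑ c, g c = ∑ j : Fin n, (g ⟨2 * j, by omega⟩ + g ⟨2 * j + 1, by omega⟩) := by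
  have hr : ∀ (k : ℕ) (G : ℕ → M), ∑ c ∈ Finset.range (2 * k), G c
      = ∑ j ∈ Finset.range k, (G (2 * j) + G (2 * j + 1)) := by
    intro k G
    induction k with
    | zero => simp
    | succ k ih =>
      rw [show 2 * (k + 1) = 2 * k + 1 + 1 by ring, Finset.sum_range_succ, Finset.sum_range_succ,
        ih, Finset.sum_range_succ, add_assoc]
  have := hr n (fun i => if h : i < 2 * n then g ⟨i, h⟩ else 0)
  rw [Finset.sum_range, Finset.sum_range] at this
  have hg : ∑ c, g c = ∑ c : Fin (2 * n), if h : (c : ℕ) < 2 * n then g ⟨c, h⟩ else 0 := by simp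
  rw [hg, this]
  refine Finset.sum_congr rfl fun j _ => ?_
  rw [dif_pos (by omega), dif_pos (by omega)]

lemma sum_symp_even {M : Type*} [AddCommGroup M] [Module ℝ M] (g : Fin (2 * n) → M) (j : Fin n) :
    ∑ b, symp (⟨2 * j, by omega⟩ : Fin (2 * n)) b • g b = g ⟨2 * j + 1, by omega⟩ := by
  rw [Finset.sum_eq_single ⟨2 * j + 1, by omega⟩]
  · simp [symp]
  · intro b _ hb
    have : (b : ℕ) ≠ 2 * j + 1 := fun h => hb (Fin.ext h)
    have : symp (⟨2 * j, by omega⟩ : Fin (2 * n)) b = 0 := by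
      unfold symp
      rw [if_neg (by simp; omega), if_neg (by simp; omega)]
    rw [this, zero_smul]
  · simp

lemma sum_symp_odd {M : Type*} [AddCommGroup M] [Module ℝ M] (g : Fin (2 * n) → M) (j : Fin n) :
    ∑ b, symp (⟨2 * j + 1, by omega⟩ : Fin (2 * n)) b • g b = -g ⟨2 * j, by omega⟩ := by
  rw [Finset.sum_eq_single ⟨2 * j, by omega⟩]
  · rw [symp_swap]; simp [symp]
  · intro b _ hb
    have : (b : ℕ) ≠ 2 * j := fun h => hb (Fin.ext h)
    have : symp (⟨2 * j + 1, by omega⟩ : Fin (2 * n)) b = 0 := by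
      unfold symp
      rw [if_neg (by simp), if_neg (by simp; omega)]
    rw [this, zero_smul]
  · simp

lemma exists_pair (c : Fin (2 * n)) :
    ∃ j : Fin n, c = ⟨2 * j, by omega⟩ ∨ c = ⟨2 * j + 1, by omega⟩ := by
  refine ⟨⟨c / 2, by omega⟩, ?_⟩
  rcases Nat.mod_two_eq_zero_or_one c with h | h
  · left; ext; simp; omega
  · right; ext; simp; omega

/-- The symplectic matrix squares to minus the identity. -/
lemma sum_symp_sum_symp {M : Type*} [AddCommGroup M] [Module ℝ M] (g : Fin (2 * n) → M)
    (c : Fin (2 * n)) : ∑ b, symp c b • ∑ d, symp b d • g d = -g c := by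
  obtain ⟨j, rfl | rfl⟩ := exists_pair c
  · rw [sum_symp_even, sum_symp_odd]
  · rw [sum_symp_odd, sum_symp_even]

/-! ### An abstract form of the superalgebra -/

/-- The operations of the superalgebra and the relations between them, on an arbitrary real algebra:
Grassmann vectors `gvec u`, orthogonal and symplectic generators `eb i` and `ef a`, and the left
derivatives `dxf c`, which see only the `Sum.inl` coordinates of a Grassmann vector. The computations
below use nothing else; working in an abstract ring also avoids the several non-syntactically equal
group structures of the tensor product `SuperAlg m n`. -/
structure SuperCalculus (m n : ℕ) (A : Type*) [Ring A] [Algebra ℝ A] where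
  gvec : (Fin (2 * n) ⊕ Fin (2 * n) → ℝ) →ₗ[ℝ] A
  eb : Fin m → A
  ef : Fin (2 * n) → A
  dxf : Fin (2 * n) → A →ₗ[ℝ] A
  gvec_mul_comm : ∀ u w, gvec u * gvec w = -(gvec w * gvec u)
  gvec_mul_ef : ∀ u a, gvec u * ef a = ef a * gvec u
  gvec_mul_eb : ∀ u i, gvec u * eb i = eb i * gvec u
  ef_commutator : ∀ a b, ef a * ef b - ef b * ef a = algebraMap ℝ A (symp a b)
  eb_mul_ef : ∀ i a, eb i * ef a = -(ef a * eb i)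
  eb_anticommutator : ∀ i k, eb i * eb k + eb k * eb i = algebraMap ℝ A (if i = k then -2 else 0)
  dxf_gvec_mul : ∀ c u w, dxf c (gvec u * w) = u (Sum.inl c) • w - gvec u * dxf c w
  dxf_ef_mul : ∀ c a w, dxf c (ef a * w) = ef a * dxf c w
  dxf_eb_mul : ∀ c i w, dxf c (eb i * w) = eb i * dxf c w
  dxf_one : ∀ c, dxf c 1 = 0
  dxf_dxf : ∀ c w, dxf c (dxf c w) = 0
  dxf_comm : ∀ c d w, dxf c (dxf d w) = -dxf d (dxf c w)

/-- The superalgebra `SuperAlg m n` with its operations. -/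
noncomputable def superCalculus (m n : ℕ) : SuperCalculus m n (SuperAlg m n) where
  gvec := gvecLin
  eb := eb
  ef := ef
  dxf := dxf
  gvec_mul_comm := gvec_mul_comm
  gvec_mul_ef := gvec_mul_ef
  gvec_mul_eb := gvec_mul_eb
  ef_commutator := ef_commutator
  eb_mul_ef := eb_mul_ef
  eb_anticommutator := eb_anticommutator
  dxf_gvec_mul := dxf_gvec_mul
  dxf_ef_mul := dxf_ef_mul
  dxf_eb_mul := dxf_eb_mul
  dxf_one := dxf_one
  dxf_dxf := dxf_dxf
  dxf_comm := dxf_comm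

end Generators

namespace SuperCalculus
variable {m n : ℕ} {A : Type*} [Ring A] [Algebra ℝ A] (D : SuperCalculus m n A)

/-! ### The Berezin integral -/

/-- The Berezin integral `π^{-n} ∂_{x̀_{2n}} ⋯ ∂_{x̀_1}`. -/
noncomputable def berezin : A →ₗ[ℝ] A :=
  ((Real.pi ^ n)⁻¹ : ℝ) • ((List.finRange (2 * n)).reverse.map
    (fun a => (D.dxf a : Module.End ℝ A))).prod

lemma berezin_apply (w : A) :
    D.berezin w = ((Real.pi ^ n)⁻¹ : ℝ) •
      (((List.finRange (2 * n)).reverse.map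
        (fun a => (D.dxf a : Module.End ℝ A))).prod w) := rfl

/-- The Berezin integral of a derivative vanishes: each derivative occurs in the integral already. -/
lemma berezin_dxf (c : Fin (2 * n)) (w : A) : D.berezin (D.dxf c w) = 0 := by
  have hanti : ∀ (L : List (Fin (2 * n))) (w : A),
      (L.map (fun a => (D.dxf a : Module.End ℝ A))).prod (D.dxf c w) =
        (-1 : ℝ) ^ L.length •
          D.dxf c ((L.map (fun a => (D.dxf a : Module.End ℝ A))).prod w) := by
    intro L
    induction L with
    | nil => simp
    | cons a L ih =>
      intro w
      simp only [List.map_cons, List.prod_cons, Module.End.mul_apply, ih, map_smul,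
        List.length_cons, pow_succ]
      rw [D.dxf_comm, smul_neg, mul_neg_one]
      rw [neg_smul]
  have hzero : ∀ L : List (Fin (2 * n)), c ∈ L → ∀ w : A,
      (L.map (fun a => (D.dxf a : Module.End ℝ A))).prod (D.dxf c w) = 0 := by
    intro L
    induction L with
    | nil => simp
    | cons a L ih =>
      intro hc w
      simp only [List.map_cons, List.prod_cons, Module.End.mul_apply]
      rcases List.mem_cons.1 hc with rfl | h
      · rw [hanti, map_smul, D.dxf_dxf, smul_zero]
      · rw [ih h, map_zero]
  rw [D.berezin_apply, hzero _ (by simp), smul_zero]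

lemma berezin_mul_of_dxf {g : A} (hg : ∀ c (w : A), D.dxf c (g * w) = g * D.dxf c w)
    (w : A) : D.berezin (g * w) = g * D.berezin w := by
  have : ∀ (L : List (Fin (2 * n))) (w : A),
      (L.map (fun a => (D.dxf a : Module.End ℝ A))).prod (g * w) =
        g * (L.map (fun a => (D.dxf a : Module.End ℝ A))).prod w := by
    intro L
    induction L with
    | nil => simp
    | cons a L ih => intro w; simp [ih, hg]
  rw [D.berezin_apply, this, D.berezin_apply, mul_smul_comm]

lemma berezin_eb_mul (i : Fin m) (w : A) : D.berezin (D.eb i * w) = D.eb i * D.berezin w :=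
  D.berezin_mul_of_dxf (fun c w => D.dxf_eb_mul c i w) w

lemma berezin_ef_mul (a : Fin (2 * n)) (w : A) :
    D.berezin (D.ef a * w) = D.ef a * D.berezin w :=
  D.berezin_mul_of_dxf (fun c w => D.dxf_ef_mul c a w) w

/-! ### The fermionic Dirac operator -/

/-- The fermionic part `2 ∑_j (è_{2j} ∂_{x̀_{2j-1}} - è_{2j-1} ∂_{x̀_{2j}})` of the super Dirac operator,
written with the symplectic matrix. -/
noncomputable def fermDirac : A →ₗ[ℝ] A :=
  (2 : ℝ) • ∑ c, ∑ b, symp c b • (LinearMap.mulLeft ℝ (D.ef b)) ∘ₗ (D.dxf c)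

lemma fermDirac_apply (w : A) :
    D.fermDirac w = (2 : ℝ) • ∑ c, ∑ b, symp c b • (D.ef b * D.dxf c w) := by
  simp [fermDirac]

/-- The fermionic Dirac operator, summed over the symplectic pairs. -/
lemma fermDirac_eq (w : A) :
    D.fermDirac w = (2 : ℝ) • ∑ j : Fin n,
      (D.ef ⟨2 * j + 1, by omega⟩ * D.dxf ⟨2 * j, by omega⟩ w
        - D.ef ⟨2 * j, by omega⟩ * D.dxf ⟨2 * j + 1, by omega⟩ w) := by
  rw [D.fermDirac_apply, sum_pairs]
  congr 1
  refine Finset.sum_congr rfl fun j _ => ?_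
  rw [sum_symp_even (fun b => D.ef b * D.dxf ⟨2 * j, by omega⟩ w),
    sum_symp_odd (fun b => D.ef b * D.dxf ⟨2 * j + 1, by omega⟩ w),
    sub_eq_add_neg]

lemma berezin_fermDirac (w : A) : D.berezin (D.fermDirac w) = 0 := by
  simp [D.fermDirac_apply, map_sum, D.berezin_ef_mul, D.berezin_dxf]

/-! ### Fermionic vector variables -/

/-- The fermionic vector `∑_a θ_a è_a`. -/
noncomputable def fvec (θ : Fin (2 * n) → (Fin (2 * n) ⊕ Fin (2 * n) → ℝ)) : A :=
  ∑ a, D.gvec (θ a) * D.ef a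

/-- `∂_{x̀_c} θ_a = δ_{ac}` for all `a` and `c`. -/
def IsDual (θ : Fin (2 * n) → (Fin (2 * n) ⊕ Fin (2 * n) → ℝ)) : Prop :=
  ∀ a c, θ a (Sum.inl c) = if a = c then 1 else 0

lemma isDual_xf : IsDual (fun a : Fin (2 * n) => Pi.single (Sum.inl a) 1) := by
  intro a c
  simp [Pi.single_apply, eq_comm]

lemma isDual_xyf : IsDual (fun a : Fin (2 * n) =>
    (Pi.single (Sum.inl a) 1 - Pi.single (Sum.inr a) 1 : Fin (2 * n) ⊕ Fin (2 * n) → ℝ)) := by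
  intro a c
  simp [Pi.single_apply, eq_comm]

variable (θ : Fin (2 * n) → (Fin (2 * n) ⊕ Fin (2 * n) → ℝ))

lemma fvec_mul (w : A) : D.fvec θ * w = ∑ a, D.gvec (θ a) * D.ef a * w := by
  rw [fvec, Finset.sum_mul]

lemma fvec_mul_eb (i : Fin m) : D.fvec θ * D.eb i = -(D.eb i * D.fvec θ) := by
  simp only [fvec, Finset.sum_mul, Finset.mul_sum, ← Finset.sum_neg_distrib]
  refine Finset.sum_congr rfl fun a _ => ?_
  rw [mul_assoc, ← neg_eq_iff_eq_neg.2 (D.eb_mul_ef i a), mul_neg, ← mul_assoc, D.gvec_mul_eb, mul_assoc]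

/-- The square of a fermionic vector is free of the symplectic generators, since the Grassmann
variables anticommute and only commutators of the generators survive. -/
lemma two_smul_fvec_sq : (2 : ℝ) • D.fvec θ ^ 2 =
    ∑ a, ∑ b, symp a b • (D.gvec (θ a) * D.gvec (θ b)) := by
  have h1 : D.fvec θ ^ 2 =
      ∑ a, ∑ b, (D.gvec (θ a) * D.gvec (θ b)) * (D.ef a * D.ef b) := by
    simp only [sq, fvec, Finset.sum_mul_sum]
    refine Finset.sum_congr rfl fun a _ => Finset.sum_congr rfl fun b _ => ?_
    rw [mul_assoc, ← mul_assoc (D.ef a), ← D.gvec_mul_ef]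
    simp only [mul_assoc]
  have h2 : D.fvec θ ^ 2 =
      -∑ a, ∑ b, (D.gvec (θ a) * D.gvec (θ b)) * (D.ef b * D.ef a) := by
    rw [h1, Finset.sum_comm, ← Finset.sum_neg_distrib]
    refine Finset.sum_congr rfl fun a _ => ?_
    rw [← Finset.sum_neg_distrib]
    refine Finset.sum_congr rfl fun b _ => ?_
    rw [D.gvec_mul_comm (θ b), neg_mul]
  rw [two_smul]
  nth_rewrite 1 [h1]
  rw [h2, ← sub_eq_add_neg, ← Finset.sum_sub_distrib]
  refine Finset.sum_congr rfl fun a _ => ?_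
  rw [← Finset.sum_sub_distrib]
  refine Finset.sum_congr rfl fun b _ => ?_
  rw [← mul_sub, D.ef_commutator, Algebra.algebraMap_eq_smul_one, mul_smul_comm, mul_one]

lemma fvec_sq_eq_half : D.fvec θ ^ 2 =
    (1 / 2 : ℝ) • ∑ a, ∑ b, symp a b • (D.gvec (θ a) * D.gvec (θ b)) := by
  rw [← D.two_smul_fvec_sq, smul_smul]; norm_num

/-- `(∑ θ_a è_a)² = ∑_j θ_{2j-1} θ_{2j}`. -/
lemma fvec_sq_eq_sum : D.fvec θ ^ 2 =
    ∑ j : Fin n, D.gvec (θ ⟨2 * j, by omega⟩) * D.gvec (θ ⟨2 * j + 1, by omega⟩) := by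
  rw [D.fvec_sq_eq_half, sum_pairs, Finset.smul_sum]
  refine Finset.sum_congr rfl fun j _ => ?_
  rw [sum_symp_even (fun b => D.gvec (θ ⟨2 * j, by omega⟩) * D.gvec (θ b)),
    sum_symp_odd (fun b => D.gvec (θ ⟨2 * j + 1, by omega⟩) * D.gvec (θ b)),
    D.gvec_mul_comm (θ ⟨2 * j + 1, _⟩), neg_neg, ← two_smul ℝ, smul_smul]
  norm_num

lemma gvec_mul_gvec_comm_gvec (u w t : Fin (2 * n) ⊕ Fin (2 * n) → ℝ) :
    Commute ((D.gvec u : A) * D.gvec w) (D.gvec t) := by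
  change _ * _ = _ * _
  rw [mul_assoc, D.gvec_mul_comm w, mul_neg, ← mul_assoc, D.gvec_mul_comm u t, neg_mul, neg_neg, mul_assoc]

lemma fvec_sq_comm_gvec (t : Fin (2 * n) ⊕ Fin (2 * n) → ℝ) :
    Commute (D.fvec θ ^ 2) (D.gvec t) := by
  rw [D.fvec_sq_eq_sum]
  exact Commute.sum_left _ _ _ fun j _ => D.gvec_mul_gvec_comm_gvec _ _ _

lemma fvec_sq_comm_ef (a : Fin (2 * n)) : Commute (D.fvec θ ^ 2) (D.ef a) := by
  rw [D.fvec_sq_eq_sum]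
  exact Commute.sum_left _ _ _ fun j _ =>
    Commute.mul_left (D.gvec_mul_ef _ _) (D.gvec_mul_ef _ _)

lemma fvec_sq_comm_eb (i : Fin m) : Commute (D.fvec θ ^ 2) (D.eb i) := by
  rw [D.fvec_sq_eq_sum]
  exact Commute.sum_left _ _ _ fun j _ =>
    Commute.mul_left (D.gvec_mul_eb _ _) (D.gvec_mul_eb _ _)

lemma fvec_sq_comm_fvec (θ' : Fin (2 * n) → (Fin (2 * n) ⊕ Fin (2 * n) → ℝ)) :
    Commute (D.fvec θ ^ 2) (D.fvec θ') :=
  Commute.sum_right _ _ _ fun _ _ => (D.fvec_sq_comm_gvec θ _).mul_right (D.fvec_sq_comm_ef θ _)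

variable {θ}

/-- `∂_{x̀_c}` is a derivation on multiples of the square of a fermionic vector. -/
lemma dxf_fvec_sq_mul (hθ : IsDual θ) (c : Fin (2 * n)) (w : A) :
    D.dxf c (D.fvec θ ^ 2 * w) = (∑ b, symp c b • D.gvec (θ b)) * w + D.fvec θ ^ 2 * D.dxf c w := by
  have h : ∀ a b : Fin (2 * n), D.dxf c (D.gvec (θ a) * D.gvec (θ b) * w) =
      ((if a = c then (1 : ℝ) else 0) • (D.gvec (θ b) * w)
        - (if b = c then (1 : ℝ) else 0) • (D.gvec (θ a) * w))
        + D.gvec (θ a) * D.gvec (θ b) * D.dxf c w := by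
    intro a b
    rw [mul_assoc, D.dxf_gvec_mul, D.dxf_gvec_mul, hθ a c, hθ b c, mul_sub, mul_smul_comm]
    rw [mul_assoc]; abel
  have h3 : ∑ a, ∑ b, symp a b • ((if b = c then (1 : ℝ) else 0) • (D.gvec (θ a) * w)) =
      -∑ b, symp c b • (D.gvec (θ b) * w) := by
    simp only [ite_smul, one_smul, zero_smul, smul_ite, smul_zero, Finset.sum_ite_eq',
      Finset.mem_univ, if_true, ← Finset.sum_neg_distrib]
    refine Finset.sum_congr rfl fun a _ => ?_
    rw [symp_swap c a, neg_smul]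
  have h4 : ∑ a, ∑ b, symp a b • ((if a = c then (1 : ℝ) else 0) • (D.gvec (θ b) * w)) =
      ∑ b, symp c b • (D.gvec (θ b) * w) := by
    rw [Finset.sum_comm]
    simp only [ite_smul, one_smul, zero_smul, smul_ite, smul_zero, Finset.sum_ite_eq',
      Finset.mem_univ, if_true]
  rw [D.fvec_sq_eq_half, smul_mul_assoc, map_smul, smul_mul_assoc]
  simp only [Finset.sum_mul, smul_mul_assoc, map_sum, map_smul, h, smul_add, smul_sub,
    Finset.sum_add_distrib, Finset.sum_sub_distrib]
  rw [h3, h4, smul_neg, sub_neg_eq_add, ← two_smul ℝ, smul_smul]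
  norm_num

lemma dxf_fvec_pow_mul (hθ : IsDual θ) (c : Fin (2 * n)) (l : ℕ) (w : A) :
    D.dxf c (D.fvec θ ^ (2 * l) * w) =
      (l : ℝ) • ((∑ b, symp c b • D.gvec (θ b)) * (D.fvec θ ^ (2 * (l - 1)) * w))
        + D.fvec θ ^ (2 * l) * D.dxf c w := by
  induction l generalizing w with
  | zero => simp
  | succ l ih =>
    have hc : ∀ u : A, (∑ b, symp c b • D.gvec (θ b)) * (D.fvec θ ^ 2 * u) =
        D.fvec θ ^ 2 * ((∑ b, symp c b • D.gvec (θ b)) * u) := by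
      intro u
      rw [← mul_assoc, ← mul_assoc]
      congr 1
      exact (Commute.sum_right _ _ _ fun b _ => (D.fvec_sq_comm_gvec θ _).smul_right _).symm
    rw [show 2 * (l + 1) = 2 + 2 * l by ring, pow_add, mul_assoc, D.dxf_fvec_sq_mul hθ, ih, mul_add,
      mul_smul_comm, ← hc]
    rcases l with _ | l
    · simp
    · have : D.fvec θ ^ 2 * (D.fvec θ ^ (2 * (l + 1 - 1)) * w) = D.fvec θ ^ (2 * (l + 1)) * w := by
        rw [← mul_assoc, ← pow_add]; congr 2; simp; ring
      rw [this, ← add_assoc, mul_assoc]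
      congr 1
      rw [add_tsub_cancel_right]
      push_cast
      rw [add_smul ((l : ℝ) + 1) 1, one_smul, add_comm]

/-- Contracting `∂_{x̀_c} (x̀²) = ∑_d symp c d θ_d` with the symplectic generators returns the vector. -/
lemma gamma_eta (w : A) :
    ∑ c, ∑ b, symp c b • (D.ef b * ((∑ d, symp c d • D.gvec (θ d)) * w)) = D.fvec θ * w := by
  rw [Finset.sum_comm]
  simp only [fvec, Finset.sum_mul]
  refine Finset.sum_congr rfl fun b _ => ?_
  have := sum_symp_sum_symp (fun d => D.ef b * (D.gvec (θ d) * w)) b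
  have h : ∀ c, symp c b • (D.ef b * ∑ d, symp c d • D.gvec (θ d) * w) =
      -(symp b c • ∑ d, symp c d • (D.ef b * (D.gvec (θ d) * w))) := by
    intro c
    rw [symp_swap b c, neg_smul, Finset.mul_sum]
    simp only [smul_mul_assoc, mul_smul_comm]
  simp only [h, Finset.sum_neg_distrib, this, neg_neg]
  rw [← mul_assoc, D.gvec_mul_ef]

/-- The Dirac operator acts on even powers of a fermionic vector like `d/dz`. -/
lemma fermDirac_fvec_pow_mul (hθ : IsDual θ) (l : ℕ) (w : A) :
    D.fermDirac (D.fvec θ ^ (2 * l) * w) =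
      (2 * l : ℝ) • (D.fvec θ * (D.fvec θ ^ (2 * (l - 1)) * w)) + D.fvec θ ^ (2 * l) * D.fermDirac w := by
  have hc : ∀ b, Commute (D.fvec θ ^ (2 * l)) (D.ef b) := fun b => by
    rw [pow_mul]; exact (D.fvec_sq_comm_ef θ b).pow_left l
  rw [D.fermDirac_apply, D.fermDirac_apply, ← D.gamma_eta]
  simp only [D.dxf_fvec_pow_mul hθ, mul_add, smul_add, Finset.sum_add_distrib, Finset.smul_sum,
    mul_smul_comm, Finset.mul_sum]
  congr 1
  · refine Finset.sum_congr rfl fun c _ => Finset.sum_congr rfl fun b _ => ?_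
    simp only [smul_smul]
    ring_nf
  · refine Finset.sum_congr rfl fun c _ => Finset.sum_congr rfl fun b _ => ?_
    rw [← mul_assoc, ← (hc b).eq, mul_assoc]

/-- Integration by parts against an even power. -/
lemma berezin_fvec_even_fermDirac (hθ : IsDual θ) (l : ℕ) (w : A) :
    D.berezin (D.fvec θ ^ (2 * l) * D.fermDirac w) =
      -((2 * l : ℝ) • D.berezin (D.fvec θ * (D.fvec θ ^ (2 * (l - 1)) * w))) := by
  have := D.berezin_fermDirac (D.fvec θ ^ (2 * l) * w)
  rw [D.fermDirac_fvec_pow_mul hθ, map_add, map_smul] at this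
  exact eq_neg_of_add_eq_zero_right this

/-- The symplectic generators satisfy `∑_j [è_{2j-1}, è_{2j}] = n`. -/
lemma gamma_trace (w : A) :
    ∑ c, ∑ b, symp c b • (D.ef c * (D.ef b * w)) = (n : ℝ) • w := by
  rw [sum_pairs]
  have : ∀ j : Fin n, (∑ b, symp (⟨2 * j, by omega⟩ : Fin (2 * n)) b •
        (D.ef (⟨2 * j, by omega⟩ : Fin (2 * n)) * (D.ef b * w)) +
      ∑ b, symp (⟨2 * j + 1, by omega⟩ : Fin (2 * n)) b •
        (D.ef (⟨2 * j + 1, by omega⟩ : Fin (2 * n)) * (D.ef b * w))) = w := by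
    intro j
    rw [sum_symp_even (fun b => D.ef (⟨2 * j, by omega⟩ : Fin (2 * n)) * (D.ef b * w)),
      sum_symp_odd (fun b => D.ef (⟨2 * j + 1, by omega⟩ : Fin (2 * n)) * (D.ef b * w)),
      ← sub_eq_add_neg, ← mul_assoc, ← mul_assoc, ← sub_mul, D.ef_commutator]
    simp [symp]
  rw [Finset.sum_congr rfl fun j _ => this j]
  simp [Nat.cast_smul_eq_nsmul]

/-- Integration by parts against an odd power; the factor `2n - 2l` comes from the trace `gamma_trace`
and from the derivative of the even power. -/
lemma berezin_fvec_odd_fermDirac (hθ : IsDual θ) (l : ℕ) (w : A) :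
    D.berezin (D.fvec θ * (D.fvec θ ^ (2 * l) * D.fermDirac w)) =
      (2 * n - 2 * l : ℝ) • D.berezin (D.fvec θ ^ (2 * l) * w) := by
  have hc : ∀ t, Commute (D.fvec θ ^ (2 * l)) (D.gvec t) := fun b => by
    rw [pow_mul]; exact (D.fvec_sq_comm_gvec θ b).pow_left l
  have hce : ∀ b, Commute (D.fvec θ ^ (2 * l)) (D.ef b) := fun b => by
    rw [pow_mul]; exact (D.fvec_sq_comm_ef θ b).pow_left l
  have hsw : ∀ a b t X, D.ef a * (D.ef b * (D.gvec t * X)) = D.gvec t * (D.ef a * (D.ef b * X)) := by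
    intro a b t X
    rw [← mul_assoc (D.ef b), ← D.gvec_mul_ef, mul_assoc, ← mul_assoc (D.ef a), ← D.gvec_mul_ef,
      mul_assoc]
  -- The integral of the total derivative `W` vanishes; the product rule splits `W` into `e1`, `e2`, `e3`.
  set W : A := ∑ a, ∑ c, ∑ b, symp c b •
    (D.ef a * (D.ef b * D.dxf c (D.gvec (θ a) * (D.fvec θ ^ (2 * l) * w)))) with hW
  have hW0 : D.berezin W = 0 := by
    simp [hW, map_sum, D.berezin_ef_mul, D.berezin_dxf]
  have e1 : ∑ a, ∑ c, ∑ b, symp c b • (D.ef a * (D.ef b *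
      ((if a = c then (1 : ℝ) else 0) • (D.fvec θ ^ (2 * l) * w)))) =
      (n : ℝ) • (D.fvec θ ^ (2 * l) * w) := by
    rw [← D.gamma_trace]
    refine Finset.sum_congr rfl fun a _ => ?_
    rw [Finset.sum_eq_single a]
    · simp
    · intro c _ hca
      simp [Ne.symm hca]
    · simp
  have e2 : ∑ a, ∑ c, ∑ b, symp c b • (D.ef a * (D.ef b * (D.gvec (θ a) * ((l : ℝ) •
      ((∑ d, symp c d • D.gvec (θ d)) * (D.fvec θ ^ (2 * (l - 1)) * w)))))) =
      (l : ℝ) • (D.fvec θ ^ (2 * l) * w) := by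
    rcases l with _ | l
    · simp
    · have : D.fvec θ ^ (2 * (l + 1)) * w =
          D.fvec θ * (D.fvec θ * (D.fvec θ ^ (2 * (l + 1 - 1)) * w)) := by
        rw [← mul_assoc, ← mul_assoc, ← sq, ← pow_add]; congr 2; simp; ring
      rw [this, ← D.gamma_eta (D.fvec θ ^ (2 * (l + 1 - 1)) * w), D.fvec_mul, Finset.smul_sum]
      refine Finset.sum_congr rfl fun a _ => ?_
      rw [Finset.mul_sum, Finset.smul_sum]
      refine Finset.sum_congr rfl fun c _ => ?_
      rw [Finset.mul_sum, Finset.smul_sum]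
      refine Finset.sum_congr rfl fun b _ => ?_
      simp only [mul_smul_comm]
      rw [smul_comm]
      congr 2
      rw [hsw, mul_assoc]
  have e3 : ∑ a, ∑ c, ∑ b, symp c b • (D.ef a * (D.ef b * (D.gvec (θ a) *
      (D.fvec θ ^ (2 * l) * D.dxf c w)))) =
      (1 / 2 : ℝ) • (D.fvec θ * (D.fvec θ ^ (2 * l) * D.fermDirac w)) := by
    rw [D.fermDirac_apply, mul_smul_comm, mul_smul_comm, smul_smul, show (1 / 2 : ℝ) * 2 = 1 by norm_num,
      one_smul]
    rw [D.fvec_mul]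
    refine Finset.sum_congr rfl fun a _ => ?_
    rw [Finset.mul_sum, Finset.mul_sum]
    refine Finset.sum_congr rfl fun c _ => ?_
    rw [Finset.mul_sum, Finset.mul_sum]
    refine Finset.sum_congr rfl fun b _ => ?_
    simp only [mul_smul_comm]
    congr 1
    rw [hsw, mul_assoc, ← mul_assoc (D.fvec θ ^ (2 * l)), (hce b).eq, mul_assoc]
  have hW2 : W = (n : ℝ) • (D.fvec θ ^ (2 * l) * w)
      - ((l : ℝ) • (D.fvec θ ^ (2 * l) * w)
        + (1 / 2 : ℝ) • (D.fvec θ * (D.fvec θ ^ (2 * l) * D.fermDirac w))) := by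
    rw [← e1, ← e2, ← e3]
    simp only [hW, D.dxf_gvec_mul, D.dxf_fvec_pow_mul hθ, hθ _ _, mul_sub, mul_add, smul_sub, smul_add,
      Finset.sum_sub_distrib, Finset.sum_add_distrib]
  rw [hW2, map_sub, map_add, map_smul, map_smul, map_smul] at hW0
  have h2 := congrArg (fun u => (2 : ℝ) • u) hW0
  simp only [smul_sub, smul_add, smul_smul, smul_zero] at h2
  norm_num at h2
  rw [sub_smul, eq_sub_iff_add_eq, add_comm]
  exact (sub_eq_zero.1 h2).symm

end SuperCalculus

/-! ### The top power of a fermionic vector -/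

/-- Powers of a sum of commuting elements of square zero. -/
lemma sum_range_pow_of_sq_eq_zero {A : Type*} [Ring A] (q : ℕ → A)
    (hq : ∀ i j, Commute (q i) (q j)) (hq0 : ∀ i, q i * q i = 0) (k : ℕ) :
    (∑ i ∈ Finset.range k, q i) ^ k = (k.factorial : A) * ((List.range k).map q).prod ∧
      (∑ i ∈ Finset.range k, q i) ^ (k + 1) = 0 := by
  have hadd : ∀ (S r : A), Commute S r → r * r = 0 → ∀ l : ℕ,
      (S + r) ^ (l + 1) = S ^ (l + 1) + ((l + 1 : ℕ) : A) * (S ^ l * r) := by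
    intro S r hSr hr l
    induction l with
    | zero => simp
    | succ l ih =>
      rw [pow_succ, ih, add_mul, mul_add, mul_add, ← pow_succ, mul_assoc (((l + 1 : ℕ)) : A) _ S,
        mul_assoc _ r S, ← hSr.eq, ← mul_assoc _ S r, ← pow_succ, mul_assoc (((l + 1 : ℕ)) : A) _ r,
        mul_assoc _ r r, hr]
      push_cast
      noncomm_ring
  induction k with
  | zero => simp
  | succ k ih =>
    obtain ⟨h1, h2⟩ := ih
    have hc : Commute (∑ i ∈ Finset.range k, q i) (q k) := Commute.sum_left _ _ _ fun i _ => hq i k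
    rw [Finset.sum_range_succ, hadd _ _ hc (hq0 k), hadd _ _ hc (hq0 k), pow_succ _ (k + 1), h2, h1]
    constructor
    · rw [List.range_succ, List.map_append, List.prod_append, zero_add, Nat.factorial_succ]
      push_cast
      simp only [List.map_cons, List.map_nil, List.prod_cons, List.prod_nil, mul_one, mul_assoc]
    · simp

namespace SuperCalculus
variable {m n : ℕ} {A : Type*} [Ring A] [Algebra ℝ A] (D : SuperCalculus m n A)

lemma gvec_mul_self (u : Fin (2 * n) ⊕ Fin (2 * n) → ℝ) : D.gvec u * D.gvec u = 0 := by
  have h := D.gvec_mul_comm u u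
  rw [eq_neg_iff_add_eq_zero, ← two_smul ℝ] at h
  exact (smul_eq_zero.1 h).resolve_left (by norm_num)

section Top
variable (θ : Fin (2 * n) → (Fin (2 * n) ⊕ Fin (2 * n) → ℝ))

/-- `gvec (θ a)`, extended by zero to all natural indices. -/
noncomputable def gvecNat (i : ℕ) : A := if h : i < 2 * n then D.gvec (θ ⟨i, h⟩) else 0

lemma fvec_sq_eq_range : D.fvec θ ^ 2 =
    ∑ j ∈ Finset.range n, D.gvecNat θ (2 * j) * D.gvecNat θ (2 * j + 1) := by
  rw [D.fvec_sq_eq_sum, Finset.sum_range]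
  refine Finset.sum_congr rfl fun j _ => ?_
  rw [gvecNat, gvecNat, dif_pos (by omega), dif_pos (by omega)]

lemma gvecNat_comm (i j : ℕ) : D.gvecNat θ i * D.gvecNat θ j = -(D.gvecNat θ j * D.gvecNat θ i) := by
  unfold gvecNat
  split_ifs <;> simp [D.gvec_mul_comm (θ ⟨i, _⟩)]

lemma gvecNat_mul_self (i : ℕ) : D.gvecNat θ i * D.gvecNat θ i = 0 := by
  unfold gvecNat
  split_ifs <;> simp [D.gvec_mul_self]

/-- The square of a fermionic vector is a sum of `n` commuting elements of square zero; hence its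
`n`-th power is `n!` times their product, and the next one vanishes. -/
lemma fvec_pow_top : D.fvec θ ^ (2 * n) =
      (n.factorial : A) * ((List.finRange (2 * n)).map (fun a => D.gvec (θ a))).prod ∧
    D.fvec θ ^ (2 * (n + 1)) = 0 := by
  have hc3 : ∀ i j k, Commute (D.gvecNat θ i * D.gvecNat θ j) (D.gvecNat θ k) := by
    intro i j k
    change _ * _ = _ * _
    rw [mul_assoc, D.gvecNat_comm θ j, mul_neg, ← mul_assoc, D.gvecNat_comm θ i k, neg_mul, neg_neg,
      mul_assoc]
  have h := sum_range_pow_of_sq_eq_zero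
    (fun j => D.gvecNat θ (2 * j) * D.gvecNat θ (2 * j + 1))
    (fun i j => (hc3 _ _ _).mul_right (hc3 _ _ _))
    (fun i => by
      rw [← mul_assoc, (hc3 _ _ _).eq, ← mul_assoc, D.gvecNat_mul_self, zero_mul, zero_mul]) n
  rw [← D.fvec_sq_eq_range, ← pow_mul, ← pow_mul] at h
  refine ⟨?_, h.2⟩
  rw [h.1]
  congr 1
  have h1 : ∀ k : ℕ, ((List.range k).map
      (fun j => D.gvecNat θ (2 * j) * D.gvecNat θ (2 * j + 1))).prod =
      ((List.range (2 * k)).map (D.gvecNat θ)).prod := by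
    intro k
    induction k with
    | zero => simp
    | succ k ih =>
      rw [show 2 * (k + 1) = 2 * k + 1 + 1 by ring]
      simp [List.range_succ, ih]
  rw [h1, ← List.map_coe_finRange_eq_range, List.map_map]
  congr 1
  refine List.map_congr_left fun a _ => ?_
  simp [gvecNat]

variable {θ}

/-- The top power of a fermionic vector is annihilated by its components: apply `∂_{x̀_c}` to the
vanishing power one higher. -/
lemma fvec_top_mul_gvec (hθ : IsDual θ) (a : Fin (2 * n)) :
    D.fvec θ ^ (2 * n) * D.gvec (θ a) = 0 := by
  have hη : ∀ c, (∑ b, symp c b • D.gvec (θ b)) * D.fvec θ ^ (2 * n) = 0 := by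
    intro c
    have h := D.dxf_fvec_pow_mul hθ c (n + 1) 1
    rw [(D.fvec_pow_top θ).2, zero_mul, zero_mul, map_zero, add_zero, mul_one,
      add_tsub_cancel_right] at h
    exact (smul_eq_zero.1 h.symm).resolve_left (by positivity)
  have h2 := sum_symp_sum_symp (fun d => D.gvec (θ d)) a
  have hc : Commute (D.fvec θ ^ (2 * n)) (D.gvec (θ a)) := by
    rw [pow_mul]; exact (D.fvec_sq_comm_gvec θ _).pow_left n
  rw [hc.eq, ← neg_neg (D.gvec (θ a)), ← h2, neg_mul, Finset.sum_mul]
  simp [hη]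

/-- A fermionic vector is nilpotent: its power `2n + 1` vanishes. -/
lemma fvec_pow_odd_top (hθ : IsDual θ) : D.fvec θ ^ (2 * n) * D.fvec θ = 0 := by
  rw [show D.fvec θ ^ (2 * n) * D.fvec θ =
    ∑ a, D.fvec θ ^ (2 * n) * D.gvec (θ a) * D.ef a by
      nth_rewrite 2 [fvec]; simp only [Finset.mul_sum, mul_assoc]]
  simp [D.fvec_top_mul_gvec hθ]

/-- The Berezin integral picks the coefficient of the top power. -/
lemma berezin_fvec_top_mul (hθ : IsDual θ) (w : A) (hw : ∀ c, D.dxf c w = 0) :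
    (Real.pi ^ n / n.factorial : ℝ) • D.berezin (D.fvec θ ^ (2 * n) * w) = w := by
  have key : ∀ L : List (Fin (2 * n)), L.Nodup →
      (L.reverse.map (fun a => (D.dxf a : Module.End ℝ A))).prod
        ((L.map (fun a => D.gvec (θ a))).prod * w) = w := by
    intro L
    induction L with
    | nil => simp
    | cons a L ih =>
      intro hL
      have hkill : ∀ L' : List (Fin (2 * n)), a ∉ L' →
          D.dxf a ((L'.map (fun a => D.gvec (θ a))).prod * w) = 0 := by
        intro L'
        induction L' with
        | nil => simp [hw]
        | cons b L' ih' =>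
          intro hb
          rw [List.mem_cons, not_or] at hb
          rw [List.map_cons, List.prod_cons, mul_assoc, D.dxf_gvec_mul, ih' hb.2, hθ b a,
            if_neg (Ne.symm hb.1)]
          simp
      rw [List.nodup_cons] at hL
      rw [List.reverse_cons, List.map_append, List.prod_append, Module.End.mul_apply]
      simp only [List.map_cons, List.map_nil, List.prod_cons, List.prod_nil, mul_one]
      rw [mul_assoc, D.dxf_gvec_mul, hkill L hL.1, hθ a a, if_pos rfl, one_smul, mul_zero, sub_zero,
        ih hL.2]
  rw [(D.fvec_pow_top θ).1, ← nsmul_eq_mul, smul_mul_assoc, map_nsmul, D.berezin_apply,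
    key _ (List.nodup_finRange _), ← Nat.cast_smul_eq_nsmul ℝ, smul_smul, smul_smul]
  have : (n.factorial : ℝ) ≠ 0 := by positivity
  have : (Real.pi ^ n : ℝ) ≠ 0 := by positivity
  rw [show Real.pi ^ n / (n.factorial : ℝ) * (n.factorial : ℝ) * (Real.pi ^ n)⁻¹ = 1 by field_simp,
    one_smul]

end Top

/-! ### Substituting `ỳ` for `x̀` -/

/-- The variable `x̀_a`. -/
noncomputable def xf (a : Fin (2 * n)) : A := D.gvec (Pi.single (Sum.inl a) 1)

/-- The variable `ỳ_a`. -/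
noncomputable def yf (a : Fin (2 * n)) : A := D.gvec (Pi.single (Sum.inr a) 1)

/-- The fermionic vector variable `x̀`. -/
noncomputable def xfvec : A := D.fvec fun a => Pi.single (Sum.inl a) 1

/-- The fermionic vector variable `ỳ`. -/
noncomputable def yfvec : A := D.fvec fun a => Pi.single (Sum.inr a) 1

/-- The fermionic vector variable `x̀ - ỳ`. -/
noncomputable def zfvec : A := D.fvec fun a => Pi.single (Sum.inl a) 1 - Pi.single (Sum.inr a) 1

/-- `P'` arises from `P` by writing `ỳ` for `x̀`, in the two respects that matter: `P` and `P'` agree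
modulo the annihilator of `(x̀ - ỳ)^{2n}`, the fermionic delta function, and `P'` is free of `x̀`. -/
def IsSubst (P P' : A) : Prop :=
  D.zfvec ^ (2 * n) * P = D.zfvec ^ (2 * n) * P' ∧ ∀ c, D.dxf c P' = 0

lemma IsSubst.one : D.IsSubst 1 1 := ⟨rfl, D.dxf_one⟩

variable {D}

lemma IsSubst.smul {P P' : A} (h : D.IsSubst P P') (r : ℝ) : D.IsSubst (r • P) (r • P') :=
  ⟨by rw [mul_smul_comm, mul_smul_comm, h.1], fun c => by rw [map_smul, h.2, smul_zero]⟩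

lemma IsSubst.sum {ι : Type*} {s : Finset ι} {P P' : ι → A} (h : ∀ i ∈ s, D.IsSubst (P i) (P' i)) :
    D.IsSubst (∑ i ∈ s, P i) (∑ i ∈ s, P' i) :=
  ⟨by rw [Finset.mul_sum, Finset.mul_sum]; exact Finset.sum_congr rfl fun i hi => (h i hi).1,
    fun c => by rw [map_sum]; exact Finset.sum_eq_zero fun i hi => (h i hi).2 c⟩

lemma IsSubst.xf_mul {P P' : A} (h : D.IsSubst P P') (a : Fin (2 * n)) :
    D.IsSubst (D.xf a * P) (D.yf a * P') := by
  refine ⟨?_, fun c => ?_⟩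
  · have h0 := D.fvec_top_mul_gvec isDual_xyf a
    rw [map_sub, mul_sub, sub_eq_zero] at h0
    have hc : Commute (D.zfvec ^ (2 * n)) (D.yf a) := by
      rw [pow_mul]; exact (D.fvec_sq_comm_gvec _ _).pow_left n
    rw [← mul_assoc, show D.zfvec ^ (2 * n) * D.xf a = D.zfvec ^ (2 * n) * D.yf a from h0, hc.eq,
      mul_assoc, h.1, ← mul_assoc, ← hc.eq, mul_assoc]
  · rw [yf, D.dxf_gvec_mul, h.2]; simp

lemma IsSubst.ef_mul {P P' : A} (h : D.IsSubst P P') (a : Fin (2 * n)) :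
    D.IsSubst (D.ef a * P) (D.ef a * P') := by
  refine ⟨?_, fun c => ?_⟩
  · have hc : Commute (D.zfvec ^ (2 * n)) (D.ef a) := by
      rw [pow_mul]; exact (D.fvec_sq_comm_ef _ _).pow_left n
    rw [← mul_assoc, hc.eq, mul_assoc, h.1, ← mul_assoc, ← hc.eq, mul_assoc]
  · rw [D.dxf_ef_mul, h.2, mul_zero]

lemma IsSubst.xfvec_mul {P P' : A} (h : D.IsSubst P P') :
    D.IsSubst (D.xfvec * P) (D.yfvec * P') := by
  simp only [xfvec, yfvec, fvec, Finset.sum_mul, mul_assoc]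
  exact IsSubst.sum fun a _ => (h.ef_mul a).xf_mul a

lemma IsSubst.xfvec_pow_mul {P P' : A} (h : D.IsSubst P P') (l : ℕ) :
    D.IsSubst (D.xfvec ^ l * P) (D.yfvec ^ l * P') := by
  induction l with
  | zero => simpa using h
  | succ l ih => simpa only [pow_succ', mul_assoc] using ih.xfvec_mul

lemma IsSubst.list_prod (L : List (Fin (2 * n))) :
    D.IsSubst (L.map D.xf).prod (L.map D.yf).prod := by
  induction L with
  | nil => simpa using IsSubst.one D
  | cons a L ih => simpa using ih.xf_mul a

/-- `(π^n / n!) (x̀ - ỳ)^{2n}` is the fermionic delta function. -/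
lemma IsSubst.berezin {P P' : A} (h : D.IsSubst P P') :
    (Real.pi ^ n / n.factorial : ℝ) • D.berezin (D.zfvec ^ (2 * n) * P) = P' := by
  rw [h.1]
  exact D.berezin_fvec_top_mul isDual_xyf P' h.2

end SuperCalculus

end SuperCauchy

namespace SuperCauchy

open Filter Topology Set

/-! ### Distributional identities for functions of class `C¹` -/

section Mollify
variable {m : ℕ}

lemma pderiv_continuous {a : Bos m → ℝ} (ha : ContDiff ℝ 1 a) (i : Fin m) :
    Continuous (pderiv i a) :=
  (ha.continuous_fderiv (by norm_num)).clm_apply continuous_const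

lemma pderiv_hasCompactSupport {a : Bos m → ℝ} (ha : HasCompactSupport a) (i : Fin m) :
    HasCompactSupport (pderiv i a) :=
  ha.fderiv_apply ℝ _

lemma integrable_mul_of_locallyIntegrable {κ g : Bos m → ℝ} (hκ : LocallyIntegrable κ volume)
    (hg : Continuous g) (hgc : HasCompactSupport g) : Integrable (fun x => κ x * g x) := by
  simpa [smul_eq_mul, mul_comm] using hκ.integrable_smul_left_of_hasCompactSupport hg hgc

/-- A shrinking sequence of bump functions. -/
noncomputable def shrinkingBump (m k : ℕ) : ContDiffBump (0 : Bos m) where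
  rIn := 1 / (2 * (k + 1))
  rOut := 1 / (k + 1)
  rIn_pos := by positivity
  rIn_lt_rOut := by
    apply one_div_lt_one_div_of_lt <;> linarith [(Nat.cast_nonneg k : (0 : ℝ) ≤ k)]

open scoped Convolution in
/-- The mollification of `g`, its convolution with a normalised bump function. -/
noncomputable def mollify (k : ℕ) (g : Bos m → ℝ) : Bos m → ℝ :=
  (shrinkingBump m k).normed volume ⋆[ContinuousLinearMap.lsmul ℝ ℝ, volume] g

lemma mollify_contDiff (k : ℕ) {g : Bos m → ℝ} (hg : Continuous g) :
    ContDiff ℝ ∞ (mollify k g) :=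
  (shrinkingBump m k).hasCompactSupport_normed.contDiff_convolution_left _
    (shrinkingBump m k).contDiff_normed hg.locallyIntegrable

lemma mollify_hasCompactSupport (k : ℕ) {g : Bos m → ℝ} (hg : HasCompactSupport g) :
    HasCompactSupport (mollify k g) :=
  (shrinkingBump m k).hasCompactSupport_normed.convolution _ hg

lemma mollify_tendsto {g : Bos m → ℝ} (hg : Continuous g) (x : Bos m) :
    Tendsto (fun k => mollify k g x) atTop (𝓝 (g x)) :=
  ContDiffBump.convolution_tendsto_right_of_continuous
    (φ := fun k => shrinkingBump m k) tendsto_one_div_add_atTop_nhds_zero_nat hg x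

lemma pderiv_mollify (k : ℕ) {a : Bos m → ℝ} (ha : ContDiff ℝ 1 a) (hac : HasCompactSupport a)
    (i : Fin m) : pderiv i (mollify k a) = mollify k (pderiv i a) := by
  funext x
  have hl : LocallyIntegrable ((shrinkingBump m k).normed volume) volume :=
    (shrinkingBump m k).continuous_normed.locallyIntegrable
  have h := hac.hasFDerivAt_convolution_right (ContinuousLinearMap.lsmul ℝ ℝ) hl ha x
  unfold pderiv mollify
  rw [h.fderiv]
  exact convolution_precompR_apply _ hl (hac.fderiv ℝ)
    (ha.continuous_fderiv (by norm_num)) x _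

/-- Mollifications of a test function are bounded and supported in a ball, uniformly. -/
lemma mollify_bound {g : Bos m → ℝ} (hg : Continuous g) (hgc : HasCompactSupport g) :
    ∃ C R : ℝ, ∀ k x, ‖mollify k g x‖ ≤ Set.indicator (Metric.closedBall 0 R) (fun _ => C) x := by
  obtain ⟨C, hC⟩ := hgc.exists_bound_of_continuous hg
  obtain ⟨R, hR⟩ := hgc.isBounded.subset_closedBall 0
  refine ⟨3 * C, R + 1, fun k x => ?_⟩
  have hC0 : 0 ≤ C := (norm_nonneg _).trans (hC 0)
  by_cases hx : x ∈ Metric.closedBall (0 : Bos m) (R + 1)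
  · rw [Set.indicator_of_mem hx]
    have h := (shrinkingBump m k).dist_normed_convolution_le (μ := volume) (x₀ := x) (g := g)
      (ε := 2 * C) hg.aestronglyMeasurable (fun z _ => by
        rw [Real.dist_eq]
        have h1 := hC z
        have h2 := hC x
        rw [Real.norm_eq_abs] at h1 h2
        linarith [abs_sub (g z) (g x)])
    rw [Real.dist_eq] at h
    have h2 := hC x
    rw [Real.norm_eq_abs] at h2 ⊢
    have h3 := abs_add_le (mollify k g x - g x) (g x)
    rw [sub_add_cancel] at h3
    unfold mollify at h3 ⊢
    linarith
  · rw [Set.indicator_of_notMem hx]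
    refine le_of_eq (norm_eq_zero.2 ?_)
    by_contra hne
    have := support_convolution_subset _ (Function.mem_support.2 hne)
    obtain ⟨p, hp, q, hq, rfl⟩ := Set.mem_add.1 this
    rw [(shrinkingBump m k).support_normed_eq, mem_ball_zero_iff] at hp
    have hq' := hR (subset_tsupport _ hq)
    rw [mem_closedBall_zero_iff] at hq' hx
    have h1 : (shrinkingBump m k).rOut ≤ 1 := by
      change 1 / ((k : ℝ) + 1) ≤ 1
      rw [div_le_one (by positivity)]; linarith [(Nat.cast_nonneg k : (0 : ℝ) ≤ k)]
    exact hx ((norm_add_le p q).trans (by linarith))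

lemma integral_mul_mollify_tendsto {κ g : Bos m → ℝ} (hκ : LocallyIntegrable κ volume)
    (hg : Continuous g) (hgc : HasCompactSupport g) :
    Tendsto (fun k => ∫ x, κ x * mollify k g x) atTop (𝓝 (∫ x, κ x * g x)) := by
  obtain ⟨C, R, hCR⟩ := mollify_bound hg hgc
  refine tendsto_integral_of_dominated_convergence
    (fun x => Set.indicator (Metric.closedBall 0 R) (fun x => ‖κ x‖ * C) x) ?_ ?_ ?_ ?_
  · intro k
    exact hκ.aestronglyMeasurable.mul (mollify_contDiff k hg).continuous.aestronglyMeasurable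
  · rw [integrable_indicator_iff Metric.isClosed_closedBall.measurableSet]
    exact ((hκ.integrableOn_isCompact (isCompact_closedBall _ _)).norm).mul_const C
  · intro k
    refine Eventually.of_forall fun x => ?_
    rw [norm_mul]
    have h := hCR k x
    by_cases hx : x ∈ Metric.closedBall (0 : Bos m) R
    · rw [Set.indicator_of_mem hx] at h ⊢
      gcongr
    · rw [Set.indicator_of_notMem hx] at h ⊢
      rw [le_antisymm h (norm_nonneg _), mul_zero]
  · exact Eventually.of_forall fun x => (mollify_tendsto hg x).const_mul _

end Mollify

namespace IsFundamentalFamily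
variable {m : ℕ} {s : ℕ → Bos m → ℝ} {v : ℕ → Fin m → Bos m → ℝ}

lemma integral_s_pderiv (h : IsFundamentalFamily m s v) {a : Bos m → ℝ} (ha : ContDiff ℝ 1 a)
    (hac : HasCompactSupport a) (k : ℕ) (i : Fin m) :
    ∫ x, s k x * pderiv i a x = ∫ x, v k i x * a x := by
  refine tendsto_nhds_unique (integral_mul_mollify_tendsto (h.integrable_s k)
    (pderiv_continuous ha i) (pderiv_hasCompactSupport hac i)) ?_
  have := integral_mul_mollify_tendsto (h.integrable_v k i) ha.continuous hac
  refine this.congr fun j => ?_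
  rw [← pderiv_mollify j ha hac, h.dirac_even k i _ (mollify_contDiff j ha.continuous)
    (mollify_hasCompactSupport j hac)]

lemma sum_integral_v_zero_pderiv (h : IsFundamentalFamily m s v) {a : Bos m → ℝ}
    (ha : ContDiff ℝ 1 a) (hac : HasCompactSupport a) :
    ∑ i, ∫ x, v 0 i x * pderiv i a x = -a 0 := by
  have h1 := tendsto_finsetSum Finset.univ fun i (_ : i ∈ Finset.univ) =>
    integral_mul_mollify_tendsto (h.integrable_v 0 i)
      (pderiv_continuous ha i) (pderiv_hasCompactSupport hac i)
  refine tendsto_nhds_unique h1 ((mollify_tendsto ha.continuous 0).neg.congr fun j => ?_)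
  rw [← h.dirac_one _ (mollify_contDiff j ha.continuous) (mollify_hasCompactSupport j hac), neg_neg]
  simp only [pderiv_mollify j ha hac]

lemma sum_integral_v_succ_pderiv (h : IsFundamentalFamily m s v) {a : Bos m → ℝ}
    (ha : ContDiff ℝ 1 a) (hac : HasCompactSupport a) (k : ℕ) :
    ∑ i, ∫ x, v (k + 1) i x * pderiv i a x = -∫ x, s k x * a x := by
  have h1 := tendsto_finsetSum Finset.univ fun i (_ : i ∈ Finset.univ) =>
    integral_mul_mollify_tendsto (h.integrable_v (k + 1) i)
      (pderiv_continuous ha i) (pderiv_hasCompactSupport hac i)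
  have h2 := (integral_mul_mollify_tendsto (h.integrable_s k) ha.continuous hac).neg
  refine tendsto_nhds_unique h1 (h2.congr fun j => ?_)
  rw [← h.dirac_odd k _ (mollify_contDiff j ha.continuous) (mollify_hasCompactSupport j hac), neg_neg]
  simp only [pderiv_mollify j ha hac]

/-- The vector-valued kernels are curl-free, being gradients. -/
lemma integral_v_pderiv_comm (h : IsFundamentalFamily m s v) {a : Bos m → ℝ}
    (ha : ContDiff ℝ 1 a) (hac : HasCompactSupport a) (k : ℕ) (i j : Fin m) :
    ∫ x, v k i x * pderiv j a x = ∫ x, v k j x * pderiv i a x := by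
  have key : ∀ φ : Bos m → ℝ, ContDiff ℝ ∞ φ → HasCompactSupport φ →
      ∫ x, v k i x * pderiv j φ x = ∫ x, v k j x * pderiv i φ x := by
    intro φ hφ hφc
    have hp : ∀ j, ContDiff ℝ ∞ (pderiv j φ) := fun j =>
      (hφ.fderiv_right (m := ∞) (by simp)).clm_apply contDiff_const
    rw [← h.dirac_even k i _ (hp j) (pderiv_hasCompactSupport hφc j),
      ← h.dirac_even k j _ (hp i) (pderiv_hasCompactSupport hφc i)]
    congr 1
    funext x
    congr 1
    have hd : DifferentiableAt ℝ (fderiv ℝ φ) x :=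
      ((hφ.fderiv_right (m := ∞) (by simp)).differentiable (by simp)) x
    have hsymm : IsSymmSndFDerivAt ℝ φ x :=
      hφ.contDiffAt.isSymmSndFDerivAt (by simp; exact WithTop.coe_le_coe.2 le_top)
    have e : ∀ i j : Fin m, pderiv i (pderiv j φ) x =
        fderiv ℝ (fderiv ℝ φ) x (EuclideanSpace.single i 1) (EuclideanSpace.single j 1) := by
      intro i j
      unfold pderiv
      rw [fderiv_clm_apply hd (differentiableAt_const _)]
      simp
    rw [e, e, hsymm.eq]
  refine tendsto_nhds_unique (integral_mul_mollify_tendsto (h.integrable_v k i)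
    (pderiv_continuous ha j) (pderiv_hasCompactSupport hac j)) ?_
  refine (integral_mul_mollify_tendsto (h.integrable_v k j)
    (pderiv_continuous ha i) (pderiv_hasCompactSupport hac i)).congr fun l => ?_
  rw [← pderiv_mollify l ha hac, ← pderiv_mollify l ha hac,
    key _ (mollify_contDiff l ha.continuous) (mollify_hasCompactSupport l hac)]

end IsFundamentalFamily

/-! ### The fundamental solution of the super Dirac operator -/

/-- `f` is integrable with integral `c`. -/
def HasInt {m : ℕ} (f : Bos m → ℝ) (c : ℝ) : Prop := Integrable f ∧ ∫ x, f x = c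

namespace HasInt
variable {m : ℕ} {f g : Bos m → ℝ} {c d : ℝ}

lemma add (hf : HasInt f c) (hg : HasInt g d) : HasInt (fun x => f x + g x) (c + d) :=
  ⟨hf.1.add hg.1, by rw [integral_add hf.1 hg.1, hf.2, hg.2]⟩

lemma sub (hf : HasInt f c) (hg : HasInt g d) : HasInt (fun x => f x - g x) (c - d) :=
  ⟨hf.1.sub hg.1, by rw [integral_sub hf.1 hg.1, hf.2, hg.2]⟩

lemma const_mul (hf : HasInt f c) (r : ℝ) : HasInt (fun x => r * f x) (r * c) :=
  ⟨hf.1.const_mul r, by rw [integral_const_mul, hf.2]⟩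

lemma mul_const (hf : HasInt f c) (r : ℝ) : HasInt (fun x => f x * r) (c * r) :=
  ⟨hf.1.mul_const r, by rw [integral_mul_const, hf.2]⟩

lemma sum {ι : Type*} {t : Finset ι} {f : ι → Bos m → ℝ} {c : ι → ℝ}
    (h : ∀ i ∈ t, HasInt (f i) (c i)) : HasInt (fun x => ∑ i ∈ t, f i x) (∑ i ∈ t, c i) :=
  ⟨integrable_finsetSum _ fun i hi => (h i hi).1, by
    rw [integral_finsetSum _ fun i hi => (h i hi).1]
    exact Finset.sum_congr rfl fun i hi => (h i hi).2⟩

end HasInt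

namespace SuperCalculus
variable {m n : ℕ} {A : Type*} [Ring A] [Algebra ℝ A] (D : SuperCalculus m n A)

/-- The Cauchy kernel `ν_1^{m|2n}`, with `z` the bosonic difference. -/
noncomputable def kernel (s : ℕ → Bos m → ℝ) (v : ℕ → Fin m → Bos m → ℝ) (z : Bos m) : A :=
  (Real.pi ^ n : ℝ) •
    (∑ k ∈ Finset.range n,
        (2 * (4 ^ k * (k.factorial : ℝ) / ((n - k - 1).factorial : ℝ)) * s k z) •
          D.zfvec ^ (2 * n - 2 * k - 1)
      + ∑ k ∈ Finset.range (n + 1),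
        (4 ^ k * (k.factorial : ℝ) / ((n - k).factorial : ℝ)) •
          ((∑ i, v k i z • D.eb i) * D.zfvec ^ (2 * n - 2 * k)))

/-- The super Dirac operator applied to `a P`, for a real function `a` and a constant `P`. -/
noncomputable def diracTerm (a : Bos m → ℝ) (P : A) (x : Bos m) : A :=
  a x • D.fermDirac P - ∑ i, pderiv i a x • (D.eb i * P)

lemma zfvec_even_comm_eb (l : ℕ) (i : Fin m) : Commute (D.zfvec ^ (2 * l)) (D.eb i) := by
  rw [pow_mul]; exact (D.fvec_sq_comm_eb _ i).pow_left l

/-- `∑ e_i e_j W_{ij} = -tr W` for a symmetric matrix `W`. -/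
lemma sum_eb_mul_eb (W : Fin m → Fin m → ℝ) (hW : ∀ i j, W i j = W j i) (w : A) :
    ∑ i, ∑ j, W i j • (D.eb i * (D.eb j * w)) = -((∑ i, W i i) • w) := by
  have h2 : (2 : ℝ) • ∑ i, ∑ j, W i j • (D.eb i * (D.eb j * w)) =
      (2 : ℝ) • -((∑ i, W i i) • w) := by
    rw [two_smul]
    nth_rewrite 2 [Finset.sum_comm]
    rw [← Finset.sum_add_distrib, Finset.sum_smul, ← Finset.sum_neg_distrib, Finset.smul_sum]
    refine Finset.sum_congr rfl fun i _ => ?_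
    rw [← Finset.sum_add_distrib, Finset.sum_eq_single i]
    · rw [← smul_add, ← mul_assoc, ← add_mul, D.eb_anticommutator, if_pos rfl, ← Algebra.smul_def,
        smul_comm, neg_smul, smul_neg]
    · intro j _ hj
      rw [hW j i, ← smul_add, ← mul_assoc, ← mul_assoc, ← add_mul, D.eb_anticommutator,
        if_neg (Ne.symm hj)]
      simp
    · simp
  have h3 := congrArg (fun u : A => (1 / 2 : ℝ) • u) h2
  simpa [smul_smul] using h3

/-- The kernel is a fundamental solution of the super Dirac operator, acting from the right; here at
the origin. -/
lemma hasInt_kernel_diracTerm_zero {s : ℕ → Bos m → ℝ} {v : ℕ → Fin m → Bos m → ℝ}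
    (h : IsFundamentalFamily m s v) {a : Bos m → ℝ} (ha : ContDiff ℝ 1 a)
    (hac : HasCompactSupport a) {P P' : A} (hP : D.IsSubst P P') (ψ : A →ₗ[ℝ] ℝ) :
    HasInt (fun x => ψ (D.berezin (D.kernel s v x * D.diracTerm a P x))) (-(a 0 * ψ P')) := by
  set Ψ : A →ₗ[ℝ] ℝ := ψ ∘ₗ D.berezin with hΨ
  set α : ℕ → ℝ := fun k => 2 * (4 ^ k * (k.factorial : ℝ) / ((n - k - 1).factorial : ℝ)) with hα
  set β : ℕ → ℝ := fun k => 4 ^ k * (k.factorial : ℝ) / ((n - k).factorial : ℝ) with hβ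
  set S : ℕ → ℝ := fun k => ∫ x, s k x * a x with hS
  set V : ℕ → Fin m → ℝ := fun k i => ∫ x, v k i x * a x with hV
  set W : ℕ → Fin m → Fin m → ℝ := fun k i j => ∫ x, v k i x * pderiv j a x with hW
  have iS : ∀ k, HasInt (fun x => s k x * a x) (S k) := fun k =>
    ⟨integrable_mul_of_locallyIntegrable (h.integrable_s k) ha.continuous hac, rfl⟩
  have iV : ∀ k i, HasInt (fun x => v k i x * a x) (V k i) := fun k i =>
    ⟨integrable_mul_of_locallyIntegrable (h.integrable_v k i) ha.continuous hac, rfl⟩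
  have iV' : ∀ k i, HasInt (fun x => s k x * pderiv i a x) (V k i) := fun k i =>
    ⟨integrable_mul_of_locallyIntegrable (h.integrable_s k) (pderiv_continuous ha i)
      (pderiv_hasCompactSupport hac i), h.integral_s_pderiv ha hac k i⟩
  have iW : ∀ k i j, HasInt (fun x => v k i x * pderiv j a x) (W k i j) := fun k i j =>
    ⟨integrable_mul_of_locallyIntegrable (h.integrable_v k i) (pderiv_continuous ha j)
      (pderiv_hasCompactSupport hac j), rfl⟩
  -- The kernel has two kinds of terms and so has the operator; this evaluates the four kinds of bosonic
  -- integrals, before any integration by parts in `x̀`.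
  have hint : HasInt (fun x => ψ (D.berezin (D.kernel s v x * D.diracTerm a P x)))
      (Real.pi ^ n *
        (∑ k ∈ Finset.range n, (α k * (S k * Ψ (D.zfvec ^ (2 * n - 2 * k - 1) * D.fermDirac P)
            - ∑ j, V k j * Ψ (D.zfvec ^ (2 * n - 2 * k - 1) * (D.eb j * P))))
        + ∑ k ∈ Finset.range (n + 1), β k * ∑ i,
          (V k i * Ψ (D.eb i * D.zfvec ^ (2 * n - 2 * k) * D.fermDirac P)
            - ∑ j, W k i j * Ψ (D.eb i * D.zfvec ^ (2 * n - 2 * k) * (D.eb j * P))))) := by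
    have := ((HasInt.sum (t := Finset.range n) fun k _ =>
      (((iS k).mul_const (Ψ (D.zfvec ^ (2 * n - 2 * k - 1) * D.fermDirac P))).sub
        (HasInt.sum (t := Finset.univ) fun j _ =>
          (iV' k j).mul_const (Ψ (D.zfvec ^ (2 * n - 2 * k - 1) * (D.eb j * P))))).const_mul
            (α k)).add
      (HasInt.sum (t := Finset.range (n + 1)) fun k _ =>
        (HasInt.sum (t := Finset.univ) fun i _ =>
          ((iV k i).mul_const (Ψ (D.eb i * D.zfvec ^ (2 * n - 2 * k) * D.fermDirac P))).sub
            (HasInt.sum (t := Finset.univ) fun j _ => (iW k i j).mul_const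
              (Ψ (D.eb i * D.zfvec ^ (2 * n - 2 * k) * (D.eb j * P))))).const_mul
                (β k))).const_mul (Real.pi ^ n)
    convert this using 2 with x
    change Ψ _ = _
    rw [kernel, diracTerm, smul_mul_assoc, map_smul, smul_eq_mul, add_mul, map_add]
    congr 2
    · rw [Finset.sum_mul, map_sum]
      refine Finset.sum_congr rfl fun k _ => ?_
      rw [smul_mul_assoc, map_smul, smul_eq_mul, mul_sub, map_sub, mul_assoc (α k), mul_smul_comm,
        map_smul, Finset.mul_sum, map_sum, mul_sub, smul_eq_mul]
      simp only [mul_smul_comm, map_smul, smul_eq_mul, Finset.mul_sum, mul_sub]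
      congr 2
      · ring
      · funext j; ring
    · rw [Finset.sum_mul, map_sum]
      refine Finset.sum_congr rfl fun k _ => ?_
      rw [smul_mul_assoc, map_smul, smul_eq_mul, Finset.sum_mul, Finset.sum_mul, map_sum]
      congr 1
      refine Finset.sum_congr rfl fun i _ => ?_
      rw [smul_mul_assoc, smul_mul_assoc, map_smul, mul_sub, map_sub, mul_smul_comm, map_smul,
        Finset.mul_sum, map_sum, smul_eq_mul, smul_eq_mul]
      simp only [mul_smul_comm, map_smul, smul_eq_mul, Finset.mul_sum, mul_sub]
      congr 1
      · ring
      · refine Finset.sum_congr rfl fun j _ => by ring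
  refine ⟨hint.1, hint.2.trans ?_⟩
  have hodd : ∀ k ∈ Finset.range n,
      D.zfvec ^ (2 * n - 2 * k - 1) = D.zfvec * D.zfvec ^ (2 * (n - k - 1)) := by
    intro k hk
    have := Finset.mem_range.1 hk
    rw [← pow_succ']; congr 1; omega
  have heven : ∀ k, D.zfvec ^ (2 * n - 2 * k) = D.zfvec ^ (2 * (n - k)) := by
    intro k; congr 1; omega
  have hαβ : ∀ k ∈ Finset.range n, α k = 2 * (n - k : ℕ) * β k := by
    intro k hk
    have hk := Finset.mem_range.1 hk
    obtain ⟨l, hl⟩ : ∃ l, n - k = l + 1 := ⟨n - k - 1, by omega⟩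
    simp only [hα, hβ, hl, Nat.add_sub_cancel, Nat.factorial_succ]
    push_cast
    have : (l.factorial : ℝ) ≠ 0 := by positivity
    field_simp
  have hαβ' : ∀ k ∈ Finset.range n, α k * (2 * n - 2 * (n - k - 1 : ℕ)) = β (k + 1) := by
    intro k hk
    have hk := Finset.mem_range.1 hk
    obtain ⟨l, rfl⟩ : ∃ l, n = k + 1 + l := ⟨n - k - 1, by omega⟩
    simp only [hα, hβ, show k + 1 + l - k - 1 = l by omega, show k + 1 + l - (k + 1) = l by omega,
      Nat.factorial_succ]
    push_cast
    have : (l.factorial : ℝ) ≠ 0 := by positivity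
    field_simp
    ring
  -- Scalar kernel against the fermionic derivative.
  have e1 : ∀ k ∈ Finset.range n, Ψ (D.zfvec ^ (2 * n - 2 * k - 1) * D.fermDirac P) =
      (2 * n - 2 * (n - k - 1 : ℕ)) * Ψ (D.zfvec ^ (2 * (n - k - 1)) * P) := by
    intro k hk
    rw [hodd k hk, mul_assoc, hΨ, LinearMap.comp_apply, LinearMap.comp_apply, zfvec,
      D.berezin_fvec_odd_fermDirac isDual_xyf, map_smul, smul_eq_mul]
  -- Scalar kernel against the bosonic derivatives, and vector kernel against the fermionic derivative:
  -- these cancel, since `α k = 2 (n - k) β k`.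
  have e2 : ∀ k ∈ Finset.range n, ∀ j, Ψ (D.zfvec ^ (2 * n - 2 * k - 1) * (D.eb j * P)) =
      -Ψ (D.eb j * (D.zfvec * (D.zfvec ^ (2 * (n - k - 1)) * P))) := by
    intro k hk j
    rw [hodd k hk, mul_assoc, ← mul_assoc _ (D.eb j), (D.zfvec_even_comm_eb _ j).eq, mul_assoc,
      ← mul_assoc D.zfvec, zfvec, D.fvec_mul_eb, neg_mul, map_neg, mul_assoc]
  have e3 : ∀ k i, Ψ (D.eb i * D.zfvec ^ (2 * n - 2 * k) * D.fermDirac P) =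
      -(2 * (n - k : ℕ) * Ψ (D.eb i * (D.zfvec * (D.zfvec ^ (2 * (n - k - 1)) * P)))) := by
    intro k i
    rw [heven, mul_assoc, hΨ, LinearMap.comp_apply, LinearMap.comp_apply, D.berezin_eb_mul,
      D.berezin_eb_mul, zfvec, D.berezin_fvec_even_fermDirac isDual_xyf]
    simp
  -- Vector kernel against the bosonic derivatives: by symmetry only the divergence survives. It cancels
  -- the terms of `e1`, since `α k (2 k + 2) = β (k + 1)`, up to the delta function in `W 0`.
  have e4 : ∀ k, ∑ i, ∑ j, W k i j * Ψ (D.eb i * D.zfvec ^ (2 * n - 2 * k) * (D.eb j * P)) =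
      -((∑ i, W k i i) * Ψ (D.zfvec ^ (2 * (n - k)) * P)) := by
    intro k
    have : ∀ i j, D.eb i * D.zfvec ^ (2 * n - 2 * k) * (D.eb j * P) =
        D.eb i * (D.eb j * (D.zfvec ^ (2 * (n - k)) * P)) := by
      intro i j
      rw [heven, mul_assoc, ← mul_assoc _ (D.eb j), (D.zfvec_even_comm_eb _ j).eq, mul_assoc]
    have hs := congrArg Ψ (D.sum_eb_mul_eb (W k) (fun i j => h.integral_v_pderiv_comm ha hac k i j)
      (D.zfvec ^ (2 * (n - k)) * P))
    simp only [map_sum, map_smul, map_neg, smul_eq_mul] at hs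
    simp only [this]
    rw [hs]
  have hW0 : ∑ i, W 0 i i = -a 0 := h.sum_integral_v_zero_pderiv ha hac
  have hWs : ∀ k, ∑ i, W (k + 1) i i = -S k := h.sum_integral_v_succ_pderiv ha hac
  have hsum2 : ∑ k ∈ Finset.range (n + 1), β k * ∑ i,
          (V k i * Ψ (D.eb i * D.zfvec ^ (2 * n - 2 * k) * D.fermDirac P)
            - ∑ j, W k i j * Ψ (D.eb i * D.zfvec ^ (2 * n - 2 * k) * (D.eb j * P))) =
      (-∑ k ∈ Finset.range n, β k * ∑ i, V k i *
          (2 * (n - k : ℕ) * Ψ (D.eb i * (D.zfvec * (D.zfvec ^ (2 * (n - k - 1)) * P)))))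
      + (-∑ k ∈ Finset.range n, β (k + 1) * (S k * Ψ (D.zfvec ^ (2 * (n - k - 1)) * P))
          - β 0 * (a 0 * Ψ (D.zfvec ^ (2 * n) * P))) := by
    simp only [Finset.sum_sub_distrib, e4, mul_sub, e3]
    rw [sub_eq_add_neg]
    congr 1
    · rw [Finset.sum_range_succ]
      simp [Finset.mul_sum]
    · rw [Finset.sum_range_succ', hW0]
      simp only [hWs, tsub_zero, ← Nat.sub_sub]
      simp only [neg_mul, neg_neg, neg_add]
      ring
  rw [hsum2, Finset.sum_congr rfl fun k hk => by
    rw [e1 k hk, Finset.sum_congr rfl fun j _ => by rw [e2 k hk j]]]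
  have hcancel : ∑ k ∈ Finset.range n, α k *
        (S k * ((2 * n - 2 * (n - k - 1 : ℕ)) * Ψ (D.zfvec ^ (2 * (n - k - 1)) * P))
          - ∑ j, V k j * -Ψ (D.eb j * (D.zfvec * (D.zfvec ^ (2 * (n - k - 1)) * P)))) =
      (∑ k ∈ Finset.range n, β k * ∑ i, V k i *
          (2 * (n - k : ℕ) * Ψ (D.eb i * (D.zfvec * (D.zfvec ^ (2 * (n - k - 1)) * P)))))
      + ∑ k ∈ Finset.range n, β (k + 1) * (S k * Ψ (D.zfvec ^ (2 * (n - k - 1)) * P)) := by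
    rw [← Finset.sum_add_distrib]
    refine Finset.sum_congr rfl fun k hk => ?_
    rw [← hαβ' k hk, mul_sub, Finset.mul_sum, Finset.mul_sum]
    simp only [mul_neg, Finset.sum_neg_distrib, sub_neg_eq_add]
    rw [add_comm]
    congr 1
    · refine Finset.sum_congr rfl fun j _ => ?_
      rw [hαβ k hk]; ring
    · ring
  rw [hcancel]
  have hfin := congrArg ψ hP.berezin
  rw [map_smul, smul_eq_mul] at hfin
  rw [← hfin]
  simp only [hβ, hΨ, LinearMap.comp_apply, tsub_zero, pow_zero, Nat.factorial_zero]
  push_cast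
  ring

/-- The kernel is a fundamental solution of the super Dirac operator, acting from the right. -/
lemma hasInt_kernel_diracTerm {s : ℕ → Bos m → ℝ} {v : ℕ → Fin m → Bos m → ℝ}
    (h : IsFundamentalFamily m s v) {a : Bos m → ℝ} (ha : ContDiff ℝ 1 a)
    (hac : HasCompactSupport a) {P P' : A} (hP : D.IsSubst P P') (ψ : A →ₗ[ℝ] ℝ) (y : Bos m) :
    HasInt (fun x => ψ (D.berezin (D.kernel s v (x - y) * D.diracTerm a P x))) (-(a y * ψ P')) := by
  have h0 := D.hasInt_kernel_diracTerm_zero h (a := fun x => a (x + y))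
    (ha.comp (contDiff_id.add contDiff_const))
    (hac.comp_homeomorph (Homeomorph.addRight y)) hP ψ
  have e : ∀ x, D.diracTerm (fun x => a (x + y)) P x = D.diracTerm a P (x + y) := by
    intro x
    simp only [diracTerm, pderiv, fderiv_comp_add_right]
  simp only [e, zero_add] at h0
  set F : Bos m → ℝ := fun x => ψ (D.berezin (D.kernel s v (x - y) * D.diracTerm a P x)) with hF
  have hF' : (fun x => ψ (D.berezin (D.kernel s v x * D.diracTerm a P (x + y)))) =
      fun x => F (x + y) := by
    funext x; simp [hF]
  rw [hF'] at h0
  refine ⟨?_, ?_⟩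
  · have := h0.1.comp_sub_right y
    simpa using this
  · rw [← h0.2, integral_add_right_eq_self F y]

end SuperCalculus

/-! ### Polar coordinates -/

section Polar
variable {m : ℕ}

lemma integral_volumeIoiPow (k : ℕ) (G : ℝ → ℝ) :
    ∫ r : Ioi (0 : ℝ), G r ∂(Measure.volumeIoiPow k) = ∫ r in Ioi (0 : ℝ), r ^ k * G r := by
  simp only [Measure.volumeIoiPow, ENNReal.ofReal]
  rw [integral_withDensity_eq_integral_smul,
    integral_subtype_comap measurableSet_Ioi fun a ↦ Real.toNNReal (a ^ k) • G a,
    setIntegral_congr_fun measurableSet_Ioi fun x hx ↦ ?_]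
  · rw [NNReal.smul_def, Real.coe_toNNReal _ (pow_nonneg (le_of_lt hx) _), smul_eq_mul]
  · exact (measurable_subtype_coe.pow_const _).real_toNNReal

/-- Polar coordinates, as an identity on the product of the sphere and the half-line. -/
lemma integrable_and_integral_polar (hm : 0 < m) {F : Bos m → ℝ} (hF : Integrable F) :
    Integrable (fun p : Metric.sphere (0 : Bos m) 1 × Ioi (0 : ℝ) => F ((p.2 : ℝ) • (p.1 : Bos m)))
      ((volume : Measure (Bos m)).toSphere.prod (Measure.volumeIoiPow (m - 1))) ∧
    ∫ x, F x = ∫ p : Metric.sphere (0 : Bos m) 1 × Ioi (0 : ℝ), F ((p.2 : ℝ) • (p.1 : Bos m))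
      ∂((volume : Measure (Bos m)).toSphere.prod (Measure.volumeIoiPow (m - 1))) := by
  have : Nonempty (Fin m) := ⟨⟨0, hm⟩⟩
  have : Nontrivial (Bos m) := inferInstance
  have hmp := (volume : Measure (Bos m)).measurePreserving_homeomorphUnitSphereProd
  have hdim : Module.finrank ℝ (Bos m) = m := by simp
  rw [hdim] at hmp
  set g : Metric.sphere (0 : Bos m) 1 × Ioi (0 : ℝ) → ℝ :=
    fun p => F ((p.2 : ℝ) • (p.1 : Bos m)) with hg
  have hcomp : g ∘ (homeomorphUnitSphereProd (Bos m)) =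
      fun x : ({(0 : Bos m)}ᶜ : Set (Bos m)) => F x := by
    funext x
    have hx : ‖(x : Bos m)‖ ≠ 0 := norm_ne_zero_iff.2 x.2
    simp [hg, smul_smul, hx]
  have hemb := (Homeomorph.measurableEmbedding (homeomorphUnitSphereProd (Bos m)))
  constructor
  · rw [← hmp.integrable_comp_emb hemb, hcomp]
    have := (integrableOn_iff_comap_subtypeVal (μ := (volume : Measure (Bos m))) (f := F)
      (measurableSet_singleton (0 : Bos m)).compl).1 hF.integrableOn
    exact this
  · rw [← hmp.integral_comp hemb g, show (fun x => g (homeomorphUnitSphereProd (Bos m) x)) =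
      fun x : ({(0 : Bos m)}ᶜ : Set (Bos m)) => F x from hcomp,
      integral_subtype_comap (measurableSet_singleton (0 : Bos m)).compl F,
      restrict_compl_singleton]

/-- Polar coordinates, integrating over the sphere last. -/
lemma integral_polar (hm : 0 < m) {F : Bos m → ℝ} (hF : Integrable F) :
    ∫ x, F x = ∫ ξ : Metric.sphere (0 : Bos m) 1,
      (∫ r in Ioi (0 : ℝ), r ^ (m - 1) * F (r • (ξ : Bos m)))
        ∂((volume : Measure (Bos m)).toSphere) := by
  obtain ⟨h1, h2⟩ := integrable_and_integral_polar hm hF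
  rw [h2, integral_prod _ h1]
  congr 1
  funext ξ
  exact integral_volumeIoiPow (m - 1) fun r => F (r • (ξ : Bos m))

/-- Polar coordinates, integrating over the radius last. -/
lemma integral_polar_symm (hm : 0 < m) {F : Bos m → ℝ} (hF : Integrable F) :
    ∫ x, F x = ∫ r in Ioi (0 : ℝ), r ^ (m - 1) *
      ∫ ξ : Metric.sphere (0 : Bos m) 1, F (r • (ξ : Bos m))
        ∂((volume : Measure (Bos m)).toSphere) := by
  obtain ⟨h1, h2⟩ := integrable_and_integral_polar hm hF
  rw [h2, integral_prod_symm _ h1]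
  exact integral_volumeIoiPow (m - 1) fun r => ∫ ξ : Metric.sphere (0 : Bos m) 1, F (r • (ξ : Bos m))
        ∂((volume : Measure (Bos m)).toSphere)

/-- Integration along the level sets of `‖x‖²`. -/
lemma integral_comp_norm_sq_mul (hm : 0 < m) (ρ : ℝ → ℝ) (c : Bos m → ℝ)
    (hF : Integrable fun x => ρ (‖x‖ ^ 2) * c x) :
    ∫ x, ρ (‖x‖ ^ 2) * c x = ∫ s in Ioi (0 : ℝ), ρ s * shell c s := by
  rw [integral_polar_symm hm hF]
  rw [← integral_comp_rpow_Ioi (fun r => r ^ (m - 1) *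
      ∫ ξ : Metric.sphere (0 : Bos m) 1, ρ (‖r • (ξ : Bos m)‖ ^ 2) * c (r • (ξ : Bos m))
        ∂((volume : Measure (Bos m)).toSphere)) (show (1 / 2 : ℝ) ≠ 0 by norm_num)]
  refine setIntegral_congr_fun measurableSet_Ioi fun s hs => ?_
  have hs : 0 < s := hs
  simp only [smul_eq_mul]
  rw [← Real.sqrt_eq_rpow]
  have hn : ∀ ξ : Metric.sphere (0 : Bos m) 1, ‖Real.sqrt s • (ξ : Bos m)‖ ^ 2 = s := by
    intro ξ
    rw [norm_smul, norm_eq_of_mem_sphere, mul_one, Real.norm_eq_abs, sq_abs, Real.sq_sqrt hs.le]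
  simp only [hn, integral_const_mul]
  unfold shell
  have hpow : s ^ ((1 : ℝ) / 2 - 1) * Real.sqrt s ^ (m - 1) = s ^ (((m : ℝ) - 2) / 2) := by
    rw [Real.sqrt_eq_rpow, ← Real.rpow_natCast, ← Real.rpow_mul hs.le, ← Real.rpow_add hs,
      Nat.cast_sub (by omega)]
    congr 1
    push_cast
    ring
  rw [← hpow, abs_of_pos (by norm_num : (0 : ℝ) < 1 / 2)]
  ring

end Polar

/-! ### Spherical means near the unit sphere -/

section Shell
variable {m : ℕ}

/-- The open spherical shell `|‖x‖² - 1| < ε`. -/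
def annulus (m : ℕ) (ε : ℝ) : Set (Bos m) := {x | 1 - ε < ‖x‖ ^ 2 ∧ ‖x‖ ^ 2 < 1 + ε}

lemma isOpen_annulus (ε : ℝ) : IsOpen (annulus m ε) :=
  isOpen_Ioo.preimage (f := fun x : Bos m => ‖x‖ ^ 2) (by fun_prop)

lemma sphere_subset_annulus {ε : ℝ} (hε : 0 < ε) : Metric.sphere (0 : Bos m) 1 ⊆ annulus m ε := by
  intro x hx
  rw [mem_sphere_zero_iff_norm] at hx
  constructor <;> rw [hx] <;> linarith

lemma exists_annulus_subset {U : Set (Bos m)} (hU : IsOpen U) (hS : Metric.sphere (0 : Bos m) 1 ⊆ U) :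
    ∃ ε, 0 < ε ∧ ε < 1 ∧ annulus m ε ⊆ U := by
  obtain ⟨δ, hδ, hδU⟩ := (isCompact_sphere (0 : Bos m) 1).exists_thickening_subset_open hU hS
  refine ⟨min δ (1 / 2), by positivity, (min_le_right _ _).trans_lt (by norm_num), fun x hx => hδU ?_⟩
  obtain ⟨h1, h2⟩ := hx
  have hd1 := min_le_left δ (1 / 2)
  have hd2 := min_le_right δ (1 / 2)
  have hx0 : 0 < ‖x‖ := by
    by_contra h
    have : ‖x‖ = 0 := le_antisymm (not_lt.1 h) (norm_nonneg x)
    rw [this] at h1; norm_num at h1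
  rw [Metric.mem_thickening_iff]
  refine ⟨‖x‖⁻¹ • x, by simp [norm_smul, hx0.ne'], ?_⟩
  rw [dist_eq_norm]
  have : x - ‖x‖⁻¹ • x = (1 - ‖x‖⁻¹) • x := by rw [sub_smul, one_smul]
  rw [this, norm_smul, Real.norm_eq_abs, ← abs_of_pos hx0, ← abs_mul, abs_of_pos hx0, sub_mul,
    inv_mul_cancel₀ hx0.ne', one_mul, abs_lt]
  constructor <;> nlinarith

lemma sqrt_smul_mem_annulus {ε s : ℝ} (hε : ε < 1) (hs : s ∈ Ioo (1 - ε) (1 + ε))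
    (ξ : Metric.sphere (0 : Bos m) 1) : Real.sqrt s • (ξ : Bos m) ∈ annulus m ε := by
  have hs0 : 0 < s := by linarith [hs.1]
  change 1 - ε < ‖Real.sqrt s • (ξ : Bos m)‖ ^ 2 ∧ ‖Real.sqrt s • (ξ : Bos m)‖ ^ 2 < 1 + ε
  rw [norm_smul, norm_eq_of_mem_sphere, mul_one, Real.norm_eq_abs, sq_abs, Real.sq_sqrt hs0.le]
  exact hs

lemma continuousOn_sqrt_smul {ε : ℝ} (hε : ε < 1) {g : Bos m → ℝ} (hg : ContinuousOn g (annulus m ε)) :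
    ContinuousOn (fun p : ℝ × Metric.sphere (0 : Bos m) 1 => g (Real.sqrt p.1 • (p.2 : Bos m)))
      (Ioo (1 - ε) (1 + ε) ×ˢ univ) :=
  hg.comp (by fun_prop) fun p hp => sqrt_smul_mem_annulus hε hp.1 p.2

lemma integrable_sqrt_smul {ε s : ℝ} (hε : ε < 1) {g : Bos m → ℝ}
    (hg : ContinuousOn g (annulus m ε)) (hs : s ∈ Ioo (1 - ε) (1 + ε)) :
    Integrable (fun ξ : Metric.sphere (0 : Bos m) 1 => g (Real.sqrt s • (ξ : Bos m)))
      ((volume : Measure (Bos m)).toSphere) := by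
  have hc : Continuous (fun ξ : Metric.sphere (0 : Bos m) 1 => g (Real.sqrt s • (ξ : Bos m))) := by
    have := (continuousOn_sqrt_smul hε hg).comp (f := fun ξ : Metric.sphere (0 : Bos m) 1 => (s, ξ))
      (s := univ) (by fun_prop) (fun ξ _ => ⟨hs, mem_univ _⟩)
    exact continuousOn_univ.1 this
  exact hc.integrable_of_hasCompactSupport (HasCompactSupport.of_compactSpace _)

/-- Spherical means of a `C^k` function are `C^k` in the squared radius. -/
lemma contDiffOn_sphere_mean {ε : ℝ} (hε : ε < 1) (k : ℕ) {g : Bos m → ℝ}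
    (hg : ContDiffOn ℝ k g (annulus m ε)) :
    ContDiffOn ℝ k (fun s => ∫ ξ : Metric.sphere (0 : Bos m) 1, g (Real.sqrt s • (ξ : Bos m))
      ∂((volume : Measure (Bos m)).toSphere)) (Ioo (1 - ε) (1 + ε)) := by
  induction k generalizing g with
  | zero =>
    rw [Nat.cast_zero, contDiffOn_zero]
    refine continuousOn_integral_of_compact_support isCompact_univ
      (continuousOn_sqrt_smul hε hg.continuousOn) ?_
    intro p x _ hx
    exact absurd (mem_univ x) hx
  | succ k ih =>
    -- Differentiating `g (√s ξ)` in `s` replaces `g` by `G`, of class one lower.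
    set G : Bos m → ℝ := fun x => (2 * ‖x‖ ^ 2)⁻¹ * fderiv ℝ g x x with hG
    have hx0 : ∀ x ∈ annulus m ε, (0 : ℝ) < ‖x‖ ^ 2 := fun x hx => by linarith [hx.1]
    have hGk : ContDiffOn ℝ k G (annulus m ε) := by
      refine ContDiffOn.mul (ContDiffOn.inv ?_ fun x hx => ?_) ?_
      · exact (contDiff_const.mul (contDiff_norm_sq ℝ)).contDiffOn
      · have := hx0 x hx; positivity
      · exact (hg.fderiv_of_isOpen (isOpen_annulus ε) (by norm_cast)).clm_apply contDiffOn_id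
    have hder : ∀ s ∈ Ioo (1 - ε) (1 + ε), HasDerivAt
        (fun s => ∫ ξ : Metric.sphere (0 : Bos m) 1, g (Real.sqrt s • (ξ : Bos m))
          ∂((volume : Measure (Bos m)).toSphere))
        (∫ ξ : Metric.sphere (0 : Bos m) 1, G (Real.sqrt s • (ξ : Bos m))
          ∂((volume : Measure (Bos m)).toSphere)) s := by
      intro s hs
      obtain ⟨a, b, hab, hsab, habs⟩ : ∃ a b, s ∈ Ioo a b ∧ Icc a b ∈ 𝓝 s ∧
          Icc a b ⊆ Ioo (1 - ε) (1 + ε) := by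
        obtain ⟨a, ha1, ha2⟩ := exists_between hs.1
        obtain ⟨b, hb1, hb2⟩ := exists_between hs.2
        exact ⟨a, b, ⟨ha2, hb1⟩, Icc_mem_nhds ha2 hb1, fun t ht =>
          ⟨ha1.trans_le ht.1, ht.2.trans_lt hb2⟩⟩
      have hcG := (continuousOn_sqrt_smul hε hGk.continuousOn).mono
        (prod_mono_left (t := (univ : Set (Metric.sphere (0 : Bos m) 1))) habs)
      obtain ⟨C, hC⟩ := (isCompact_Icc.prod isCompact_univ).exists_bound_of_continuousOn hcG
      refine (hasDerivAt_integral_of_dominated_loc_of_deriv_le (bound := fun _ => C)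
        (F := fun s (ξ : Metric.sphere (0 : Bos m) 1) => g (Real.sqrt s • (ξ : Bos m)))
        (F' := fun s (ξ : Metric.sphere (0 : Bos m) 1) => G (Real.sqrt s • (ξ : Bos m)))
        hsab ?_ ?_ ?_ ?_ (integrable_const C) ?_).2
      · filter_upwards [hsab] with t ht
        exact (integrable_sqrt_smul hε hg.continuousOn (habs ht)).aestronglyMeasurable
      · exact integrable_sqrt_smul hε hg.continuousOn hs
      · exact (integrable_sqrt_smul hε hGk.continuousOn hs).aestronglyMeasurable
      · exact Eventually.of_forall fun ξ t ht => hC (t, ξ) ⟨ht, mem_univ _⟩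
      · refine Eventually.of_forall fun ξ t ht => ?_
        have hmem := sqrt_smul_mem_annulus hε (habs ht) ξ
        have ht0 : 0 < t := by linarith [(habs ht).1]
        have hgd : DifferentiableAt ℝ g (Real.sqrt t • (ξ : Bos m)) :=
          (hg.differentiableOn (by simp)).differentiableAt
            ((isOpen_annulus ε).mem_nhds hmem)
        have h1 : HasDerivAt (fun t => Real.sqrt t • (ξ : Bos m))
            ((1 / (2 * Real.sqrt t)) • (ξ : Bos m)) t :=
          (Real.hasDerivAt_sqrt ht0.ne').smul_const _
        have h2 := hgd.hasFDerivAt.comp_hasDerivAt t h1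
        refine h2.congr_deriv ?_
        rw [map_smul, smul_eq_mul]
        change _ = (2 * ‖Real.sqrt t • (ξ : Bos m)‖ ^ 2)⁻¹ *
          fderiv ℝ g (Real.sqrt t • (ξ : Bos m)) (Real.sqrt t • (ξ : Bos m))
        rw [map_smul, smul_eq_mul]
        rw [norm_smul, norm_eq_of_mem_sphere, mul_one, Real.norm_eq_abs, sq_abs,
          Real.sq_sqrt ht0.le]
        have := Real.sqrt_pos.2 ht0
        rw [← mul_assoc]
        congr 1
        rw [inv_mul_eq_div, div_eq_div_iff (by positivity) (by positivity)]
        nlinarith [Real.mul_self_sqrt ht0.le]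
    have : ((k + 1 : ℕ) : WithTop ℕ∞) = (k : WithTop ℕ∞) + 1 := by norm_cast
    rw [this, contDiffOn_succ_iff_deriv_of_isOpen isOpen_Ioo]
    refine ⟨fun s hs => (hder s hs).differentiableAt.differentiableWithinAt, by simp, ?_⟩
    exact (ih hGk).congr fun s hs => (hder s hs).deriv

lemma contDiffOn_shell {ε : ℝ} (hε : ε < 1) {k : ℕ} {g : Bos m → ℝ}
    (hg : ContDiffOn ℝ k g (annulus m ε)) : ContDiffOn ℝ k (shell g) (Ioo (1 - ε) (1 + ε)) := by
  refine ContDiffOn.mul (contDiffOn_const.mul ?_) (contDiffOn_sphere_mean hε k hg)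
  intro s hs
  have : s ≠ 0 := by linarith [hs.1]
  exact (Real.contDiffAt_rpow_const_of_ne this).contDiffWithinAt

lemma deltaPairing_add {ε : ℝ} (hε0 : 0 < ε) (hε : ε < 1) {k : ℕ} {c d : Bos m → ℝ}
    (hc : ContDiffOn ℝ k c (annulus m ε)) (hd : ContDiffOn ℝ k d (annulus m ε)) :
    deltaPairing k (fun x => c x + d x) = deltaPairing k c + deltaPairing k d := by
  have hmem : Ioo (1 - ε) (1 + ε) ∈ 𝓝 (1 : ℝ) := Ioo_mem_nhds (by linarith) (by linarith)
  unfold deltaPairing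
  rw [← iteratedDeriv_add ((contDiffOn_shell hε hc).contDiffAt hmem)
    ((contDiffOn_shell hε hd).contDiffAt hmem)]
  refine Filter.EventuallyEq.iteratedDeriv_eq k ?_
  filter_upwards [hmem] with s hs
  simp only [shell, Pi.add_apply]
  rw [integral_add (integrable_sqrt_smul hε hc.continuousOn hs)
    (integrable_sqrt_smul hε hd.continuousOn hs), mul_add]

lemma deltaPairing_const_mul (k : ℕ) (r : ℝ) (c : Bos m → ℝ) :
    deltaPairing k (fun x => r * c x) = r * deltaPairing k c := by
  unfold deltaPairing
  rw [← iteratedDeriv_const_mul_field]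
  congr 1
  funext s
  simp only [shell, integral_const_mul]
  ring

end Shell

/-! ### Smooth steps -/

section Steps
variable {m : ℕ}

/-- Smooth monotone functions tending to the Heaviside function: `smoothStep N` is `0` on `t ≤ -1/(N+1)`
and `1` on `t ≥ 1/(N+1)`. -/
noncomputable def smoothStep (N : ℕ) (t : ℝ) : ℝ :=
  Real.smoothTransition ((((N : ℝ) + 1) * t + 1) / 2)

lemma smoothStep_contDiff (N : ℕ) : ContDiff ℝ ∞ (smoothStep N) :=
  Real.smoothTransition.contDiff.comp (by fun_prop)

lemma smoothStep_of_le (N : ℕ) {t : ℝ} (ht : t ≤ -(1 / ((N : ℝ) + 1))) : smoothStep N t = 0 := by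
  apply Real.smoothTransition.zero_of_nonpos
  have h0 : (0 : ℝ) < (N : ℝ) + 1 := by positivity
  have h1 := mul_le_mul_of_nonneg_left ht h0.le
  rw [mul_neg, mul_one_div_cancel h0.ne'] at h1
  linarith

lemma smoothStep_of_ge (N : ℕ) {t : ℝ} (ht : 1 / ((N : ℝ) + 1) ≤ t) : smoothStep N t = 1 := by
  apply Real.smoothTransition.one_of_one_le
  have h0 : (0 : ℝ) < (N : ℝ) + 1 := by positivity
  have h1 := mul_le_mul_of_nonneg_left ht h0.le
  rw [mul_one_div_cancel h0.ne'] at h1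
  linarith

lemma smoothStep_monotone (N : ℕ) : Monotone (smoothStep N) := by
  intro a b hab
  apply Real.smoothTransition.monotone
  gcongr

lemma smoothStep_mem (N : ℕ) (t : ℝ) : 0 ≤ smoothStep N t ∧ smoothStep N t ≤ 1 :=
  ⟨Real.smoothTransition.nonneg _, Real.smoothTransition.le_one _⟩

lemma contDiff_iteratedDeriv_smoothStep (N j : ℕ) : ContDiff ℝ ∞ (iteratedDeriv j (smoothStep N)) := by
  rw [iteratedDeriv_eq_iterate]
  exact (smoothStep_contDiff N).iterate_deriv j

lemma iteratedDeriv_smoothStep_of_lt (N j : ℕ) {t : ℝ} (ht : t < -(1 / ((N : ℝ) + 1))) :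
    iteratedDeriv j (smoothStep N) t = 0 := by
  have : smoothStep N =ᶠ[𝓝 t] fun _ => 0 := by
    filter_upwards [Iio_mem_nhds ht] with u hu using smoothStep_of_le N (le_of_lt hu)
  rw [this.iteratedDeriv_eq]
  simp

lemma iteratedDeriv_succ_smoothStep_of_gt (N j : ℕ) {t : ℝ} (ht : 1 / ((N : ℝ) + 1) < t) :
    iteratedDeriv (j + 1) (smoothStep N) t = 0 := by
  have : smoothStep N =ᶠ[𝓝 t] fun _ => 1 := by
    filter_upwards [Ioi_mem_nhds ht] with u hu using smoothStep_of_ge N (le_of_lt hu)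
  rw [this.iteratedDeriv_eq]
  simp [iteratedDeriv_const]

lemma support_iteratedDeriv_succ_smoothStep (N j : ℕ) {s : ℝ}
    (hs : s ∉ Icc (1 - 1 / ((N : ℝ) + 1)) (1 + 1 / ((N : ℝ) + 1))) :
    iteratedDeriv (j + 1) (smoothStep N) (1 - s) = 0 := by
  rw [mem_Icc, not_and_or, not_le, not_le] at hs
  rcases hs with hs | hs
  · exact iteratedDeriv_succ_smoothStep_of_gt N j (by linarith)
  · exact iteratedDeriv_smoothStep_of_lt N _ (by linarith)

lemma contDiffOn_iteratedDeriv {S : ℝ → ℝ} {U : Set ℝ} (hU : IsOpen U) {j k : ℕ}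
    (hS : ContDiffOn ℝ (j + k : ℕ) S U) : ContDiffOn ℝ j (iteratedDeriv k S) U := by
  induction k generalizing j with
  | zero => simpa using hS
  | succ k ih =>
    rw [iteratedDeriv_succ]
    exact (ih (j := j + 1) (by rwa [add_assoc, add_comm 1])).deriv_of_isOpen hU (by norm_cast)

/-- Moving derivatives from a bump function onto the other factor. -/
lemma integral_iteratedDeriv_mul {a b δ ε : ℝ} (hδ : δ < ε) (ha : a = 1 - ε) (hb : b = 1 + ε)
    (hδ0 : 0 < δ) (k : ℕ) {ρ : ℝ → ℝ} (hρ : ContDiff ℝ ∞ ρ)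
    (hρ0 : ∀ t, t ∉ Icc (-δ) δ → ρ t = 0) {S : ℝ → ℝ} (hS : ContDiffOn ℝ k S (Ioo a b)) :
    ∫ s, iteratedDeriv k ρ (1 - s) * S s = ∫ s, ρ (1 - s) * iteratedDeriv k S s := by
  subst ha hb
  have hder0 : ∀ ρ : ℝ → ℝ, (∀ t, t ∉ Icc (-δ) δ → ρ t = 0) →
      ∀ t, t ∉ Icc (-δ) δ → deriv ρ t = 0 := by
    intro ρ hρ0 t ht
    have : ρ =ᶠ[𝓝 t] fun _ => 0 := by
      filter_upwards [isClosed_Icc.isOpen_compl.mem_nhds ht] with u hu using hρ0 u hu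
    rw [this.deriv_eq]; simp
  obtain ⟨η, hδη, hηε⟩ := exists_between hδ
  have hstep : ∀ (ρ T : ℝ → ℝ), ContDiff ℝ ∞ ρ → (∀ t, t ∉ Icc (-δ) δ → ρ t = 0) →
      DifferentiableOn ℝ T (Ioo (1 - ε) (1 + ε)) → ContinuousOn (deriv T) (Ioo (1 - ε) (1 + ε)) →
      ∫ s, deriv ρ (1 - s) * T s = ∫ s, ρ (1 - s) * deriv T s := by
    intro ρ T hρ hρ0 hT hT'
    have hsub : uIcc (1 - η) (1 + η) ⊆ Ioo (1 - ε) (1 + ε) := by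
      rw [uIcc_of_le (by linarith)]
      exact fun t ht => ⟨by linarith [ht.1], by linarith [ht.2]⟩
    have hsupp : ∀ (ρ T : ℝ → ℝ), (∀ t, t ∉ Icc (-δ) δ → ρ t = 0) →
        Function.support (fun s => ρ (1 - s) * T s) ⊆ Ioc (1 - η) (1 + η) := by
      intro ρ T hρ0 s hs
      by_contra hns
      apply hs
      have : ρ (1 - s) = 0 := hρ0 _ fun h => hns ⟨by linarith [h.2], by linarith [h.1]⟩
      simp [this]
    rw [← intervalIntegral.integral_eq_integral_of_support_subset
        (hsupp _ _ (hder0 ρ hρ0)),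
      ← intervalIntegral.integral_eq_integral_of_support_subset (hsupp _ _ hρ0)]
    have hd1 : Continuous (deriv ρ) := hρ.continuous_deriv (by simp)
    have hibp := intervalIntegral.integral_mul_deriv_eq_deriv_mul (a := 1 - η) (b := 1 + η)
      (u := fun s => ρ (1 - s)) (u' := fun s => -deriv ρ (1 - s)) (v := T) (v' := deriv T)
      (fun s _ => by
        have := ((hρ.differentiable (by simp)) (1 - s)).hasDerivAt.comp s
          ((hasDerivAt_id s).const_sub 1)
        rw [mul_neg_one] at this
        exact this)
      (fun s hs => (hT.differentiableAt (isOpen_Ioo.mem_nhds (hsub hs))).hasDerivAt)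
      (Continuous.intervalIntegrable (by fun_prop) _ _)
      (hT'.mono hsub).intervalIntegrable
    rw [hibp, hρ0 (1 - (1 + η)) fun h => by linarith [h.1],
      hρ0 (1 - (1 - η)) fun h => by linarith [h.2]]
    simp
  induction k generalizing ρ with
  | zero => simp
  | succ k ih =>
    have hS' : ContDiffOn ℝ k S (Ioo (1 - ε) (1 + ε)) := hS.of_le (by norm_cast; omega)
    rw [iteratedDeriv_succ', ih (ρ := deriv ρ) (hρ.iterate_deriv 1) (hder0 ρ hρ0) hS', iteratedDeriv_succ]
    have hT : ContDiffOn ℝ (1 : ℕ) (iteratedDeriv k S) (Ioo (1 - ε) (1 + ε)) :=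
      contDiffOn_iteratedDeriv isOpen_Ioo (by rwa [add_comm])
    exact hstep ρ _ hρ hρ0 (hT.differentiableOn (by norm_num))
      (hT.continuousOn_deriv_of_isOpen isOpen_Ioo (by norm_num))

lemma integral_deriv_smoothStep (N : ℕ) : ∫ s, deriv (smoothStep N) (1 - s) = 1 := by
  have h1 : ∫ s, deriv (smoothStep N) (1 - s) = ∫ s, deriv (smoothStep N) s :=
    integral_sub_left_eq_self _ volume 1
  have h0 : 1 / ((N : ℝ) + 1) ≤ 1 := by
    rw [div_le_one (by positivity)]; linarith [(Nat.cast_nonneg N : (0 : ℝ) ≤ N)]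
  rw [h1, ← intervalIntegral.integral_eq_integral_of_support_subset (a := -2) (b := 2)]
  · rw [intervalIntegral.integral_deriv_eq_sub]
    · rw [smoothStep_of_ge N (by linarith), smoothStep_of_le N (by linarith), sub_zero]
    · exact fun x _ => (smoothStep_contDiff N).differentiable (by simp) x
    · exact ((smoothStep_contDiff N).continuous_deriv (by simp)).intervalIntegrable _ _
  · intro s hs
    by_contra hns
    apply hs
    have := support_iteratedDeriv_succ_smoothStep N 0 (s := 1 - s) (fun h => hns
      ⟨by linarith [h.2], by linarith [h.1]⟩)
    rw [sub_sub_cancel, zero_add, iteratedDeriv_one] at this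
    exact this

/-- The derivatives of the smooth steps are approximations of the identity. -/
lemma tendsto_integral_deriv_smoothStep_mul {ε : ℝ} (hε : 0 < ε) {T : ℝ → ℝ}
    (hT : ContinuousOn T (Ioo (1 - ε) (1 + ε))) :
    Tendsto (fun N => ∫ s, deriv (smoothStep N) (1 - s) * T s) atTop (𝓝 (T 1)) := by
  rw [Metric.tendsto_atTop]
  intro η hη
  have hcont : ContinuousAt T 1 := hT.continuousAt (Ioo_mem_nhds (by linarith) (by linarith))
  obtain ⟨δ, hδ, hδT⟩ := Metric.continuousAt_iff.1 hcont (η / 2) (by positivity)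
  obtain ⟨N0, hN0⟩ := exists_nat_one_div_lt (show 0 < min δ ε by positivity)
  refine ⟨N0, fun N hN => ?_⟩
  have hNlt : 1 / ((N : ℝ) + 1) < min δ ε := by
    refine lt_of_le_of_lt ?_ hN0
    gcongr
  have hN1 := hNlt.trans_le (min_le_left _ _)
  have hN2 := hNlt.trans_le (min_le_right _ _)
  set ρ : ℝ → ℝ := fun s => deriv (smoothStep N) (1 - s) with hρ
  have hρc : Continuous ρ := by
    have := (smoothStep_contDiff N).continuous_deriv (by simp)
    fun_prop
  have hρ0 : ∀ s, s ∉ Icc (1 - 1 / ((N : ℝ) + 1)) (1 + 1 / ((N : ℝ) + 1)) → ρ s = 0 := by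
    intro s hs
    have := support_iteratedDeriv_succ_smoothStep N 0 hs
    rwa [zero_add, iteratedDeriv_one] at this
  have hρnn : ∀ s, 0 ≤ ρ s := fun s => (smoothStep_monotone N).deriv_nonneg
  have hρi : Integrable ρ := hρc.integrable_of_hasCompactSupport
    (HasCompactSupport.intro isCompact_Icc hρ0)
  have hρT : Integrable (fun s => ρ s * T s) := by
    rw [← integrableOn_iff_integrable_of_support_subset
      (s := Icc (1 - 1 / ((N : ℝ) + 1)) (1 + 1 / ((N : ℝ) + 1)))]
    · refine ContinuousOn.integrableOn_compact isCompact_Icc (hρc.continuousOn.mul (hT.mono ?_))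
      exact fun t ht => ⟨by linarith [ht.1], by linarith [ht.2]⟩
    · intro s hs
      by_contra hns
      exact hs (by simp [hρ0 s hns])
  have hint : ∫ s, ρ s = 1 := integral_deriv_smoothStep N
  have hsub : (∫ s, ρ s * T s) - T 1 = ∫ s, (ρ s * T s - ρ s * T 1) := by
    rw [integral_sub hρT (hρi.mul_const _), integral_mul_const, hint, one_mul]
  rw [Real.dist_eq, hsub, ← Real.norm_eq_abs]
  calc ‖∫ s, (ρ s * T s - ρ s * T 1)‖ ≤ ∫ s, ρ s * (η / 2) := by
        refine norm_integral_le_of_norm_le (hρi.mul_const _) (Eventually.of_forall fun s => ?_)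
        rw [← mul_sub, norm_mul, Real.norm_of_nonneg (hρnn s)]
        by_cases hs : s ∈ Icc (1 - 1 / ((N : ℝ) + 1)) (1 + 1 / ((N : ℝ) + 1))
        · refine mul_le_mul_of_nonneg_left ?_ (hρnn s)
          rw [← dist_eq_norm]
          refine (hδT ?_).le
          rw [Real.dist_eq, abs_lt]
          constructor <;> linarith [hs.1, hs.2]
        · simp [hρ0 s hs]
    _ = η / 2 := by rw [integral_mul_const, hint, one_mul]
    _ < η := by linarith

lemma integrable_iteratedDeriv_succ_smoothStep_mul {ε : ℝ} {c : Bos m → ℝ}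
    (hc : ContinuousOn c (annulus m ε)) {N : ℕ} (hN : 1 / ((N : ℝ) + 1) < ε) (j : ℕ) :
    Integrable fun x => iteratedDeriv (j + 1) (smoothStep N) (1 - ‖x‖ ^ 2) * c x := by
  set K : Set (Bos m) :=
    (fun x => ‖x‖ ^ 2) ⁻¹' Icc (1 - 1 / ((N : ℝ) + 1)) (1 + 1 / ((N : ℝ) + 1)) with hK
  have hKc : IsCompact K := by
    refine Metric.isCompact_of_isClosed_isBounded (isClosed_Icc.preimage (by fun_prop)) ?_
    refine (Metric.isBounded_closedBall (x := (0 : Bos m)) (r := 2)).subset fun x hx => ?_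
    rw [mem_closedBall_zero_iff]
    have h0 : 1 / ((N : ℝ) + 1) ≤ 1 := by
      rw [div_le_one (by positivity)]; linarith [(Nat.cast_nonneg N : (0 : ℝ) ≤ N)]
    have h2 : ‖x‖ ^ 2 ≤ 1 + 1 / ((N : ℝ) + 1) := hx.2
    nlinarith [norm_nonneg x]
  rw [← integrableOn_iff_integrable_of_support_subset (s := K)]
  · have h1 : Continuous fun x : Bos m => iteratedDeriv (j + 1) (smoothStep N) (1 - ‖x‖ ^ 2) :=
      (contDiff_iteratedDeriv_smoothStep N (j + 1)).continuous.comp (by fun_prop)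
    refine ContinuousOn.integrableOn_compact hKc (h1.continuousOn.mul (hc.mono ?_))
    intro x hx
    have hx : ‖x‖ ^ 2 ∈ Icc (1 - 1 / ((N : ℝ) + 1)) (1 + 1 / ((N : ℝ) + 1)) := hx
    exact ⟨by linarith [hx.1], by linarith [hx.2]⟩
  · intro x hx
    by_contra hns
    exact hx (by simp [support_iteratedDeriv_succ_smoothStep N j hns])

/-- The layers `δ^{(k)}` as limits of smooth functions. -/
lemma tendsto_integral_iteratedDeriv_smoothStep (hm : 0 < m) {ε : ℝ} (hε0 : 0 < ε) (hε : ε < 1)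
    {k : ℕ} {c : Bos m → ℝ} (hc : ContDiffOn ℝ k c (annulus m ε)) :
    Tendsto (fun N => ∫ x, iteratedDeriv (k + 1) (smoothStep N) (1 - ‖x‖ ^ 2) * c x) atTop
      (𝓝 (deltaPairing k c)) := by
  have hS := contDiffOn_shell hε hc
  have hT : ContinuousOn (iteratedDeriv k (shell c)) (Ioo (1 - ε) (1 + ε)) :=
    (contDiffOn_iteratedDeriv isOpen_Ioo (j := 0) (by simpa using hS)).continuousOn
  refine (tendsto_integral_deriv_smoothStep_mul hε0 hT).congr' ?_
  obtain ⟨N0, hN0⟩ := exists_nat_one_div_lt hε0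
  filter_upwards [eventually_ge_atTop N0] with N hN
  have hNlt : 1 / ((N : ℝ) + 1) < ε := by
    refine lt_of_le_of_lt ?_ hN0
    gcongr
  rw [integral_comp_norm_sq_mul hm (fun s => iteratedDeriv (k + 1) (smoothStep N) (1 - s)) c
    (integrable_iteratedDeriv_succ_smoothStep_mul hc.continuousOn hNlt k),
    setIntegral_eq_integral_of_forall_compl_eq_zero]
  · simp only [iteratedDeriv_succ']
    rw [integral_iteratedDeriv_mul hNlt rfl rfl (by positivity) k (ρ := deriv (smoothStep N))
      ((smoothStep_contDiff N).iterate_deriv 1) ?_ hS]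
    · intro t ht
      have := support_iteratedDeriv_succ_smoothStep N 0 (s := 1 - t) (fun h => ht
        ⟨by linarith [h.2], by linarith [h.1]⟩)
      rw [sub_sub_cancel, zero_add, iteratedDeriv_one] at this
      exact this
  · intro s hs
    rw [support_iteratedDeriv_succ_smoothStep N k, zero_mul]
    intro h
    exact hs (show 0 < s by linarith [h.1])

lemma integrable_smoothStep_mul {ε : ℝ} {c : Bos m → ℝ}
    (hc : IntegrableOn c (Metric.closedBall 0 (1 + ε))) {N : ℕ} (hN : 1 / ((N : ℝ) + 1) < ε) :
    Integrable fun x => smoothStep N (1 - ‖x‖ ^ 2) * c x := by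
  rw [← integrableOn_iff_integrable_of_support_subset (s := Metric.closedBall 0 (1 + ε))]
  · have h1 : Continuous fun x : Bos m => smoothStep N (1 - ‖x‖ ^ 2) :=
      (smoothStep_contDiff N).continuous.comp (by fun_prop)
    refine Integrable.bdd_mul hc h1.aestronglyMeasurable (c := 1) (Eventually.of_forall fun x => ?_)
    rw [Real.norm_of_nonneg (smoothStep_mem N _).1]
    exact (smoothStep_mem N _).2
  · intro x hx
    by_contra hns
    rw [mem_closedBall_zero_iff, not_le] at hns
    refine hx ?_
    have hN0 : 0 < 1 / ((N : ℝ) + 1) := by positivity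
    simp only
    rw [smoothStep_of_le N (by nlinarith), zero_mul]

lemma tendsto_integral_smoothStep (hm : 0 < m) {ε : ℝ} (hε : 0 < ε) {c : Bos m → ℝ}
    (hc : IntegrableOn c (Metric.closedBall 0 (1 + ε))) :
    Tendsto (fun N => ∫ x, smoothStep N (1 - ‖x‖ ^ 2) * c x) atTop
      (𝓝 (∫ x in Metric.closedBall (0 : Bos m) 1, c x)) := by
  have : Nonempty (Fin m) := ⟨⟨0, hm⟩⟩
  have : Nontrivial (Bos m) := inferInstance
  obtain ⟨N0, hN0⟩ := exists_nat_one_div_lt hε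
  have hNlt : ∀ N ≥ N0, 1 / ((N : ℝ) + 1) < ε := fun N hN => by
    refine lt_of_le_of_lt ?_ hN0
    gcongr
  rw [← integral_indicator Metric.isClosed_closedBall.measurableSet]
  refine tendsto_integral_filter_of_dominated_convergence
    (fun x => indicator (Metric.closedBall 0 (1 + ε)) (fun x => ‖c x‖) x) ?_ ?_ ?_ ?_
  · filter_upwards [eventually_ge_atTop N0] with N hN
    exact (integrable_smoothStep_mul hc (hNlt N hN)).aestronglyMeasurable
  · filter_upwards [eventually_ge_atTop N0] with N hN
    refine Eventually.of_forall fun x => ?_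
    by_cases hx : x ∈ Metric.closedBall (0 : Bos m) (1 + ε)
    · rw [indicator_of_mem hx, norm_mul, Real.norm_of_nonneg (smoothStep_mem N _).1]
      exact mul_le_of_le_one_left (norm_nonneg _) (smoothStep_mem N _).2
    · rw [indicator_of_notMem hx]
      rw [mem_closedBall_zero_iff, not_le] at hx
      have := hNlt N hN
      rw [smoothStep_of_le N (by nlinarith), zero_mul, norm_zero]
  · rw [integrable_indicator_iff Metric.isClosed_closedBall.measurableSet]
    exact hc.norm
  · have hnull : ∀ᵐ x : Bos m, x ∉ Metric.sphere (0 : Bos m) 1 :=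
      measure_eq_zero_iff_ae_notMem.1 (Measure.addHaar_sphere volume 0 1)
    filter_upwards [hnull] with x hx
    rw [mem_sphere_zero_iff_norm] at hx
    refine tendsto_const_nhds.congr' ?_
    have hpos : 0 < |1 - ‖x‖ ^ 2| := by
      rw [abs_pos, sub_ne_zero]
      intro h
      exact hx (by nlinarith [norm_nonneg x, sq_nonneg (‖x‖ - 1)])
    obtain ⟨N1, hN1⟩ := exists_nat_one_div_lt hpos
    filter_upwards [eventually_ge_atTop N1] with N hN
    have hlt : 1 / ((N : ℝ) + 1) < |1 - ‖x‖ ^ 2| := by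
      refine lt_of_le_of_lt ?_ hN1
      gcongr
    by_cases hx1 : ‖x‖ ≤ 1
    · rw [indicator_of_mem (mem_closedBall_zero_iff.2 hx1)]
      rw [abs_of_nonneg (by nlinarith [norm_nonneg x])] at hlt
      rw [smoothStep_of_ge N hlt.le, one_mul]
    · rw [indicator_of_notMem (by rwa [mem_closedBall_zero_iff])]
      rw [abs_of_neg (by nlinarith)] at hlt
      rw [smoothStep_of_le N (by linarith), zero_mul]

end Steps

/-! ### Functions with finitely many coefficients -/

section Expansions
variable {X : Type*} {A : Type*} [Ring A] [Algebra ℝ A]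

/-- `F = ∑ c_q w_q` is a finite sum with coefficients `c_q ∈ C` and constants `w_q ∈ A`. -/
def HasExpansion (C : Submodule ℝ (X → ℝ)) (F : X → A) : Prop :=
  ∃ (ι : Type) (_ : Fintype ι) (c : ι → X → ℝ) (w : ι → A),
    (∀ q, c q ∈ C) ∧ ∀ x, F x = ∑ q, c q x • w q

variable {C C' C'' : Submodule ℝ (X → ℝ)} {F G : X → A}

lemma HasExpansion.smul_const {c : X → ℝ} (hc : c ∈ C) (w : A) :
    HasExpansion C fun x => c x • w :=
  ⟨Unit, inferInstance, fun _ => c, fun _ => w, fun _ => hc, fun x => by simp⟩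

lemma HasExpansion.zero : HasExpansion C fun _ => (0 : A) :=
  ⟨Empty, inferInstance, fun _ => 0, fun _ => 0, fun q => q.elim, fun x => by simp⟩

lemma HasExpansion.add (hF : HasExpansion C F) (hG : HasExpansion C G) :
    HasExpansion C fun x => F x + G x := by
  obtain ⟨ι, _, c, w, hc, hF⟩ := hF
  obtain ⟨ι', _, c', w', hc', hG⟩ := hG
  refine ⟨ι ⊕ ι', inferInstance, Sum.elim c c', Sum.elim w w', ?_, fun x => ?_⟩
  · rintro (q | q)
    exacts [hc q, hc' q]
  · simp [hF, hG]

lemma HasExpansion.map (hF : HasExpansion C F) (L : A →ₗ[ℝ] A) :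
    HasExpansion C fun x => L (F x) := by
  obtain ⟨ι, _, c, w, hc, hF⟩ := hF
  exact ⟨ι, inferInstance, c, fun q => L (w q), hc, fun x => by simp [hF]⟩

lemma HasExpansion.sum {κ : Type*} {t : Finset κ} {F : κ → X → A}
    (hF : ∀ k ∈ t, HasExpansion C (F k)) : HasExpansion C fun x => ∑ k ∈ t, F k x := by
  classical
  induction t using Finset.induction_on with
  | empty => simpa using HasExpansion.zero
  | insert k t hk ih =>
    simp only [Finset.sum_insert hk]
    exact (hF k (Finset.mem_insert_self _ _)).add
      (ih fun j hj => hF j (Finset.mem_insert_of_mem hj))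

lemma HasExpansion.mul (hF : HasExpansion C F) (hG : HasExpansion C' G)
    (h : ∀ c ∈ C, ∀ c' ∈ C', (fun x => c x * c' x) ∈ C'') :
    HasExpansion C'' fun x => F x * G x := by
  obtain ⟨ι, _, c, w, hc, hF⟩ := hF
  obtain ⟨ι', _, c', w', hc', hG⟩ := hG
  refine ⟨ι × ι', inferInstance, fun q x => c q.1 x * c' q.2 x, fun q => w q.1 * w' q.2,
    fun q => h _ (hc _) _ (hc' _), fun x => ?_⟩
  change F x * G x = _
  rw [hF, hG, Finset.sum_mul_sum, Fintype.sum_prod_type]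
  simp [smul_smul, mul_comm]

lemma HasExpansion.apply_mem (hF : HasExpansion C F) (φ : A →ₗ[ℝ] ℝ) : (fun x => φ (F x)) ∈ C := by
  obtain ⟨ι, _, c, w, hc, hF⟩ := hF
  have : (fun x => φ (F x)) = ∑ q, φ (w q) • c q := by
    funext x
    simp [hF, mul_comm]
  rw [this]
  exact Submodule.sum_mem _ fun q _ => Submodule.smul_mem _ _ (hc q)

/-- A linear functional on the coefficients extends to functions with an expansion. -/
lemma HasExpansion.exists_extend (hF : HasExpansion C F) (T : C →ₗ[ℝ] ℝ) :
    ∃ I : A, ∀ φ : A →ₗ[ℝ] ℝ, φ I = T ⟨fun x => φ (F x), hF.apply_mem φ⟩ := by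
  obtain ⟨ι, _, c, w, hc, hF'⟩ := id hF
  refine ⟨∑ q, T ⟨c q, hc q⟩ • w q, fun φ => ?_⟩
  have : (⟨fun x => φ (F x), hF.apply_mem φ⟩ : C) = ∑ q, φ (w q) • ⟨c q, hc q⟩ := by
    apply Subtype.ext
    rw [Submodule.coe_sum]
    funext x
    simp [hF', mul_comm]
  rw [this, map_sum, map_sum]
  refine Finset.sum_congr rfl fun q _ => ?_
  rw [map_smul, map_smul, smul_eq_mul, smul_eq_mul, mul_comm]

end Expansions

/-! ### Cutting off with smooth steps -/

section Cutoff
variable {m : ℕ}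

/-- The function `h_N^{(j)}(1 - ‖x‖²) g(x)`, where `h_N` is a smooth step. -/
noncomputable def cutoff (N j : ℕ) (g : Bos m → ℝ) (x : Bos m) : ℝ :=
  iteratedDeriv j (smoothStep N) (1 - ‖x‖ ^ 2) * g x

variable {Ω : Set (Bos m)} {ε : ℝ} {N : ℕ} {g : Bos m → ℝ}

lemma cutoff_eventuallyEq_zero (hN : 1 / ((N : ℝ) + 1) < ε) (j : ℕ) (g : Bos m → ℝ) {x : Bos m}
    (hx : x ∉ Metric.ball (0 : Bos m) (1 + ε)) : cutoff N j g =ᶠ[𝓝 x] fun _ => 0 := by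
  rw [mem_ball_zero_iff, not_lt] at hx
  have hN0 : 0 < 1 / ((N : ℝ) + 1) := by positivity
  have hopen : IsOpen {x : Bos m | 1 + 1 / ((N : ℝ) + 1) < ‖x‖ ^ 2} :=
    isOpen_lt (by fun_prop) (by fun_prop)
  filter_upwards [hopen.mem_nhds (show 1 + 1 / ((N : ℝ) + 1) < ‖x‖ ^ 2 by nlinarith)] with z hz
  have hz : 1 + 1 / ((N : ℝ) + 1) < ‖z‖ ^ 2 := hz
  rw [cutoff, iteratedDeriv_smoothStep_of_lt N j (by linarith), zero_mul]

lemma cutoff_hasCompactSupport (hN : 1 / ((N : ℝ) + 1) < ε) (j : ℕ) (g : Bos m → ℝ) :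
    HasCompactSupport (cutoff N j g) := by
  refine HasCompactSupport.intro (isCompact_closedBall (0 : Bos m) (1 + ε)) fun x hx => ?_
  exact (cutoff_eventuallyEq_zero hN j g fun h => hx (Metric.ball_subset_closedBall h)).eq_of_nhds

lemma contDiff_step_norm_sq (N j : ℕ) :
    ContDiff ℝ ∞ fun x : Bos m => iteratedDeriv j (smoothStep N) (1 - ‖x‖ ^ 2) :=
  (contDiff_iteratedDeriv_smoothStep N j).comp (contDiff_const.sub (contDiff_norm_sq ℝ))

lemma cutoff_contDiff (hΩ : IsOpen Ω) (hB : Metric.closedBall (0 : Bos m) (1 + ε) ⊆ Ω)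
    (hN : 1 / ((N : ℝ) + 1) < ε) (hg : ContDiffOn ℝ 1 g Ω) (j : ℕ) :
    ContDiff ℝ 1 (cutoff N j g) := by
  rw [contDiff_iff_contDiffAt]
  intro x
  by_cases hx : x ∈ Metric.ball (0 : Bos m) (1 + ε)
  · exact ((contDiff_step_norm_sq N j).of_le (by exact_mod_cast le_top)).contDiffAt.mul
      (hg.contDiffAt (hΩ.mem_nhds (hB (Metric.ball_subset_closedBall hx))))
  · exact contDiffAt_const.congr_of_eventuallyEq (cutoff_eventuallyEq_zero hN j g hx)

lemma pderiv_cutoff (hΩ : IsOpen Ω) (hB : Metric.closedBall (0 : Bos m) (1 + ε) ⊆ Ω)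
    (hN : 1 / ((N : ℝ) + 1) < ε) (hg : ContDiffOn ℝ 1 g Ω) (j : ℕ) (i : Fin m) (x : Bos m) :
    pderiv i (cutoff N j g) x =
      -2 * x i * cutoff N (j + 1) g x + cutoff N j (pderiv i g) x := by
  by_cases hx : x ∈ Metric.ball (0 : Bos m) (1 + ε)
  · have hgd : DifferentiableAt ℝ g x := (hg.contDiffAt
      (hΩ.mem_nhds (hB (Metric.ball_subset_closedBall hx)))).differentiableAt (by norm_num)
    have h1 : HasFDerivAt (fun x : Bos m => 1 - ‖x‖ ^ 2) (-(2 • innerSL ℝ x)) x := by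
      simpa using (hasStrictFDerivAt_norm_sq x).hasFDerivAt.const_sub 1
    have h2 : HasDerivAt (iteratedDeriv j (smoothStep N))
        (iteratedDeriv (j + 1) (smoothStep N) (1 - ‖x‖ ^ 2)) (1 - ‖x‖ ^ 2) := by
      rw [iteratedDeriv_succ]
      exact ((contDiff_iteratedDeriv_smoothStep N j).differentiable (by simp) _).hasDerivAt
    have h3 := (h2.comp_hasFDerivAt x h1).mul hgd.hasFDerivAt
    have h4 : pderiv i (cutoff N j g) x = _ :=
      congrArg (fun L : Bos m →L[ℝ] ℝ => L (EuclideanSpace.single i 1)) h3.fderiv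
    rw [h4]
    simp only [cutoff, pderiv]
    simp [EuclideanSpace.inner_single_right]
    ring
  · have h1 := cutoff_eventuallyEq_zero hN j g hx
    have h2 := (cutoff_eventuallyEq_zero hN (j + 1) g hx).eq_of_nhds
    have h3 := (cutoff_eventuallyEq_zero hN j (pderiv i g) hx).eq_of_nhds
    rw [h2, h3, pderiv, h1.fderiv_eq]
    simp

end Cutoff

/-! ### The Cauchy–Pompeiu formula for smooth steps -/

namespace SuperCalculus
variable {m n : ℕ} {A : Type*} [Ring A] [Algebra ℝ A] (D : SuperCalculus m n A)

/-- The monomial `x̀_S`. -/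
noncomputable def monomial (S : Finset (Fin (2 * n))) : A := ((S.sort (· ≤ ·)).map D.xf).prod

/-- The monomial `ỳ_S`. -/
noncomputable def monomial' (S : Finset (Fin (2 * n))) : A := ((S.sort (· ≤ ·)).map D.yf).prod

/-- The value `f(x)` of a superfunction. -/
noncomputable def eval (f : SuperFun m n) (x : Bos m) : A := ∑ S, f S x • D.monomial S

/-- The value `f(y)` of a superfunction, in the variables `ỳ`. -/
noncomputable def eval' (f : SuperFun m n) (x : Bos m) : A := ∑ S, f S x • D.monomial' S

/-- The bosonic vector `∑ t_i e_i`. -/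
noncomputable def bvec (t : Fin m → ℝ) : A := ∑ i, t i • D.eb i

/-- The vector variable `x = x̲ + x̀`. -/
noncomputable def xvec (x : Bos m) : A := D.bvec (fun i => x i) + D.xfvec

/-- The super Dirac operator. -/
noncomputable def dirac (f : SuperFun m n) (x : Bos m) : A :=
  D.fermDirac (D.eval f x) - ∑ i, D.eb i * D.eval (fun S => pderiv i (f S)) x

/-- The coefficient `x̀^{2j}/j!` of the Taylor expansion of a function of `x²`. -/
noncomputable def taylorCoeff (j : ℕ) : A := (j.factorial : ℝ)⁻¹ • D.xfvec ^ (2 * j)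

lemma xfvec_sq_comm_kernel (s : ℕ → Bos m → ℝ) (v : ℕ → Fin m → Bos m → ℝ) (z : Bos m) :
    Commute (D.xfvec ^ 2) (D.kernel s v z) := by
  have h1 : Commute (D.xfvec ^ 2) D.zfvec := D.fvec_sq_comm_fvec _ _
  have h2 : ∀ i, Commute (D.xfvec ^ 2) (D.eb i) := D.fvec_sq_comm_eb _
  refine Commute.smul_right (Commute.add_right ?_ ?_) _
  · exact Commute.sum_right _ _ _ fun k _ => (h1.pow_right _).smul_right _
  · refine Commute.sum_right _ _ _ fun k _ => Commute.smul_right (Commute.mul_right ?_ ?_) _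
    · exact Commute.sum_right _ _ _ fun i _ => (h2 i).smul_right _
    · exact h1.pow_right _

lemma taylorCoeff_comm_kernel (j : ℕ) (s : ℕ → Bos m → ℝ) (v : ℕ → Fin m → Bos m → ℝ) (z : Bos m) :
    Commute (D.taylorCoeff j) (D.kernel s v z) := by
  rw [taylorCoeff, pow_mul]
  exact ((D.xfvec_sq_comm_kernel s v z).pow_left j).smul_left _

lemma taylorCoeff_comm_eb (j : ℕ) (i : Fin m) : Commute (D.taylorCoeff j) (D.eb i) := by
  rw [taylorCoeff, pow_mul]
  exact ((D.fvec_sq_comm_eb _ i).pow_left j).smul_left _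

/-- `∂_x̀ (x̀^{2j}/j! P) = 2 x̀ x̀^{2j-2}/(j-1)! P + x̀^{2j}/j! ∂_x̀ P`. -/
lemma fermDirac_taylorCoeff_succ_mul (j : ℕ) (P : A) :
    D.fermDirac (D.taylorCoeff (j + 1) * P) =
      (2 : ℝ) • (D.taylorCoeff j * (D.xfvec * P)) + D.taylorCoeff (j + 1) * D.fermDirac P := by
  simp only [taylorCoeff, smul_mul_assoc, map_smul]
  rw [xfvec, D.fermDirac_fvec_pow_mul isDual_xf, smul_add, smul_smul, smul_smul, Nat.add_sub_cancel]
  congr 1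
  have hc : Commute (D.fvec fun a => Pi.single (Sum.inl a) 1)
      ((D.fvec fun a => Pi.single (Sum.inl a) 1) ^ (2 * j)) :=
    (Commute.refl _).pow_right _
  rw [← mul_assoc _ _ P, hc.eq, mul_assoc _ _ P]
  congr 1
  rw [Nat.factorial_succ]
  push_cast
  have : (j.factorial : ℝ) ≠ 0 := by positivity
  field_simp

lemma fermDirac_taylorCoeff_zero_mul (P : A) :
    D.fermDirac (D.taylorCoeff 0 * P) = D.taylorCoeff 0 * D.fermDirac P := by
  simp [taylorCoeff]

/-- The chain rule `∂_x (h(x²+1) f) = h(x²+1) ∂_x f + 2 h^{(1)}(x²+1) x f` for the smooth step `h = h_N`;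
here `h(x²+1) = ∑_j h^{(j)}(1-‖x‖²) x̀^{2j}/j!`. -/
lemma sum_diracTerm_cutoff {Ω : Set (Bos m)} {ε : ℝ} {N : ℕ} (hΩ : IsOpen Ω)
    (hB : Metric.closedBall (0 : Bos m) (1 + ε) ⊆ Ω) (hN : 1 / ((N : ℝ) + 1) < ε)
    (f : SuperFun m n) (hf : f.CkOn 1 Ω) (x : Bos m) :
    ∑ j ∈ Finset.range (n + 1), ∑ S, D.diracTerm (cutoff N j (f S)) (D.taylorCoeff j * D.monomial S) x =
      ∑ j ∈ Finset.range (n + 1),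
        (iteratedDeriv j (smoothStep N) (1 - ‖x‖ ^ 2) • (D.taylorCoeff j * D.dirac f x)
          + (2 * iteratedDeriv (j + 1) (smoothStep N) (1 - ‖x‖ ^ 2)) •
            (D.taylorCoeff j * (D.xvec x * D.eval f x))) := by
  set H : ℕ → ℝ := fun j => iteratedDeriv j (smoothStep N) (1 - ‖x‖ ^ 2) with hH
  have hterm : ∀ j, ∑ S, D.diracTerm (cutoff N j (f S)) (D.taylorCoeff j * D.monomial S) x =
      H j • (D.fermDirac (D.taylorCoeff j * D.eval f x)
        - D.taylorCoeff j * ∑ i, D.eb i * D.eval (fun S => pderiv i (f S)) x)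
        + (2 * H (j + 1)) • (D.taylorCoeff j * (D.bvec (fun i => x i) * D.eval f x)) := by
    intro j
    simp only [diracTerm, pderiv_cutoff hΩ hB hN (hf _)]
    rw [Finset.sum_sub_distrib]
    have e1 : ∑ S, cutoff N j (f S) x • D.fermDirac (D.taylorCoeff j * D.monomial S) =
        H j • D.fermDirac (D.taylorCoeff j * D.eval f x) := by
      simp only [eval, Finset.mul_sum, mul_smul_comm, map_sum, map_smul, Finset.smul_sum, smul_smul]
      rfl
    have e2 : ∑ S, ∑ i, (-2 * x i * cutoff N (j + 1) (f S) x + cutoff N j (pderiv i (f S)) x) •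
        (D.eb i * (D.taylorCoeff j * D.monomial S)) =
        H j • (D.taylorCoeff j * ∑ i, D.eb i * D.eval (fun S => pderiv i (f S)) x)
        - (2 * H (j + 1)) • (D.taylorCoeff j * (D.bvec (fun i => x i) * D.eval f x)) := by
      simp only [eval, bvec, Finset.mul_sum, Finset.sum_mul, mul_smul_comm, smul_mul_assoc,
        Finset.smul_sum, smul_smul]
      rw [Finset.sum_comm]
      conv_rhs => arg 2; rw [Finset.sum_comm]
      rw [← Finset.sum_sub_distrib]
      refine Finset.sum_congr rfl fun i _ => ?_
      rw [← Finset.sum_sub_distrib]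
      refine Finset.sum_congr rfl fun S _ => ?_
      rw [← mul_assoc (D.eb i), ← (D.taylorCoeff_comm_eb j i).eq,
        mul_assoc (D.taylorCoeff j), ← sub_smul]
      congr 1
      simp only [cutoff, hH]
      ring
    rw [e1, e2, smul_sub]
    abel
  -- The shifted sum has one term too many, which vanishes as `x̀^{2n+1} = 0`.
  have hodd : D.taylorCoeff n * D.xfvec = 0 := by
    rw [taylorCoeff, smul_mul_assoc, xfvec, D.fvec_pow_odd_top isDual_xf, smul_zero]
  simp only [hterm]
  have hsplit : ∑ j ∈ Finset.range (n + 1), H j • D.fermDirac (D.taylorCoeff j * D.eval f x) =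
      ∑ j ∈ Finset.range (n + 1), (H j • (D.taylorCoeff j * D.fermDirac (D.eval f x))
        + (2 * H (j + 1)) • (D.taylorCoeff j * (D.xfvec * D.eval f x))) := by
    rw [Finset.sum_add_distrib, Finset.sum_range_succ' _ n]
    simp only [fermDirac_taylorCoeff_succ_mul, fermDirac_taylorCoeff_zero_mul, smul_add, smul_smul]
    rw [Finset.sum_add_distrib, Finset.sum_range_succ' (fun j => H j • (D.taylorCoeff j *
      D.fermDirac (D.eval f x))), Finset.sum_range_succ (fun j => (2 * H (j + 1)) •
      (D.taylorCoeff j * (D.xfvec * D.eval f x))), ← mul_assoc (D.taylorCoeff n), hodd, zero_mul,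
      smul_zero, add_zero]
    simp only [mul_comm (2 : ℝ)]
    abel
  simp only [smul_sub, Finset.sum_add_distrib, Finset.sum_sub_distrib, dirac, xvec, mul_sub, add_mul,
    mul_add, smul_add, hsplit]
  abel

/-- The super Cauchy–Pompeiu formula with the Heaviside function replaced by a smooth step. -/
lemma hasInt_smoothStep {s : ℕ → Bos m → ℝ} {v : ℕ → Fin m → Bos m → ℝ}
    (h : IsFundamentalFamily m s v) {Ω : Set (Bos m)} {ε : ℝ} {N : ℕ} (hΩ : IsOpen Ω)
    (hB : Metric.closedBall (0 : Bos m) (1 + ε) ⊆ Ω) (hN : 1 / ((N : ℝ) + 1) < ε)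
    (f : SuperFun m n) (hf : f.CkOn 1 Ω) (y : Bos m) (φ : A →ₗ[ℝ] ℝ) :
    HasInt (fun x => ∑ j ∈ Finset.range (n + 1),
        (iteratedDeriv j (smoothStep N) (1 - ‖x‖ ^ 2) *
            φ (D.berezin (D.taylorCoeff j * (D.kernel s v (x - y) * D.dirac f x)))
          + 2 * (iteratedDeriv (j + 1) (smoothStep N) (1 - ‖x‖ ^ 2) *
            φ (D.berezin (D.taylorCoeff j * (D.kernel s v (x - y) * D.xvec x * D.eval f x))))))
      (∑ j ∈ Finset.range (n + 1), ∑ S, -(cutoff N j (f S) y *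
        φ ((j.factorial : ℝ)⁻¹ • D.yfvec ^ (2 * j) * D.monomial' S))) := by
  have hsub : ∀ j S, D.IsSubst (D.taylorCoeff j * D.monomial S)
      ((j.factorial : ℝ)⁻¹ • D.yfvec ^ (2 * j) * D.monomial' S) := by
    intro j S
    rw [taylorCoeff, smul_mul_assoc, smul_mul_assoc]
    exact ((IsSubst.list_prod _).xfvec_pow_mul _).smul _
  have := HasInt.sum (t := Finset.range (n + 1)) fun j _ =>
    HasInt.sum (t := (Finset.univ : Finset (Finset (Fin (2 * n))))) fun S _ =>
      D.hasInt_kernel_diracTerm h (cutoff_contDiff hΩ hB hN (hf S) j)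
        (cutoff_hasCompactSupport hN j (f S)) (hsub j S) φ y
  convert this using 2 with x
  have hs := congrArg (fun w => φ (D.berezin (D.kernel s v (x - y) * w)))
    (D.sum_diracTerm_cutoff hΩ hB hN f hf x)
  simp only [Finset.mul_sum, map_sum, mul_add, map_add, mul_smul_comm, map_smul, smul_eq_mul] at hs
  rw [hs]
  refine Finset.sum_congr rfl fun j _ => ?_
  have hc := (D.taylorCoeff_comm_kernel j s v (x - y)).eq
  rw [← mul_assoc (D.taylorCoeff j), hc, ← mul_assoc (D.kernel s v (x - y)) (D.taylorCoeff j), ← hc,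
    mul_assoc (D.kernel s v (x - y)) (D.xvec x)]
  simp only [← mul_assoc, hc]

end SuperCalculus

/-! ### Passing to the limit of sharp steps -/

section Coefficients
variable {m : ℕ} {ε : ℝ} {k : ℕ}

/-- Functions of class `C^k` near the unit sphere and integrable on a ball containing it. -/
def regularCoeff (m : ℕ) (ε : ℝ) (k : ℕ) : Submodule ℝ (Bos m → ℝ) where
  carrier := {c | ContDiffOn ℝ k c (annulus m ε) ∧ IntegrableOn c (Metric.closedBall 0 (1 + ε)) volume}
  add_mem' hc hd := ⟨hc.1.add hd.1, hc.2.add hd.2⟩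
  zero_mem' := ⟨contDiffOn_const, integrableOn_zero⟩
  smul_mem' r c hc := ⟨contDiffOn_const.smul hc.1,
    show IntegrableOn (fun x => r • c x) _ volume from Integrable.smul r hc.2⟩

/-- Functions of class `C^k` near the unit sphere and continuous on a ball containing it. -/
def continuousCoeff (m : ℕ) (ε : ℝ) (k : ℕ) : Submodule ℝ (Bos m → ℝ) where
  carrier := {c | ContDiffOn ℝ k c (annulus m ε) ∧ ContinuousOn c (Metric.closedBall 0 (1 + ε))}
  add_mem' hc hd := ⟨hc.1.add hd.1, hc.2.add hd.2⟩
  zero_mem' := ⟨contDiffOn_const, continuousOn_const⟩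
  smul_mem' r _ hc := ⟨contDiffOn_const.smul hc.1, hc.2.const_smul r⟩

lemma mul_mem_regularCoeff {c d : Bos m → ℝ} (hc : c ∈ regularCoeff m ε k)
    (hd : d ∈ continuousCoeff m ε k) : (fun x => c x * d x) ∈ regularCoeff m ε k :=
  ⟨hc.1.mul hd.1, hc.2.mul_continuousOn hd.2 (isCompact_closedBall 0 (1 + ε))⟩

/-- The translated kernels are regular near the sphere, as the pole `y` lies off the shell. -/
lemma translate_mem_regularCoeff {g : Bos m → ℝ} (hg : LocallyIntegrable g volume)
    (hs : ContDiffOn ℝ ∞ g {0}ᶜ) {y : Bos m} (hy : y ∉ annulus m ε) :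
    (fun x => g (x - y)) ∈ regularCoeff m ε k := by
  constructor
  · refine (hs.of_le (by exact_mod_cast le_top)).comp (contDiffOn_id.sub contDiffOn_const) ?_
    intro x hx h0
    exact hy (sub_eq_zero.1 h0 ▸ hx)
  · have h1 : MeasurePreserving (fun x : Bos m => x - y) volume volume :=
      measurePreserving_sub_right volume y
    have h2 := h1.integrableOn_comp_preimage (f := g) (s := Metric.closedBall (-y) (1 + ε))
      (Homeomorph.subRight y).measurableEmbedding
    have h3 : (fun x : Bos m => x - y) ⁻¹' Metric.closedBall (-y) (1 + ε) =
        Metric.closedBall 0 (1 + ε) := by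
      ext x
      simp [dist_eq_norm]
    rw [h3] at h2
    exact h2.2 (hg.integrableOn_isCompact (isCompact_closedBall _ _))

/-- The pairing with `δ^{(j)}(x̲² + 1)` as a linear functional. -/
noncomputable def deltaFunctional (m : ℕ) {ε : ℝ} (hε0 : 0 < ε) (hε : ε < 1) {j k : ℕ} (hjk : j ≤ k) :
    regularCoeff m ε k →ₗ[ℝ] ℝ where
  toFun c := deltaPairing j (c : Bos m → ℝ)
  map_add' c d := deltaPairing_add hε0 hε (c.2.1.of_le (by exact_mod_cast hjk))
    (d.2.1.of_le (by exact_mod_cast hjk))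
  map_smul' r c := deltaPairing_const_mul j r (c : Bos m → ℝ)

lemma regularCoeff.integrableOn_ball (hε0 : 0 < ε) (c : regularCoeff m ε k) :
    IntegrableOn (c : Bos m → ℝ) (Metric.closedBall 0 1) :=
  c.2.2.mono_set (Metric.closedBall_subset_closedBall (by linarith))

/-- Integration over the unit ball as a linear functional. -/
noncomputable def ballFunctional (m : ℕ) {ε : ℝ} (hε0 : 0 < ε) (k : ℕ) :
    regularCoeff m ε k →ₗ[ℝ] ℝ where
  toFun c := ∫ x in Metric.closedBall (0 : Bos m) 1, (c : Bos m → ℝ) x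
  map_add' c d := integral_add (regularCoeff.integrableOn_ball hε0 c)
    (regularCoeff.integrableOn_ball hε0 d)
  map_smul' r _ := integral_const_mul r _

end Coefficients

namespace SuperCalculus
variable {m n : ℕ} {A : Type*} [Ring A] [Algebra ℝ A] (D : SuperCalculus m n A) {ε : ℝ}

lemma hasExpansion_kernel {s : ℕ → Bos m → ℝ} {v : ℕ → Fin m → Bos m → ℝ}
    (h : IsFundamentalFamily m s v) {y : Bos m} (hy : y ∉ annulus m ε) (k : ℕ) :
    HasExpansion (regularCoeff m ε k) fun x => D.kernel s v (x - y) := by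
  unfold kernel
  refine HasExpansion.map (HasExpansion.add (HasExpansion.sum fun k _ => ?_)
    (HasExpansion.sum fun k _ => ?_)) ((Real.pi ^ n : ℝ) • (LinearMap.id : A →ₗ[ℝ] A))
  · exact HasExpansion.smul_const (Submodule.smul_mem _ _
      (translate_mem_regularCoeff (h.integrable_s k) (h.smooth_s k) hy)) _
  · refine HasExpansion.map (F := fun x => ∑ i, v k i (x - y) • D.eb i) (HasExpansion.sum fun i _ => ?_)
      ((4 ^ k * (k.factorial : ℝ) / ((n - k).factorial : ℝ)) •
        LinearMap.mulRight ℝ (D.zfvec ^ (2 * n - 2 * k)))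
    exact HasExpansion.smul_const
      (translate_mem_regularCoeff (h.integrable_v k i) (h.smooth_v k i) hy) _

lemma hasExpansion_xvec (k : ℕ) : HasExpansion (continuousCoeff m ε k) fun x => D.xvec x := by
  unfold xvec bvec
  refine HasExpansion.add (HasExpansion.sum fun i _ =>
    HasExpansion.smul_const (C := continuousCoeff m ε k) ⟨?_, ?_⟩ _) ?_
  · exact (contDiff_piLp_apply (p := 2)).contDiffOn
  · exact Continuous.continuousOn (by fun_prop)
  · simpa using HasExpansion.smul_const (C := continuousCoeff m ε k) (c := fun _ => 1)
      ⟨contDiffOn_const, continuousOn_const⟩ D.xfvec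

lemma hasExpansion_eval {k : ℕ} {f : SuperFun m n} (hf : ∀ S, f S ∈ continuousCoeff m ε k) :
    HasExpansion (continuousCoeff m ε k) fun x => D.eval f x :=
  HasExpansion.sum fun S _ => HasExpansion.smul_const (hf S) _

lemma hasExpansion_dirac {k : ℕ} {f : SuperFun m n} (hf : ∀ S, f S ∈ continuousCoeff m ε k)
    (hf' : ∀ i S, pderiv i (f S) ∈ continuousCoeff m ε k) :
    HasExpansion (continuousCoeff m ε k) fun x => D.dirac f x := by
  simp only [dirac, sub_eq_add_neg]
  refine HasExpansion.add ((D.hasExpansion_eval hf).map _) ?_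
  exact (HasExpansion.sum fun i _ =>
    (D.hasExpansion_eval (hf' i)).map (LinearMap.mulLeft ℝ (D.eb i))).map (-LinearMap.id)

end SuperCalculus

lemma mem_continuousCoeff {m k : ℕ} {ε : ℝ} {Ω U : Set (Bos m)}
    (hB : Metric.closedBall (0 : Bos m) (1 + ε) ⊆ Ω) (hU : annulus m ε ⊆ U) {g : Bos m → ℝ}
    (hg : ContDiffOn ℝ 1 g Ω) (hgU : ContDiffOn ℝ k g U) : g ∈ continuousCoeff m ε k :=
  ⟨hgU.mono hU, hg.continuousOn.mono hB⟩

lemma pderiv_mem_continuousCoeff {m k : ℕ} {ε : ℝ} {Ω U : Set (Bos m)} (hΩ : IsOpen Ω) (hU : IsOpen U)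
    (hB : Metric.closedBall (0 : Bos m) (1 + ε) ⊆ Ω) (hAU : annulus m ε ⊆ U)
    (hAΩ : annulus m ε ⊆ Ω) {g : Bos m → ℝ}
    (hg : ContDiffOn ℝ 1 g Ω) (hgU : ContDiffOn ℝ k g U) (i : Fin m) :
    pderiv i g ∈ continuousCoeff m ε (k - 1) := by
  have h0 : ContDiffOn ℝ (0 : ℕ) (pderiv i g) Ω :=
    (hg.fderiv_of_isOpen hΩ (by norm_num)).clm_apply contDiffOn_const
  refine ⟨?_, h0.continuousOn.mono hB⟩
  -- For `k = 0` the class `C^{k-1}` means `C^0`, which comes from `g` being `C¹` on `Ω`.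
  rcases k with _ | k
  · exact h0.mono hAΩ
  · exact ((hgU.fderiv_of_isOpen hU (m := k) (by norm_cast)).clm_apply contDiffOn_const).mono hAU

namespace SuperCalculus
variable {m n : ℕ} {A : Type*} [Ring A] [Algebra ℝ A] (D : SuperCalculus m n A) {ε : ℝ}

/-- The limit `N → ∞` of a formula for smooth steps: the term `h_N` gives the integral over the ball, its
derivatives the layers `δ^{(j)}` of both the superball and the supersphere. -/
lemma tendsto_hasInt_smoothStep (hm : 0 < m) (hε0 : 0 < ε) (hε : ε < 1) {c d : ℕ → Bos m → ℝ}
    (hc : ∀ j, c j ∈ regularCoeff m ε (n - 1)) (hd : ∀ j, d j ∈ regularCoeff m ε n) {V : ℕ → ℝ} {W : ℝ}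
    (hV : ∀ N : ℕ, 1 / ((N : ℝ) + 1) < ε → HasInt (fun x => ∑ j ∈ Finset.range (n + 1),
      (iteratedDeriv j (smoothStep N) (1 - ‖x‖ ^ 2) * c j x
        + 2 * (iteratedDeriv (j + 1) (smoothStep N) (1 - ‖x‖ ^ 2) * d j x))) (V N))
    (hW : Tendsto V atTop (𝓝 W)) :
    2 * ∑ j ∈ Finset.range (n + 1), deltaPairing j (d j) +
      ((∫ x in Metric.closedBall (0 : Bos m) 1, c 0 x) +
        ∑ j ∈ Finset.range n, deltaPairing j (c (j + 1))) = W := by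
  have hlim : ∀ᶠ N : ℕ in atTop, 1 / ((N : ℝ) + 1) < ε :=
    tendsto_one_div_add_atTop_nhds_zero_nat.eventually (gt_mem_nhds hε0)
  have hdint : ∀ N : ℕ, 1 / ((N : ℝ) + 1) < ε → ∀ j,
      Integrable fun x => iteratedDeriv (j + 1) (smoothStep N) (1 - ‖x‖ ^ 2) * d j x :=
    fun N hN j => integrable_iteratedDeriv_succ_smoothStep_mul (hd j).1.continuousOn hN j
  have hcint : ∀ N : ℕ, 1 / ((N : ℝ) + 1) < ε → ∀ j,
      Integrable fun x => iteratedDeriv j (smoothStep N) (1 - ‖x‖ ^ 2) * c j x := by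
    rintro N hN (_ | j)
    · simpa using integrable_smoothStep_mul (hc 0).2 hN
    · exact integrable_iteratedDeriv_succ_smoothStep_mul (hc _).1.continuousOn hN j
  obtain ⟨g, hg0, hgs⟩ : ∃ g : ℕ → ℝ, g 0 = (∫ x in Metric.closedBall (0 : Bos m) 1, c 0 x) ∧
      ∀ j, g (j + 1) = deltaPairing j (c (j + 1)) := ⟨fun j => Nat.casesOn j
        (∫ x in Metric.closedBall (0 : Bos m) 1, c 0 x) fun i => deltaPairing i (c (i + 1)),
        rfl, fun _ => rfl⟩
  have hclim : ∀ j ∈ Finset.range (n + 1),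
      Tendsto (fun N => ∫ x, iteratedDeriv j (smoothStep N) (1 - ‖x‖ ^ 2) * c j x) atTop
        (𝓝 (g j)) := by
    rintro (_ | j) hj
    · simpa [hg0] using tendsto_integral_smoothStep hm hε0 (hc 0).2
    · rw [hgs]
      refine tendsto_integral_iteratedDeriv_smoothStep hm hε0 hε ((hc _).1.of_le ?_)
      have := Finset.mem_range.1 hj
      exact_mod_cast (by omega : j ≤ n - 1)
  have hdlim : ∀ j ∈ Finset.range (n + 1),
      Tendsto (fun N => ∫ x, iteratedDeriv (j + 1) (smoothStep N) (1 - ‖x‖ ^ 2) * d j x) atTop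
        (𝓝 (deltaPairing j (d j))) := by
    intro j hj
    refine tendsto_integral_iteratedDeriv_smoothStep hm hε0 hε ((hd _).1.of_le ?_)
    have := Finset.mem_range.1 hj
    exact_mod_cast (by omega : j ≤ n)
  have hT := tendsto_finsetSum (Finset.range (n + 1)) fun j hj =>
    (hclim j hj).add ((hdlim j hj).const_mul 2)
  have hT' := hT.congr' (f₂ := V) (by
    filter_upwards [hlim] with N hN
    have hsum : ∀ j ∈ Finset.range (n + 1), Integrable fun x =>
        iteratedDeriv j (smoothStep N) (1 - ‖x‖ ^ 2) * c j x
          + 2 * (iteratedDeriv (j + 1) (smoothStep N) (1 - ‖x‖ ^ 2) * d j x) :=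
      fun j _ => (hcint N hN j).add ((hdint N hN j).const_mul 2)
    rw [← (hV N hN).2, integral_finsetSum _ hsum]
    refine Finset.sum_congr rfl fun j _ => ?_
    rw [integral_add (hcint N hN j) ((hdint N hN j).const_mul 2), integral_const_mul])
  rw [← tendsto_nhds_unique hT' hW, Finset.sum_add_distrib, ← Finset.mul_sum]
  simp only [Finset.sum_range_succ' _ n, hg0, hgs]
  ring

/-- For `y` inside the ball, `h_N` is eventually constant near `1 - ‖y‖²`, with value `1`. -/
lemma tendsto_cutoff_value_of_lt {y : Bos m} (hy : ‖y‖ < 1) (f : SuperFun m n) (φ : A →ₗ[ℝ] ℝ) :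
    Tendsto (fun N => ∑ j ∈ Finset.range (n + 1), ∑ S, -(cutoff N j (f S) y *
        φ ((j.factorial : ℝ)⁻¹ • D.yfvec ^ (2 * j) * D.monomial' S))) atTop
      (𝓝 (φ (-D.eval' f y))) := by
  have hy2 : (0 : ℝ) < 1 - ‖y‖ ^ 2 := by nlinarith [norm_nonneg y]
  refine tendsto_const_nhds.congr' ?_
  filter_upwards [tendsto_one_div_add_atTop_nhds_zero_nat.eventually (gt_mem_nhds hy2)] with N hN
  rw [Finset.sum_eq_single 0]
  · simp [cutoff, smoothStep_of_ge N hN.le, eval']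
  · rintro (_ | j) - hj
    · exact absurd rfl hj
    · simp [cutoff, iteratedDeriv_succ_smoothStep_of_gt N j hN]
  · simp

lemma tendsto_cutoff_value_of_gt {y : Bos m} (hy : 1 < ‖y‖) (f : SuperFun m n) (φ : A →ₗ[ℝ] ℝ) :
    Tendsto (fun N => ∑ j ∈ Finset.range (n + 1), ∑ S, -(cutoff N j (f S) y *
        φ ((j.factorial : ℝ)⁻¹ • D.yfvec ^ (2 * j) * D.monomial' S))) atTop (𝓝 0) := by
  have hy2 : (0 : ℝ) < ‖y‖ ^ 2 - 1 := by nlinarith [norm_nonneg y]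
  refine tendsto_const_nhds.congr' ?_
  filter_upwards [tendsto_one_div_add_atTop_nhds_zero_nat.eventually (gt_mem_nhds hy2)] with N hN
  refine (Finset.sum_eq_zero fun j _ => Finset.sum_eq_zero fun S _ => ?_).symm
  rw [cutoff, iteratedDeriv_smoothStep_of_lt N j (by linarith), zero_mul, zero_mul, neg_zero]

/-- The Cauchy–Pompeiu formula on the supersphere, in any realisation of the superalgebra. -/
theorem cauchyPompeiu (hm : 0 < m) {s : ℕ → Bos m → ℝ} {v : ℕ → Fin m → Bos m → ℝ}
    (h : IsFundamentalFamily m s v) {Ω U : Set (Bos m)} (hΩ : IsOpen Ω)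
    (hBΩ : Metric.closedBall (0 : Bos m) 1 ⊆ Ω) (hU : IsOpen U)
    (hSU : Metric.sphere (0 : Bos m) 1 ⊆ U) (f : SuperFun m n) (hf : f.CkOn 1 Ω) (hfU : f.CkOn n U)
    {y : Bos m} (hy : ‖y‖ ≠ 1) :
    ∃ V : Set (Bos m), IsOpen V ∧ Metric.sphere (0 : Bos m) 1 ⊆ V ∧ ∃ I J : A,
      (∀ φ : A →ₗ[ℝ] ℝ,
        ContDiffOn ℝ n (fun x => φ (D.kernel s v (x - y) * D.xvec x * D.eval f x)) V ∧
        ContDiffOn ℝ (n - 1 : ℕ) (fun x => φ (D.kernel s v (x - y) * D.dirac f x)) V ∧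
        IntegrableOn (fun x => φ (D.kernel s v (x - y) * D.dirac f x)) (Metric.closedBall 0 1) ∧
        φ I = 2 * ∑ j ∈ Finset.range (n + 1), deltaPairing j (fun x =>
          φ (D.berezin (D.taylorCoeff j * (D.kernel s v (x - y) * D.xvec x * D.eval f x)))) ∧
        φ J = (∫ x in Metric.closedBall (0 : Bos m) 1,
            φ (D.berezin (D.kernel s v (x - y) * D.dirac f x)))
          + ∑ j ∈ Finset.range n, deltaPairing j fun x =>
            φ (D.berezin (D.taylorCoeff (j + 1) * (D.kernel s v (x - y) * D.dirac f x)))) ∧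
      (‖y‖ < 1 → I + J = -D.eval' f y) ∧ (1 < ‖y‖ → I + J = 0) := by
  obtain ⟨δ, hδ0, hδ1, hδ⟩ := exists_annulus_subset
    ((hU.inter hΩ).inter (isOpen_compl_singleton (x := y))) (fun x hx => ⟨⟨hSU hx, hBΩ
      (Metric.sphere_subset_closedBall hx)⟩, fun hxy => hy (by
        rw [← mem_singleton_iff.1 hxy]; simpa using hx)⟩)
  -- With `δ / 3` the closed ball of radius `1 + ε` stays within the shell `‖x‖² < 1 + δ`.
  set ε := δ / 3 with hεδ
  have hε0 : 0 < ε := by positivity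
  have hε : ε < 1 := by linarith
  have hsub : annulus m ε ⊆ annulus m δ := fun x hx => ⟨by linarith [hx.1], by linarith [hx.2]⟩
  have hAU : annulus m ε ⊆ U := fun x hx => (hδ (hsub hx)).1.1
  have hAΩ : annulus m ε ⊆ Ω := fun x hx => (hδ (hsub hx)).1.2
  have hyA : y ∉ annulus m ε := fun hx => (hδ (hsub hx)).2 rfl
  have hB : Metric.closedBall (0 : Bos m) (1 + ε) ⊆ Ω := by
    intro x hx
    rw [mem_closedBall_zero_iff] at hx
    by_cases hx1 : ‖x‖ ≤ 1
    · exact hBΩ (mem_closedBall_zero_iff.2 hx1)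
    · exact (hδ ⟨by nlinarith, by nlinarith⟩).1.2
  have hfc : ∀ S, f S ∈ continuousCoeff m ε n := fun S => mem_continuousCoeff hB hAU (hf S) (hfU S)
  have hfc' : ∀ S, f S ∈ continuousCoeff m ε (n - 1) := fun S =>
    ⟨(hfc S).1.of_le (by exact_mod_cast Nat.sub_le n 1), (hfc S).2⟩
  have hF : HasExpansion (regularCoeff m ε n)
      fun x => D.kernel s v (x - y) * D.xvec x * D.eval f x :=
    ((D.hasExpansion_kernel h hyA n).mul (D.hasExpansion_xvec n)
      fun c hc d hd => mul_mem_regularCoeff hc hd).mul (D.hasExpansion_eval hfc)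
      fun c hc d hd => mul_mem_regularCoeff hc hd
  have hG : HasExpansion (regularCoeff m ε (n - 1)) fun x => D.kernel s v (x - y) * D.dirac f x :=
    (D.hasExpansion_kernel h hyA _).mul (D.hasExpansion_dirac hfc' fun i S =>
      pderiv_mem_continuousCoeff hΩ hU hB hAU hAΩ (hf S) (hfU S) i)
      fun c hc d hd => mul_mem_regularCoeff hc hd
  have hFj : ∀ j, HasExpansion (regularCoeff m ε n) fun x =>
      D.berezin (D.taylorCoeff j * (D.kernel s v (x - y) * D.xvec x * D.eval f x)) :=
    fun j => hF.map (D.berezin ∘ₗ LinearMap.mulLeft ℝ (D.taylorCoeff j))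
  have hGj : ∀ j, HasExpansion (regularCoeff m ε (n - 1)) fun x =>
      D.berezin (D.taylorCoeff j * (D.kernel s v (x - y) * D.dirac f x)) :=
    fun j => hG.map (D.berezin ∘ₗ LinearMap.mulLeft ℝ (D.taylorCoeff j))
  have hG0 : HasExpansion (regularCoeff m ε (n - 1)) fun x =>
      D.berezin (D.kernel s v (x - y) * D.dirac f x) := hG.map D.berezin
  have hI : ∀ j : Fin (n + 1), ∃ I : A, ∀ φ : A →ₗ[ℝ] ℝ, φ I = deltaPairing j fun x =>
      φ (D.berezin (D.taylorCoeff j * (D.kernel s v (x - y) * D.xvec x * D.eval f x))) :=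
    fun j => (hFj j).exists_extend (deltaFunctional m hε0 hε (by omega))
  have hJ : ∀ j : Fin n, ∃ J : A, ∀ φ : A →ₗ[ℝ] ℝ, φ J = deltaPairing j fun x =>
      φ (D.berezin (D.taylorCoeff (j + 1) * (D.kernel s v (x - y) * D.dirac f x))) :=
    fun j => (hGj (j + 1)).exists_extend (deltaFunctional m hε0 hε (by omega))
  obtain ⟨J₀, hJ₀⟩ : ∃ J : A, ∀ φ : A →ₗ[ℝ] ℝ, φ J = ∫ x in Metric.closedBall (0 : Bos m) 1,
      φ (D.berezin (D.kernel s v (x - y) * D.dirac f x)) :=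
    hG0.exists_extend (ballFunctional m hε0 (n - 1))
  choose I hI using hI
  choose J hJ using hJ
  have hIsum : ∀ φ : A →ₗ[ℝ] ℝ, φ ((2 : ℝ) • ∑ j, I j) =
      2 * ∑ j ∈ Finset.range (n + 1), deltaPairing j fun x =>
        φ (D.berezin (D.taylorCoeff j * (D.kernel s v (x - y) * D.xvec x * D.eval f x))) := by
    intro φ
    rw [map_smul, map_sum, Finset.sum_range, smul_eq_mul]
    simp only [hI]
  have hJsum : ∀ φ : A →ₗ[ℝ] ℝ, φ (J₀ + ∑ j, J j) = (∫ x in Metric.closedBall (0 : Bos m) 1,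
        φ (D.berezin (D.kernel s v (x - y) * D.dirac f x)))
      + ∑ j ∈ Finset.range n, deltaPairing j fun x =>
        φ (D.berezin (D.taylorCoeff (j + 1) * (D.kernel s v (x - y) * D.dirac f x))) := by
    intro φ
    rw [map_add, map_sum, Finset.sum_range, hJ₀]
    simp only [hJ]
  have key : ∀ (φ : A →ₗ[ℝ] ℝ) (W : ℝ), Tendsto (fun N => ∑ j ∈ Finset.range (n + 1), ∑ S,
      -(cutoff N j (f S) y * φ ((j.factorial : ℝ)⁻¹ • D.yfvec ^ (2 * j) * D.monomial' S))) atTop (𝓝 W) →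
      φ ((2 : ℝ) • ∑ j, I j + (J₀ + ∑ j, J j)) = W := by
    intro φ W hW
    rw [map_add, hIsum, hJsum, ← tendsto_hasInt_smoothStep hm hε0 hε
      (fun j => (hGj j).apply_mem φ) (fun j => (hFj j).apply_mem φ)
      (fun N hN => D.hasInt_smoothStep h hΩ hB hN f hf y φ) hW]
    simp [taylorCoeff]
  refine ⟨annulus m ε, isOpen_annulus ε, sphere_subset_annulus hε0, (2 : ℝ) • ∑ j, I j, J₀ + ∑ j, J j,
    fun φ => ⟨(hF.apply_mem φ).1, (hG.apply_mem φ).1,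
      regularCoeff.integrableOn_ball hε0 ⟨_, hG.apply_mem φ⟩, hIsum φ, hJsum φ⟩, fun hy1 => ?_, fun hy1 => ?_⟩
  · refine sub_eq_zero.1 ((Module.forall_dual_apply_eq_zero_iff ℝ _).1 fun φ => ?_)
    rw [map_sub, key φ _ (D.tendsto_cutoff_value_of_lt hy1 f φ), sub_self]
  · exact (Module.forall_dual_apply_eq_zero_iff ℝ _).1 fun φ =>
      key φ _ (D.tendsto_cutoff_value_of_gt hy1 f φ)

end SuperCalculus

/-! ### The Cauchy–Pompeiu formula in the superalgebra -/

section Realisation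
variable {m n : ℕ}

lemma superCalculus_zfvec : (superCalculus m n).zfvec = xyfvec := by
  unfold SuperCalculus.zfvec SuperCalculus.fvec xyfvec
  refine Finset.sum_congr rfl fun a _ => ?_
  rw [map_sub]
  rfl

lemma superCalculus_kernel (s : ℕ → Bos m → ℝ) (v : ℕ → Fin m → Bos m → ℝ) (z : Bos m) :
    (superCalculus m n).kernel s v z = kernel s v z := by
  unfold SuperCalculus.kernel
  rw [superCalculus_zfvec]
  rfl

lemma superCalculus_dirac (f : SuperFun m n) (x : Bos m) :
    (superCalculus m n).dirac f x = dirac f x := by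
  unfold SuperCalculus.dirac
  rw [SuperCalculus.fermDirac_eq]
  rfl

end Realisation

/-! ### Singularities of power type -/

section Order
variable {m : ℕ} {a b : ℝ} {F G : Bos m → ℝ}

/-- `F` is continuous off the origin and `O(‖x‖^a)` on every ball around the origin. -/
def HasOrder (a : ℝ) (F : Bos m → ℝ) : Prop :=
  ContinuousOn F {0}ᶜ ∧ ∀ R : ℝ, ∃ C, 0 ≤ C ∧ ∀ x, x ≠ 0 → ‖x‖ ≤ R → |F x| ≤ C * ‖x‖ ^ a

lemma HasOrder.add (hF : HasOrder a F) (hG : HasOrder a G) : HasOrder a fun x => F x + G x := by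
  refine ⟨hF.1.add hG.1, fun R => ?_⟩
  obtain ⟨C, hC0, hC⟩ := hF.2 R
  obtain ⟨C', hC0', hC'⟩ := hG.2 R
  refine ⟨C + C', add_nonneg hC0 hC0', fun x hx hR => ?_⟩
  rw [add_mul]
  exact (abs_add_le _ _).trans (add_le_add (hC x hx hR) (hC' x hx hR))

lemma HasOrder.const_mul (hF : HasOrder a F) (c : ℝ) : HasOrder a fun x => c * F x := by
  refine ⟨continuousOn_const.mul hF.1, fun R => ?_⟩
  obtain ⟨C, hC0, hC⟩ := hF.2 R
  refine ⟨|c| * C, by positivity, fun x hx hR => ?_⟩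
  rw [abs_mul, mul_assoc]
  exact mul_le_mul_of_nonneg_left (hC x hx hR) (abs_nonneg c)

lemma HasOrder.mul (hF : HasOrder a F) (hG : HasOrder b G) :
    HasOrder (a + b) fun x => F x * G x := by
  refine ⟨hF.1.mul hG.1, fun R => ?_⟩
  obtain ⟨C, hC0, hC⟩ := hF.2 R
  obtain ⟨C', hC0', hC'⟩ := hG.2 R
  refine ⟨C * C', mul_nonneg hC0 hC0', fun x hx hR => ?_⟩
  rw [abs_mul, Real.rpow_add (norm_pos_iff.2 hx), mul_mul_mul_comm]
  exact mul_le_mul (hC x hx hR) (hC' x hx hR) (abs_nonneg _) (by positivity)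

lemma hasOrder_norm_rpow (a : ℝ) : HasOrder a fun x : Bos m => ‖x‖ ^ a := by
  refine ⟨continuousOn_id.norm.rpow_const fun x hx => Or.inl (norm_ne_zero_iff.2 hx),
    fun R => ⟨1, zero_le_one, fun x _ _ => ?_⟩⟩
  rw [one_mul, abs_of_nonneg (by positivity)]

lemma hasOrder_coord (i : Fin m) : HasOrder 1 fun x : Bos m => x i := by
  refine ⟨Continuous.continuousOn (by fun_prop), fun R => ⟨1, zero_le_one, fun x _ _ => ?_⟩⟩
  rw [one_mul, Real.rpow_one, ← Real.norm_eq_abs]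
  exact PiLp.norm_apply_le x i

lemma integrableOn_norm_rpow (hm : 0 < m) (ha : -(m : ℝ) < a) (R : ℝ) :
    IntegrableOn (fun x : Bos m => ‖x‖ ^ a) (Metric.ball 0 R) volume := by
  have : Nonempty (Fin m) := ⟨⟨0, hm⟩⟩
  rcases le_or_gt R 0 with hR | hR
  · rw [Metric.ball_eq_empty.2 hR]
    exact integrableOn_empty
  rw [integrableOn_fun_norm_addHaar (volume : Measure (Bos m)) (f := fun r => r ^ a), finrank_euclideanSpace_fin]
  refine (integrableOn_congr_fun (fun r hr => ?_) measurableSet_Ioo).2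
    ((intervalIntegral.integrableOn_Ioo_rpow_iff (s := (m - 1 : ℕ) + a) hR).2 ?_)
  · rw [smul_eq_mul, Real.rpow_add hr.1, Real.rpow_natCast]
  · rw [Nat.cast_sub (by omega)]
    push_cast
    linarith

lemma aestronglyMeasurable_of_continuousOn_compl (hm : 0 < m) (hF : ContinuousOn F {0}ᶜ) :
    AEStronglyMeasurable F volume := by
  have : Nonempty (Fin m) := ⟨⟨0, hm⟩⟩
  have := hF.aestronglyMeasurable (μ := volume) (measurableSet_singleton (0 : Bos m)).compl
  rwa [restrict_compl_singleton] at this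

lemma ae_ne_zero (hm : 0 < m) : ∀ᵐ x : Bos m, x ≠ 0 := by
  have : Nonempty (Fin m) := ⟨⟨0, hm⟩⟩
  exact Measure.ae_ne volume 0

lemma HasOrder.locallyIntegrable (hm : 0 < m) (hF : HasOrder a F) (ha : -(m : ℝ) < a) :
    LocallyIntegrable F volume := by
  rw [locallyIntegrable_iff]
  intro K hK
  obtain ⟨R, hR⟩ := hK.isBounded.subset_ball 0
  obtain ⟨C, hC0, hC⟩ := hF.2 R
  refine IntegrableOn.mono_set ?_ hR
  refine Integrable.mono' ((integrableOn_norm_rpow hm ha R).const_mul C)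
    (aestronglyMeasurable_of_continuousOn_compl hm hF.1).restrict ?_
  filter_upwards [ae_restrict_mem Metric.isOpen_ball.measurableSet, ae_restrict_of_ae (ae_ne_zero hm)]
    with x hx hx0
  exact hC x hx0 (mem_ball_zero_iff.1 hx).le

end Order

/-! ### Integration by parts across a point singularity -/

section Puncture
variable {m : ℕ}

/-- The cutoff `χ_N`, which is `0` for `N ‖x‖² ≤ 1` and `1` for `N ‖x‖² ≥ 2`. -/
noncomputable def puncture (N : ℕ) (x : Bos m) : ℝ := Real.smoothTransition (N * ‖x‖ ^ 2 - 1)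

lemma puncture_contDiff (N : ℕ) : ContDiff ℝ ∞ (puncture (m := m) N) :=
  Real.smoothTransition.contDiff.comp ((contDiff_const.mul (contDiff_norm_sq ℝ)).sub contDiff_const)

lemma abs_puncture_le (N : ℕ) (x : Bos m) : |puncture N x| ≤ 1 := by
  rw [puncture, abs_of_nonneg (Real.smoothTransition.nonneg _)]
  exact Real.smoothTransition.le_one _

lemma puncture_eventuallyEq_zero (N : ℕ) : puncture N =ᶠ[𝓝 (0 : Bos m)] fun _ => 0 := by
  have : IsOpen {x : Bos m | (N : ℝ) * ‖x‖ ^ 2 < 1} := isOpen_lt (by fun_prop) (by fun_prop)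
  filter_upwards [this.mem_nhds (by simp)] with x hx
  have hx : (N : ℝ) * ‖x‖ ^ 2 < 1 := hx
  exact Real.smoothTransition.zero_of_nonpos (by linarith)

lemma pderiv_puncture (N : ℕ) (i : Fin m) (x : Bos m) :
    pderiv i (puncture N) x = deriv Real.smoothTransition (N * ‖x‖ ^ 2 - 1) * (N * (2 * x i)) := by
  have h1 : HasFDerivAt (fun x : Bos m => (N : ℝ) * ‖x‖ ^ 2 - 1) ((N : ℝ) • (2 • innerSL ℝ x)) x :=
    ((hasStrictFDerivAt_norm_sq x).hasFDerivAt.const_mul (N : ℝ)).sub_const 1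
  have h2 : HasDerivAt Real.smoothTransition (deriv Real.smoothTransition (N * ‖x‖ ^ 2 - 1))
      (N * ‖x‖ ^ 2 - 1) :=
    ((Real.smoothTransition.contDiff (n := 1)).differentiable (by simp) _).hasDerivAt
  have h4 : pderiv i (puncture N) x = _ :=
    congrArg (fun L : Bos m →L[ℝ] ℝ => L (EuclideanSpace.single i 1)) (h2.comp_hasFDerivAt x h1).fderiv
  rw [h4]
  simp [EuclideanSpace.inner_single_right]

lemma eventually_puncture_eq_one {x : Bos m} (hx : x ≠ 0) :
    ∀ᶠ N : ℕ in atTop, puncture N x = 1 ∧ deriv Real.smoothTransition (N * ‖x‖ ^ 2 - 1) = 0 := by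
  have hx2 : 0 < ‖x‖ ^ 2 := by positivity
  filter_upwards [(tendsto_natCast_atTop_atTop (R := ℝ)).eventually (eventually_gt_atTop (2 / ‖x‖ ^ 2))]
    with N hN
  have hN : 1 < N * ‖x‖ ^ 2 - 1 := by
    have := (div_lt_iff₀ hx2).1 hN
    linarith
  refine ⟨Real.smoothTransition.one_of_one_le hN.le, ?_⟩
  have : Real.smoothTransition =ᶠ[𝓝 (N * ‖x‖ ^ 2 - 1)] fun _ => 1 := by
    filter_upwards [Ioi_mem_nhds hN] with t ht using Real.smoothTransition.one_of_one_le (le_of_lt ht)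
  rw [this.deriv_eq, deriv_const]

lemma exists_abs_deriv_smoothTransition_le :
    ∃ K, 0 ≤ K ∧ ∀ t, |deriv Real.smoothTransition t| ≤ K ∧
      (1 < t → deriv Real.smoothTransition t = 0) := by
  have h1 : ∀ t : ℝ, 1 < t → deriv Real.smoothTransition t = 0 := by
    intro t ht
    have : Real.smoothTransition =ᶠ[𝓝 t] fun _ => 1 := by
      filter_upwards [Ioi_mem_nhds ht] with u hu using Real.smoothTransition.one_of_one_le (le_of_lt hu)
    rw [this.deriv_eq, deriv_const]
  have h0 : ∀ t : ℝ, t < 0 → deriv Real.smoothTransition t = 0 := by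
    intro t ht
    have : Real.smoothTransition =ᶠ[𝓝 t] fun _ => 0 := by
      filter_upwards [Iio_mem_nhds ht] with u hu using Real.smoothTransition.zero_of_nonpos (le_of_lt hu)
    rw [this.deriv_eq, deriv_const]
  have hc : Continuous (deriv Real.smoothTransition) :=
    (Real.smoothTransition.contDiff (n := 1)).continuous_deriv le_rfl
  obtain ⟨K, hK⟩ := (isCompact_Icc (a := (0 : ℝ)) (b := 1)).exists_bound_of_continuousOn hc.continuousOn
  have hK0 : 0 ≤ K := (norm_nonneg _).trans (hK 0 (by simp))
  refine ⟨K, hK0, fun t => ⟨?_, h1 t⟩⟩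
  by_cases h : t < 0
  · rw [h0 t h, abs_zero]; exact hK0
  by_cases h' : 1 < t
  · rw [h1 t h', abs_zero]; exact hK0
  exact hK t ⟨not_lt.1 h, not_lt.1 h'⟩

/-- The gradient of the cutoff is `O(1/‖x‖)`, uniformly in `N`: it lives where `N ‖x‖² ≤ 2`. -/
lemma exists_abs_pderiv_puncture_le :
    ∃ K, 0 ≤ K ∧ ∀ (N : ℕ) (i : Fin m) (x : Bos m), x ≠ 0 →
      |pderiv i (puncture N) x| ≤ K * ‖x‖ ^ (-1 : ℝ) := by
  obtain ⟨K, hK0, hK⟩ := exists_abs_deriv_smoothTransition_le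
  refine ⟨4 * K, by positivity, fun N i x hx => ?_⟩
  have hxp : 0 < ‖x‖ := norm_pos_iff.2 hx
  rw [pderiv_puncture, Real.rpow_neg_one]
  by_cases h : 1 < N * ‖x‖ ^ 2 - 1
  · rw [(hK _).2 h, zero_mul, abs_zero]
    positivity
  have hxi : |x i| ≤ ‖x‖ := by
    rw [← Real.norm_eq_abs]
    exact PiLp.norm_apply_le x i
  have hN : (N : ℝ) * (2 * |x i|) ≤ 4 * ‖x‖⁻¹ := by
    rw [← div_eq_mul_inv, le_div_iff₀ hxp]
    have h2 : (N : ℝ) * |x i| * ‖x‖ ≤ N * ‖x‖ * ‖x‖ := by gcongr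
    nlinarith
  rw [abs_mul, abs_mul, abs_mul, abs_two, Nat.abs_cast]
  calc |deriv Real.smoothTransition (N * ‖x‖ ^ 2 - 1)| * (N * (2 * |x i|))
      ≤ K * (4 * ‖x‖⁻¹) := mul_le_mul (hK _).1 hN (by positivity) hK0
    _ = 4 * K * ‖x‖⁻¹ := by ring

variable {a b : ℝ} {G G' : Bos m → ℝ}

/-- Integration by parts away from the singularity. -/
lemma integral_puncture_mul_pderiv (hG : ContDiffOn ℝ 1 G {0}ᶜ) (i : Fin m)
    {φ : Bos m → ℝ} (hφ : ContDiff ℝ ∞ φ) (hφc : HasCompactSupport φ) (N : ℕ) :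
    ∫ x, puncture N x * (G x * pderiv i φ x) =
      -∫ x, (puncture N x * (pderiv i G x * φ x) + pderiv i (puncture N) x * (G x * φ x)) := by
  have hφ1 : ContDiff ℝ 1 φ := hφ.of_le (by exact_mod_cast le_top)
  have hz : (fun x => puncture N x * G x) =ᶠ[𝓝 0] fun _ => 0 := by
    filter_upwards [puncture_eventuallyEq_zero N] with x hx
    rw [hx, zero_mul]
  have hGat : ∀ x : Bos m, x ≠ 0 → ContDiffAt ℝ 1 G x := fun x hx =>
    hG.contDiffAt (isOpen_compl_singleton.mem_nhds hx)
  have hp1 : ContDiff ℝ 1 (puncture (m := m) N) := (puncture_contDiff N).of_le (by exact_mod_cast le_top)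
  have hC : ContDiff ℝ 1 fun x => puncture N x * G x := by
    rw [contDiff_iff_contDiffAt]
    intro x
    by_cases hx : x = 0
    · rw [hx]
      exact contDiffAt_const.congr_of_eventuallyEq hz
    · exact hp1.contDiffAt.mul (hGat x hx)
  have hd : ∀ x, fderiv ℝ (fun x => puncture N x * G x) x (EuclideanSpace.single i 1) =
      puncture N x * pderiv i G x + pderiv i (puncture N) x * G x := by
    intro x
    by_cases hx : x = 0
    · rw [hx, hz.fderiv_eq, pderiv, pderiv, (puncture_eventuallyEq_zero N).fderiv_eq,
        (puncture_eventuallyEq_zero N).eq_of_nhds]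
      simp
    · rw [fderiv_fun_mul (hp1.differentiable (by simp) x) ((hGat x hx).differentiableAt (by simp))]
      simp [pderiv, mul_comm]
  have hcd : Continuous fun x => fderiv ℝ (fun x => puncture N x * G x) x (EuclideanSpace.single i 1) :=
    (hC.continuous_fderiv (by simp)).clm_apply continuous_const
  have := integral_mul_fderiv_eq_neg_fderiv_mul_of_integrable (μ := (volume : Measure (Bos m)))
    (f := fun x => puncture N x * G x) (g := φ) (v := EuclideanSpace.single i 1)
    ((hcd.mul hφ.continuous).integrable_of_hasCompactSupport hφc.mul_left)
    ((hC.continuous.mul (pderiv_continuous hφ1 i)).integrable_of_hasCompactSupport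
      (pderiv_hasCompactSupport hφc i).mul_left)
    ((hC.continuous.mul hφ.continuous).integrable_of_hasCompactSupport hφc.mul_left)
    (fun x _ => hC.differentiable (by simp) x) (fun x _ => hφ1.differentiable (by simp) x)
  simp only [hd] at this
  calc _ = ∫ x, puncture N x * G x * fderiv ℝ φ x (EuclideanSpace.single i 1) := by
        simp only [pderiv, mul_assoc]
    _ = _ := this
    _ = _ := by
        congr 2
        funext x
        ring

/-- A singularity of order greater than `1 - m` at the origin does not contribute to the
distributional derivative. -/
lemma HasOrder.integral_mul_pderiv (hm : 0 < m) (hG : HasOrder a G) (ha : 1 - (m : ℝ) < a)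
    (hGd : ContDiffOn ℝ 1 G {0}ᶜ) (hG' : HasOrder b G') (hb : -(m : ℝ) < b) (i : Fin m)
    (hd : ∀ x, x ≠ 0 → pderiv i G x = G' x) {φ : Bos m → ℝ} (hφ : ContDiff ℝ ∞ φ)
    (hφc : HasCompactSupport φ) :
    ∫ x, G x * pderiv i φ x = -∫ x, G' x * φ x := by
  have hφ1 : ContDiff ℝ 1 φ := hφ.of_le (by exact_mod_cast le_top)
  obtain ⟨K, hK0, hK⟩ := exists_abs_pderiv_puncture_le (m := m)
  have hi1 : Integrable fun x => G x * pderiv i φ x :=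
    integrable_mul_of_locallyIntegrable (hG.locallyIntegrable hm (by linarith))
      (pderiv_continuous hφ1 i) (pderiv_hasCompactSupport hφc i)
  have hi2 : Integrable fun x => G' x * φ x :=
    integrable_mul_of_locallyIntegrable (hG'.locallyIntegrable hm hb) hφ.continuous hφc
  have hi3 : Integrable fun x => ‖x‖ ^ (-1 : ℝ) * G x * φ x :=
    integrable_mul_of_locallyIntegrable (((hasOrder_norm_rpow (-1)).mul hG).locallyIntegrable hm
      (by linarith)) hφ.continuous hφc
  have hpc : ∀ N, Continuous (puncture (m := m) N) := fun N => (puncture_contDiff N).continuous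
  have hpd : ∀ N, Continuous (pderiv i (puncture (m := m) N)) := fun N =>
    pderiv_continuous ((puncture_contDiff N).of_le (by exact_mod_cast le_top)) i
  have hGm := aestronglyMeasurable_of_continuousOn_compl hm hG.1
  have hGm' := aestronglyMeasurable_of_continuousOn_compl hm hG'.1
  have hl : Tendsto (fun N : ℕ => ∫ x, puncture N x * (G x * pderiv i φ x)) atTop
      (𝓝 (∫ x, G x * pderiv i φ x)) := by
    refine tendsto_integral_of_dominated_convergence (fun x => ‖G x * pderiv i φ x‖)
      (fun N => (hpc N).aestronglyMeasurable.mul hi1.1) hi1.norm (fun N => ae_of_all _ fun x => ?_) ?_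
    · rw [norm_mul]
      exact mul_le_of_le_one_left (norm_nonneg _) (abs_puncture_le N x)
    · filter_upwards [ae_ne_zero hm] with x hx
      refine tendsto_const_nhds.congr' ?_
      filter_upwards [eventually_puncture_eq_one hx] with N hN
      rw [hN.1, one_mul]
  have hr : Tendsto (fun N : ℕ => ∫ x, (puncture N x * (pderiv i G x * φ x)
      + pderiv i (puncture N) x * (G x * φ x))) atTop (𝓝 (∫ x, G' x * φ x)) := by
    have e : ∀ N : ℕ, ∫ x, (puncture N x * (pderiv i G x * φ x)
      + pderiv i (puncture N) x * (G x * φ x)) = ∫ x, (puncture N x * (G' x * φ x)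
      + pderiv i (puncture N) x * (G x * φ x)) := by
      intro N
      refine integral_congr_ae ?_
      filter_upwards [ae_ne_zero hm] with x hx
      rw [hd x hx]
    simp only [e]
    refine tendsto_integral_of_dominated_convergence
      (fun x => ‖G' x * φ x‖ + K * ‖‖x‖ ^ (-1 : ℝ) * G x * φ x‖)
      (fun N => ((hpc N).aestronglyMeasurable.mul hi2.1).add
        ((hpd N).aestronglyMeasurable.mul (hGm.mul hφ.continuous.aestronglyMeasurable)))
      (hi2.norm.add (hi3.norm.const_mul K)) (fun N => ?_) ?_
    · filter_upwards [ae_ne_zero hm] with x hx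
      refine (norm_add_le _ _).trans (add_le_add ?_ ?_)
      · rw [norm_mul]
        exact mul_le_of_le_one_left (norm_nonneg _) (abs_puncture_le N x)
      · rw [norm_mul, mul_assoc (‖x‖ ^ (-1 : ℝ)), norm_mul (‖x‖ ^ (-1 : ℝ)), ← mul_assoc,
          Real.norm_of_nonneg (by positivity : 0 ≤ ‖x‖ ^ (-1 : ℝ))]
        exact mul_le_mul_of_nonneg_right (hK N i x hx) (norm_nonneg _)
    · filter_upwards [ae_ne_zero hm] with x hx
      refine tendsto_const_nhds.congr' ?_
      filter_upwards [eventually_puncture_eq_one hx] with N hN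
      rw [pderiv_puncture, hN.1, hN.2]
      ring
  refine tendsto_nhds_unique hl (hr.neg.congr fun N => ?_)
  exact (integral_puncture_mul_pderiv hGd i hφ hφc N).symm

end Puncture

/-! ### Radial functions of power-logarithm type -/

section PowLog
variable {m : ℕ}

/-- The function `t^p (A log t + B)`. -/
noncomputable def powLog (p A B t : ℝ) : ℝ := t ^ p * (A * Real.log t + B)

lemma hasDerivAt_powLog (p A B : ℝ) {t : ℝ} (ht : 0 < t) :
    HasDerivAt (powLog p A B) (powLog (p - 1) (p * A) (p * B + A) t) t := by
  have h := (Real.hasDerivAt_rpow_const (p := p) (Or.inl ht.ne')).mul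
    (((Real.hasDerivAt_log ht.ne').const_mul A).add_const B)
  refine h.congr_deriv ?_
  have e : t ^ p = t ^ (p - 1) * t := by
    rw [← Real.rpow_add_one ht.ne', sub_add_cancel]
  rw [powLog, e]
  field_simp
  ring

lemma mul_powLog_sub_one (p A B : ℝ) {t : ℝ} (ht : 0 < t) :
    t * powLog (p - 1) A B t = powLog p A B t := by
  have e : t ^ p = t ^ (p - 1) * t := by
    rw [← Real.rpow_add_one ht.ne', sub_add_cancel]
  rw [powLog, powLog, e]
  ring

lemma contDiffOn_powLog (p A B : ℝ) : ContDiffOn ℝ ∞ (powLog p A B) (Ioi 0) :=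
  (contDiffOn_id.rpow_const_of_ne fun _ ht => ht.ne').mul
    ((contDiffOn_const.mul (contDiffOn_id.log fun _ ht => ht.ne')).add contDiffOn_const)

lemma contDiffOn_powLog_norm_sq (p A B : ℝ) :
    ContDiffOn ℝ ∞ (fun x : Bos m => powLog p A B (‖x‖ ^ 2)) {0}ᶜ :=
  (contDiffOn_powLog p A B).comp (contDiff_norm_sq ℝ).contDiffOn fun _ hx =>
    pow_pos (norm_pos_iff.2 hx) 2

lemma pderiv_powLog_norm_sq (p A B : ℝ) (i : Fin m) {x : Bos m} (hx : x ≠ 0) :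
    pderiv i (fun x => powLog p A B (‖x‖ ^ 2)) x =
      2 * x i * powLog (p - 1) (p * A) (p * B + A) (‖x‖ ^ 2) := by
  have hx2 : 0 < ‖x‖ ^ 2 := pow_pos (norm_pos_iff.2 hx) 2
  have h1 : HasFDerivAt (fun x : Bos m => ‖x‖ ^ 2) (2 • innerSL ℝ x) x :=
    (hasStrictFDerivAt_norm_sq x).hasFDerivAt
  have h3 := (hasDerivAt_powLog p A B hx2).comp_hasFDerivAt x h1
  have h4 : pderiv i (fun x => powLog p A B (‖x‖ ^ 2)) x = _ :=
    congrArg (fun L : Bos m →L[ℝ] ℝ => L (EuclideanSpace.single i 1)) h3.fderiv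
  rw [h4]
  simp [EuclideanSpace.inner_single_right]
  ring

lemma pderiv_coord_mul_powLog_norm_sq (p A B c : ℝ) (i : Fin m) {x : Bos m} (hx : x ≠ 0) :
    pderiv i (fun x => c * x i * powLog p A B (‖x‖ ^ 2)) x =
      c * powLog p A B (‖x‖ ^ 2)
        + c * x i * (2 * x i * powLog (p - 1) (p * A) (p * B + A) (‖x‖ ^ 2)) := by
  have h1 : HasFDerivAt (fun x : Bos m => c * x i) (c • (EuclideanSpace.proj i : Bos m →L[ℝ] ℝ)) x :=
    (EuclideanSpace.proj i : Bos m →L[ℝ] ℝ).hasFDerivAt.const_mul c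
  have h2 : DifferentiableAt ℝ (fun x : Bos m => powLog p A B (‖x‖ ^ 2)) x :=
    ((contDiffOn_powLog_norm_sq p A B).contDiffAt
      (isOpen_compl_singleton.mem_nhds hx)).differentiableAt (by simp)
  have h4 : pderiv i (fun x => c * x i * powLog p A B (‖x‖ ^ 2)) x = _ :=
    congrArg (fun L : Bos m →L[ℝ] ℝ => L (EuclideanSpace.single i 1)) (h1.mul h2.hasFDerivAt).fderiv
  have h5 : fderiv ℝ (fun x : Bos m => powLog p A B (‖x‖ ^ 2)) x (EuclideanSpace.single i 1) = _ :=
    pderiv_powLog_norm_sq p A B i hx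
  rw [h4]
  simp [h5]
  ring

/-- The logarithm costs at most a factor `‖x‖^{-1/2}`. -/
lemma exists_abs_powLog_norm_sq_le (p A B R : ℝ) :
    ∃ C, 0 ≤ C ∧ ∀ x : Bos m, x ≠ 0 → ‖x‖ ≤ R →
      |powLog p A B (‖x‖ ^ 2)| ≤ C * ‖x‖ ^ (2 * p - 1 / 2) := by
  set T : ℝ := max R 1 ^ 2 with hT
  have hT1 : 1 ≤ T := one_le_pow₀ (le_max_right R 1)
  have hq : (0 : ℝ) < 1 / 4 := by norm_num
  -- The bound on `t^{1/4} |log t|` is `4` for `t ≤ 1`, and `T^{1/4} T` for `1 ≤ t ≤ T`.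
  refine ⟨|A| * (4 + T * T ^ (1 / 4 : ℝ)) + |B| * T ^ (1 / 4 : ℝ), by positivity, fun x hx hR => ?_⟩
  have hxp := norm_pos_iff.2 hx
  have ht : 0 < ‖x‖ ^ 2 := pow_pos hxp 2
  have htT : ‖x‖ ^ 2 ≤ T := pow_le_pow_left₀ hxp.le (hR.trans (le_max_left R 1)) 2
  have hlog : |Real.log (‖x‖ ^ 2)| * (‖x‖ ^ 2) ^ (1 / 4 : ℝ) ≤ 4 + T * T ^ (1 / 4 : ℝ) := by
    rcases le_total (‖x‖ ^ 2) 1 with h | h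
    · have h1 := (Real.abs_log_mul_self_rpow_lt _ _ ht h hq).le
      rw [abs_mul, abs_of_nonneg (by positivity : 0 ≤ (‖x‖ ^ 2) ^ (1 / 4 : ℝ))] at h1
      have : 0 ≤ T * T ^ (1 / 4 : ℝ) := by positivity
      norm_num at h1 ⊢
      linarith
    · rw [abs_of_nonneg (Real.log_nonneg h)]
      have : Real.log (‖x‖ ^ 2) * (‖x‖ ^ 2) ^ (1 / 4 : ℝ) ≤ T * T ^ (1 / 4 : ℝ) := by
        refine mul_le_mul ((Real.log_le_self ht.le).trans htT) ?_ (by positivity) (by positivity)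
        exact Real.rpow_le_rpow ht.le htT hq.le
      linarith
  have hB : (‖x‖ ^ 2) ^ (1 / 4 : ℝ) ≤ T ^ (1 / 4 : ℝ) := Real.rpow_le_rpow ht.le htT hq.le
  have e : (‖x‖ ^ 2) ^ p = (‖x‖ ^ 2) ^ (1 / 4 : ℝ) * ‖x‖ ^ (2 * p - 1 / 2) := by
    rw [← Real.rpow_natCast, ← Real.rpow_mul hxp.le, ← Real.rpow_mul hxp.le, ← Real.rpow_add hxp]
    congr 1
    push_cast
    ring
  rw [powLog, e, mul_right_comm, abs_mul, abs_of_nonneg (by positivity : 0 ≤ ‖x‖ ^ (2 * p - 1 / 2))]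
  refine mul_le_mul_of_nonneg_right ?_ (by positivity)
  rw [abs_mul, abs_of_nonneg (by positivity : 0 ≤ (‖x‖ ^ 2) ^ (1 / 4 : ℝ))]
  calc (‖x‖ ^ 2) ^ (1 / 4 : ℝ) * |A * Real.log (‖x‖ ^ 2) + B|
      ≤ (‖x‖ ^ 2) ^ (1 / 4 : ℝ) * (|A| * |Real.log (‖x‖ ^ 2)| + |B|) := by
        gcongr
        rw [← abs_mul]
        exact abs_add_le _ _
    _ = |A| * (|Real.log (‖x‖ ^ 2)| * (‖x‖ ^ 2) ^ (1 / 4 : ℝ)) + |B| * (‖x‖ ^ 2) ^ (1 / 4 : ℝ) := by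
        ring
    _ ≤ _ := by gcongr

lemma hasOrder_powLog (p A B : ℝ) :
    HasOrder (2 * p - 1 / 2) fun x : Bos m => powLog p A B (‖x‖ ^ 2) :=
  ⟨(contDiffOn_powLog_norm_sq p A B).continuousOn, exists_abs_powLog_norm_sq_le p A B⟩

end PowLog

/-! ### Fundamental solutions of the powers of the Dirac operator -/

section Fundamental
variable {m : ℕ}

/-- The area of the unit sphere. -/
noncomputable def sphereArea (m : ℕ) : ℝ := (volume : Measure (Bos m)).toSphere.real univ

lemma sphereArea_pos (hm : 0 < m) : 0 < sphereArea m := by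
  have : Nonempty (Fin m) := ⟨⟨0, hm⟩⟩
  rw [sphereArea, Measure.toSphere_real_apply_univ, finrank_euclideanSpace_fin]
  have : 0 < (volume : Measure (Bos m)).real (Metric.ball 0 1) :=
    ENNReal.toReal_pos (Metric.measure_ball_pos _ _ one_pos).ne' measure_ball_lt_top.ne
  positivity

/-- The coefficients `(A_k, B_k)` satisfy the equations that make the radial functions
`t^{p_k} (A_k log t + B_k)`, `t = ‖x‖²`, `p_k = k + 1 - m/2`, successive fundamental solutions of the powers of
the Laplacian. -/
lemma exists_coefficients (m : ℕ) (c : ℝ) : ∃ A B : ℕ → ℝ,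
    ((1 - m / 2 : ℝ) * A 0 = 0 ∧ (1 - m / 2 : ℝ) * B 0 + A 0 = c) ∧
    ∀ k : ℕ, 4 * (k + 1) * ((k + 2 - m / 2 : ℝ) * A (k + 1)) = -A k ∧
      4 * (k + 1) * ((k + 2 - m / 2 : ℝ) * B (k + 1) + A (k + 1))
        + 4 * ((k + 2 - m / 2 : ℝ) * A (k + 1)) = -B k := by
  classical
  let p : ℕ → ℝ := fun k => k + 1 - m / 2
  -- A logarithm enters exactly when the exponent passes through zero.
  let step : ℕ → ℝ × ℝ → ℝ × ℝ := fun k w =>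
    if p (k + 1) = 0 then (-w.2 / (4 * (k + 1)), 0)
    else (-w.1 / (4 * (k + 1) * p (k + 1)),
      (-w.2 + w.1 / (k + 1) + w.1 / p (k + 1)) / (4 * (k + 1) * p (k + 1)))
  let w : ℕ → ℝ × ℝ := fun k => Nat.rec (if p 0 = 0 then (c, 0) else (0, c / p 0)) step k
  have hw0 : w 0 = if p 0 = 0 then (c, 0) else (0, c / p 0) := rfl
  have hws : ∀ k, w (k + 1) = step k (w k) := fun k => rfl
  have hp : ∀ k, p (k + 1) = p k + 1 := fun k => by simp only [p]; push_cast; ring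
  -- No logarithm appears as long as the exponent is negative.
  have hneg : ∀ k, p k < 0 → (w k).1 = 0 := by
    intro k
    induction k with
    | zero =>
      intro h
      rw [hw0, if_neg h.ne]
    | succ k ih =>
      intro h
      rw [hws]
      simp only [step]
      rw [if_neg h.ne, ih (by rw [hp] at h; linarith)]
      simp
  refine ⟨fun k => (w k).1, fun k => (w k).2, ?_, fun k => ?_⟩
  · have e : (1 - m / 2 : ℝ) = p 0 := by simp [p]
    rw [e]
    by_cases h : p 0 = 0
    · simp [hw0, h]
    · simp only [hw0, h, if_false]
      constructor
      · simp
      · field_simp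
        ring
  · have e : (k + 2 - m / 2 : ℝ) = p (k + 1) := by simp only [p]; push_cast; ring
    have hk : (k + 1 : ℝ) ≠ 0 := by positivity
    rw [e]
    simp only [hws]
    simp only [step]
    by_cases h : p (k + 1) = 0
    · have h0 : (w k).1 = 0 := hneg k (by rw [hp] at h; linarith)
      simp only [h, if_true, h0]
      constructor
      · simp
      · field_simp
        ring
    · simp only [h, if_false]
      constructor
      · field_simp
      · field_simp
        ring

/-- The kernel `x / (σ ‖x‖^m)` is a fundamental solution of the Dirac operator: in polar coordinates the
integrand is the derivative of `φ` along rays. -/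
lemma sum_integral_coord_mul_pderiv (hm : 0 < m) {φ : Bos m → ℝ} (hφ : ContDiff ℝ ∞ φ)
    (hφc : HasCompactSupport φ)
    (hint : ∀ i : Fin m, Integrable fun x : Bos m => x i * ‖x‖ ^ (-(m : ℝ)) * pderiv i φ x) :
    ∑ i, ∫ x : Bos m, x i * ‖x‖ ^ (-(m : ℝ)) * pderiv i φ x = -(sphereArea m * φ 0) := by
  have hφ1 : ContDiff ℝ 1 φ := hφ.of_le (by exact_mod_cast le_top)
  rw [← integral_finsetSum _ fun i _ => hint i, integral_polar hm (integrable_finsetSum _ fun i _ => hint i)]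
  have hray : ∀ ξ : Metric.sphere (0 : Bos m) 1,
      ∫ r in Ioi (0 : ℝ), r ^ (m - 1) * ∑ i, (r • (ξ : Bos m)) i * ‖r • (ξ : Bos m)‖ ^ (-(m : ℝ)) *
        pderiv i φ (r • (ξ : Bos m)) = -φ 0 := by
    intro ξ
    have hξ : ‖(ξ : Bos m)‖ = 1 := norm_eq_of_mem_sphere ξ
    have hc : ContDiff ℝ 1 fun r : ℝ => φ (r • (ξ : Bos m)) :=
      hφ1.comp (contDiff_id.smul contDiff_const)
    have hcs : HasCompactSupport fun r : ℝ => φ (r • (ξ : Bos m)) := by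
      refine hφc.comp_isClosedEmbedding (isClosedEmbedding_smul_left ?_)
      rw [← norm_ne_zero_iff, hξ]
      exact one_ne_zero
    have h1 := hcs.integral_Ioi_deriv_eq hc 0
    rw [zero_smul] at h1
    rw [← h1]
    refine setIntegral_congr_fun measurableSet_Ioi fun r hr => ?_
    have hr : 0 < r := hr
    have hd : deriv (fun r : ℝ => φ (r • (ξ : Bos m))) r = fderiv ℝ φ (r • (ξ : Bos m)) (ξ : Bos m) := by
      have h2 : HasDerivAt (fun r : ℝ => r • (ξ : Bos m)) (ξ : Bos m) r := by
        simpa using (hasDerivAt_id r).smul_const (ξ : Bos m)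
      exact ((hφ1.differentiable (by simp) _).hasFDerivAt.comp_hasDerivAt r h2).deriv
    have hξsum : (ξ : Bos m) = ∑ i, (ξ : Bos m) i • EuclideanSpace.single i (1 : ℝ) := by
      ext j
      simp [Pi.single_apply]
    have hpow : r ^ (m - 1) * (r * r ^ (-(m : ℝ))) = 1 := by
      rw [← mul_assoc, ← pow_succ, Nat.sub_add_cancel hm, ← Real.rpow_natCast, ← Real.rpow_add hr]
      simp
    simp only [hd]
    conv_rhs => rw [hξsum, map_sum]
    rw [← hξsum, Finset.mul_sum]
    refine Finset.sum_congr rfl fun i _ => ?_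
    rw [norm_smul, hξ, mul_one, Real.norm_of_nonneg hr.le, map_smul]
    simp only [PiLp.smul_apply, smul_eq_mul, pderiv]
    linear_combination ((ξ : Bos m) i * fderiv ℝ φ (r • (ξ : Bos m)) (EuclideanSpace.single i 1)) * hpow
  simp only [hray]
  rw [integral_const, smul_eq_mul, sphereArea, mul_neg]

/-- Fundamental solutions of all powers of the Dirac operator, as radial functions and their
gradients. -/
theorem exists_isFundamentalFamily (hm : 0 < m) :
    ∃ (s : ℕ → Bos m → ℝ) (v : ℕ → Fin m → Bos m → ℝ), IsFundamentalFamily m s v := by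
  obtain ⟨A, B, ⟨hA0, hB0⟩, hAB⟩ := exists_coefficients m (-(2 * sphereArea m)⁻¹)
  have hσ := sphereArea_pos hm
  let p : ℕ → ℝ := fun k => k + 1 - m / 2
  let s : ℕ → Bos m → ℝ := fun k x => powLog (p k) (A k) (B k) (‖x‖ ^ 2)
  let A' : ℕ → ℝ := fun k => p k * A k
  let B' : ℕ → ℝ := fun k => p k * B k + A k
  let v : ℕ → Fin m → Bos m → ℝ := fun k i x => -2 * x i * powLog (p k - 1) (A' k) (B' k) (‖x‖ ^ 2)
  have hsO : ∀ k, HasOrder (2 * p k - 1 / 2) (s k) := fun k => hasOrder_powLog _ _ _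
  have hvO : ∀ k i, HasOrder (2 * p k - 3 / 2) (v k i) := by
    intro k i
    have := ((hasOrder_coord i).const_mul (-2)).mul (hasOrder_powLog (m := m) (p k - 1) (A' k) (B' k))
    rwa [show 1 + (2 * (p k - 1) - 1 / 2) = 2 * p k - 3 / 2 by ring] at this
  have hpk : ∀ k, 2 * p k = 2 * k + 2 - m := fun k => by simp only [p]; ring
  have hk0 : ∀ k : ℕ, (0 : ℝ) ≤ k := fun k => k.cast_nonneg
  have hsm : ∀ k, ContDiffOn ℝ ∞ (s k) {0}ᶜ := fun k => contDiffOn_powLog_norm_sq _ _ _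
  have hvm : ∀ k i, ContDiffOn ℝ ∞ (v k i) {0}ᶜ := fun k i =>
    (contDiffOn_const.mul (contDiff_piLp_apply (p := 2)).contDiffOn).mul
      (contDiffOn_powLog_norm_sq _ _ _)
  have hvi : ∀ k i, LocallyIntegrable (v k i) volume := fun k i =>
    (hvO k i).locallyIntegrable hm (by rw [hpk]; linarith [hk0 k])
  have hsi : ∀ k, LocallyIntegrable (s k) volume := fun k =>
    (hsO k).locallyIntegrable hm (by rw [hpk]; linarith [hk0 k])
  refine ⟨s, v, hsi, hvi, hsm, hvm, ?_, ?_, ?_⟩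
  · intro k i φ hφ hφc
    have h := (hsO k).integral_mul_pderiv hm (by rw [hpk]; linarith [hk0 k])
      ((hsm k).of_le (by exact_mod_cast le_top)) ((hvO k i).const_mul (-1))
      (by rw [hpk]; linarith [hk0 k]) i (fun x hx => ?_) hφ hφc
    · rw [h, ← integral_neg]
      congr 1
      funext x
      ring
    · rw [pderiv_powLog_norm_sq _ _ _ i hx]
      simp only [v, A', B']
      ring
  · intro φ hφ hφc
    have hφ1 : ContDiff ℝ 1 φ := hφ.of_le (by exact_mod_cast le_top)
    have hv0 : ∀ (i : Fin m) (x : Bos m), v 0 i x = (sphereArea m)⁻¹ * (x i * ‖x‖ ^ (-(m : ℝ))) := by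
      intro i x
      have e1 : A' 0 = 0 := by simpa [A', p] using hA0
      have e2 : B' 0 = -(2 * sphereArea m)⁻¹ := by simpa [B', p] using hB0
      have e3 : (‖x‖ ^ 2) ^ (p 0 - 1) = ‖x‖ ^ (-(m : ℝ)) := by
        rw [← Real.rpow_natCast, ← Real.rpow_mul (norm_nonneg x)]
        congr 1
        simp [p]
        ring
      simp only [v, powLog, e1, e2, e3]
      field_simp
      ring
    have hi : ∀ i : Fin m, Integrable fun x : Bos m => x i * ‖x‖ ^ (-(m : ℝ)) * pderiv i φ x := by
      intro i
      have := (integrable_mul_of_locallyIntegrable (hvi 0 i) (pderiv_continuous hφ1 i)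
        (pderiv_hasCompactSupport hφc i)).const_mul (sphereArea m)
      refine this.congr (ae_of_all _ fun x => ?_)
      simp only [hv0]
      field_simp
    simp only [hv0, mul_assoc ((sphereArea m)⁻¹), integral_const_mul]
    rw [← Finset.mul_sum, sum_integral_coord_mul_pderiv hm hφ hφc hi]
    field_simp
  · intro k φ hφ hφc
    let d : Fin m → Bos m → ℝ := fun i x => -2 * powLog (p (k + 1) - 1) (A' (k + 1)) (B' (k + 1)) (‖x‖ ^ 2)
      + -2 * x i * (2 * x i * powLog (p (k + 1) - 1 - 1) ((p (k + 1) - 1) * A' (k + 1))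
        ((p (k + 1) - 1) * B' (k + 1) + A' (k + 1)) (‖x‖ ^ 2))
    have hdO : ∀ i, HasOrder (2 * p (k + 1) - 5 / 2) (d i) := by
      intro i
      have h1 := (hasOrder_powLog (m := m) (p (k + 1) - 1) (A' (k + 1)) (B' (k + 1))).const_mul (-2)
      have h2 := ((hasOrder_coord i).const_mul (-2)).mul (((hasOrder_coord i).const_mul 2).mul
        (hasOrder_powLog (m := m) (p (k + 1) - 1 - 1) ((p (k + 1) - 1) * A' (k + 1))
        ((p (k + 1) - 1) * B' (k + 1) + A' (k + 1))))
      rw [show 2 * (p (k + 1) - 1) - 1 / 2 = 2 * p (k + 1) - 5 / 2 by ring] at h1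
      rw [show 1 + (1 + (2 * (p (k + 1) - 1 - 1) - 1 / 2)) = 2 * p (k + 1) - 5 / 2 by ring] at h2
      exact h1.add h2
    have hdb : -(m : ℝ) < 2 * p (k + 1) - 5 / 2 := by
      rw [hpk]
      push_cast
      linarith [hk0 k]
    have hdi : ∀ i, Integrable fun x => d i x * φ x := fun i =>
      integrable_mul_of_locallyIntegrable ((hdO i).locallyIntegrable hm hdb) hφ.continuous hφc
    have h : ∀ i, ∫ x, v (k + 1) i x * pderiv i φ x = -∫ x, d i x * φ x := fun i =>
      (hvO (k + 1) i).integral_mul_pderiv hm (by rw [hpk]; push_cast; linarith [hk0 k])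
        ((hvm (k + 1) i).of_le (by exact_mod_cast le_top)) (hdO i) hdb i
        (fun x hx => pderiv_coord_mul_powLog_norm_sq _ _ _ _ i hx) hφ hφc
    simp only [h, Finset.sum_neg_distrib, neg_neg]
    rw [← integral_finsetSum _ fun i _ => hdi i]
    refine integral_congr_ae ?_
    filter_upwards [ae_ne_zero hm] with x hx
    rw [← Finset.sum_mul]
    congr 1
    have hx2 : 0 < ‖x‖ ^ 2 := pow_pos (norm_pos_iff.2 hx) 2
    have hnorm : ∑ i, x i * x i = ‖x‖ ^ 2 := by
      rw [EuclideanSpace.real_norm_sq_eq]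
      simp only [sq]
    simp only [d]
    rw [Finset.sum_add_distrib, Finset.sum_const, Finset.card_univ, Fintype.card_fin, nsmul_eq_mul]
    have hsum : ∀ w : ℝ, ∑ i, -2 * x i * (2 * x i * w) = -4 * (‖x‖ ^ 2 * w) := by
      intro w
      rw [← hnorm, Finset.sum_mul, Finset.mul_sum]
      refine Finset.sum_congr rfl fun i _ => ?_
      ring
    rw [hsum, mul_powLog_sub_one _ _ _ hx2]
    have ep : p (k + 1) = k + 2 - m / 2 := by simp only [p]; push_cast; ring
    have ep' : p (k + 1) - 1 = p k := by simp only [p]; push_cast; ring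
    obtain ⟨h1, h2⟩ := hAB k
    rw [← ep] at h1 h2
    simp only [s, powLog, ep', A', B']
    -- The radial equation `4 t g'' + 2 m g' = -s`, compared coefficientwise.
    have em : (m : ℝ) = 2 * (k + 1) - 2 * p k := by simp only [p]; ring
    rw [em]
    linear_combination -(‖x‖ ^ 2) ^ p k * Real.log (‖x‖ ^ 2) * h1 - (‖x‖ ^ 2) ^ p k * h2

end Fundamental

end SuperCauchy

theorem theorem5p7 (m n : ℕ) (hm : 0 < m) :
    (∃ (s : ℕ → Bos m → ℝ) (v : ℕ → Fin m → Bos m → ℝ), IsFundamentalFamily m s v) ∧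
    ∀ (s : ℕ → Bos m → ℝ) (v : ℕ → Fin m → Bos m → ℝ), IsFundamentalFamily m s v →
    ∀ (Ω U : Set (Bos m)), IsOpen Ω → Metric.closedBall (0 : Bos m) 1 ⊆ Ω →
      IsOpen U → Metric.sphere (0 : Bos m) 1 ⊆ U →
    ∀ f : SuperFun m n, f.CkOn 1 Ω → f.CkOn n U →
    ∀ y ∈ Ω, ‖y‖ ≠ 1 →
      ∃ I J : SuperAlg m n,
        IsSupersphereIntegral (fun x => kernel s v (x - y) * xvec x * f.eval xf x) I ∧
        IsSuperballIntegral (fun x => kernel s v (x - y) * dirac f x) J ∧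
        (‖y‖ < 1 → I + J = -f.eval yf y) ∧
        (1 < ‖y‖ → I + J = 0) := by
  refine ⟨exists_isFundamentalFamily hm, ?_⟩
  intro s v h Ω U hΩ hB hU hS f hf hfU y _ hy
  obtain ⟨V, hV, hSV, I, J, hφ, h1, h2⟩ :=
    (superCalculus m n).cauchyPompeiu hm h hΩ hB hU hS f hf hfU hy
  simp only [superCalculus_kernel, superCalculus_dirac] at hφ
  refine ⟨I, J, ⟨⟨V, hV, hSV, fun φ => (hφ φ).1⟩, fun φ => (hφ φ).2.2.2.1⟩,
    ⟨⟨V, hV, hSV, fun φ => (hφ φ).2.1⟩, fun φ => ⟨(hφ φ).2.2.1, ?_⟩⟩, h1, h2⟩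
  have e : Finset.Icc 1 n = Finset.Ico 1 (n + 1) := by ext; simp
  rw [e, Finset.sum_Ico_eq_sum_range]
  simp only [add_comm 1, Nat.add_sub_cancel]
  exact (hφ φ).2.2.2.2
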